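/- Let $\mathbf{k}$ be a commutative ring and let $\delta\in\mathbf{k}$. **Species.** Let $\mathbf{FB}$ be the category of finite sets and bijections. An $\mathbf{FB}$-module (linear species) is a functor from $\mathbf{FB}$ to $\mathbf{k}$-modules. $\mathbf{FB}$-modules form a symmetric monoidal category under $(M\otimes N)(S)=\bigoplus_{T\subseteq S}M(T)\otimes N(S\setminus T)$ with the evident symmetry $M\otimes N\cong N\otimes M$. Let $\mathbf{V}$ be the $\mathbf{FB}$-module that is $\mathbf{k}$ on one-element sets, with basis $t^i$ on $\{i\}$, and $0$ on all other sets. $\mathrm{Div}^2\mathbf{V}$ (the invariants of $\mathfrak{S}_2$ on $\mathbf{V}\otimes\mathbf{V}$) and $\mathrm{Sym}^2\mathbf{V}$ (the coinvariants) are both $\mathbf{k}$ on two-element sets, with basis $t^{\{i,j\}}$ on $\{i,j\}$, and $0$ on all other sets; the comultiplication $\Delta\colon\mathrm{Div}^2\mathbf{V}\to\mathbf{V}\otimes\mathbf{V}$ is $t^{\{i,j\}}\mapsto t^i\otimes t^j+t^j\otimes t^i$, and the multiplication $m\colon\mathbf{V}\otimes\mathbf{V}\to\mathrm{Sym}^2\mathbf{V}$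 is $t^i\otimes t^j\mapsto t^{\{i,j\}}$. **Curried algebras.** A representation of the curried general linear Lie algebra $\underline{\mathfrak{gl}}(\mathbf{V})$ on an $\mathbf{FB}$-module $M$ is a map $a\colon\mathbf{V}\otimes M\to\mathbf{V}\otimes M$ with $[a_1,a_2]=\tau(a_1-a_2)$ on $\mathbf{V}\otimes\mathbf{V}\otimes M$, where $\tau$ interchanges the two factors $\mathbf{V}$, $a_2=\mathrm{id}\otimes a$ and $a_1=\tau a_2\tau$. On a tensor product, one takes the sum of the action maps on the two factors. $\mathbf{V}$ carries the representation given by the interchange of $\mathbf{V}\otimes\mathbf{V}$; the representations that it induces on $\mathrm{Div}^2\mathbf{V}\subset\mathbf{V}^{\otimes2}$ and on the quotient $\mathrm{Sym}^2\mathbf{V}$ of $\mathbf{V}^{\otimes 2}$ are called natural (explicitly, $t^i\otimes t^{\{j,k\}}\mapsto t^j\otimes t^{\{i,k\}}+t^k\otimes t^{\{i,j\}}$). A module over the curried symplectic algebra $\underline{\mathfrak{sp}}(\mathbf{V}\oplus\mathbf{V}^*)$ is an $\mathbf{FB}$-module $M$ with maps $$a\colon\mathbf{V}\otimes M\to\mathbf{V}\otimes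 M,\qquad b\colon\mathrm{Div}^2\mathbf{V}\otimes M\to M,\qquad b'\colon M\to\mathrm{Sym}^2\mathbf{V}\otimes M$$ such that (a) $a$ is a representation of $\underline{\mathfrak{gl}}(\mathbf{V})$; (b) $bb_2=bb_1$ as maps $\mathrm{Div}^2\mathbf{V}\otimes\mathrm{Div}^2\mathbf{V}\otimes M\to M$, and $b'_1b'=b'_2b'$ as maps $M\to\mathrm{Sym}^2\mathbf{V}\otimes\mathrm{Sym}^2\mathbf{V}\otimes M$, the index telling on which of the two squares a map operates; (c) $b$ and $b'$ are maps of $\underline{\mathfrak{gl}}(\mathbf{V})$-representations, for the natural representations on $\mathrm{Div}^2\mathbf{V}$ and $\mathrm{Sym}^2\mathbf{V}$; (d) $b'b-b_1b'_2=(m\otimes1)(1\otimes a)(\Delta\otimes1)$ as maps $\mathrm{Div}^2\mathbf{V}\otimes M\to\mathrm{Sym}^2\mathbf{V}\otimes M$. Morphisms are the maps of $\mathbf{FB}$-modules that commute with $a$, $b$ and $b'$. The module is $\delta$-standard if $a$ is the $\delta$-standard map, i.e., for all finite sets $S$, $j\in S$ and $x\in M(S\setminus j)$, $$a(t^j\otimes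 x)=\delta\,t^j\otimes x+\sum_{i\in S\setminus j}t^i\otimes(\iota^S_{i,j})_*(x),$$ where $\iota^S_{i,j}\colon S\setminus j\to S\setminus i$ is the bijection that sends $i$ to $j$ and fixes all other elements. Let $\mathrm{Rep}_\delta(\underline{\mathfrak{sp}}(\mathbf{V}\oplus\mathbf{V}^*))$ be the full subcategory of $\delta$-standard modules. **Brauer category.** Let $\mathfrak{G}(2\delta)$ be the Brauer category with parameter $2\delta$: its objects are the finite sets, $\mathrm{Hom}(S,T)$ is the free $\mathbf{k}$-module on the perfect matchings of $S\amalg T$ (Brauer diagrams), and diagrams are composed by stacking them, each closed loop being replaced by a factor $2\delta$. A $\mathfrak{G}(2\delta)$-module is a $\mathbf{k}$-linear functor from $\mathfrak{G}(2\delta)$ to $\mathbf{k}$-modules, and morphisms of modules are natural transformations. For $i\neq j$ in a finite set $S$, let $\eta^S_{i,j}\colon S\setminus\{i,j\}\to S$ be the diagram with an edge between $i$ and $j$ in the target and that is the identity elsewhere, and let $(\eta')^S_{i,j}\colon S\to S\setminus\{i,j\}$ be the opposite diagram. **Theorem.** For every $\mathfrak{G}(2\delta)$-module $M$, the restriction of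 $M$ to $\mathbf{FB}$ with the $\delta$-standard map $a$ and the maps $$b(t^{\{i,j\}}\otimes x)=M(\eta^S_{i,j})(x),\qquad b'(y)=\sum_{\{i,j\}\subseteq S}t^{\{i,j\}}\otimes M((\eta')^S_{i,j})(y)\qquad(x\in M(S\setminus\{i,j\}),\ y\in M(S))$$ is a $\delta$-standard $\underline{\mathfrak{sp}}(\mathbf{V}\oplus\mathbf{V}^*)$-module $\Phi(M)$. The functor $$\Phi\colon\mathrm{Mod}_{\mathfrak{G}(2\delta)}\to\mathrm{Rep}_\delta(\underline{\mathfrak{sp}}(\mathbf{V}\oplus\mathbf{V}^*)),$$ which sends a morphism of $\mathfrak{G}(2\delta)$-modules to the same map of underlying $\mathbf{FB}$-modules, is an isomorphism of categories: there is a functor $\Psi$ in the opposite direction such that $\Psi\Phi$ and $\Phi\Psi$ are equal to the identity functors. -/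

import Mathlib

open CategoryTheory MonoidalCategory Limits

universe u

/-- Finite sets; the morphisms of the category `FB` are the bijections. -/
structure FB : Type 1 where
  of ::
  carrier : Type
  [finite : Finite carrier]

namespace FB

instance : CoeSort FB Type := ⟨FB.carrier⟩

attribute [instance] FB.finite

instance : Category FB where
  Hom S T := S ≃ T
  id S := Equiv.refl S
  comp f g := f.trans g

/-- A subset of a finite set, as a finite set. -/
abbrev sub {S : FB} (T : Set S) : FB := FB.of T

/-- Disjoint union. -/
abbrev sum (A B : FB) : FB := FB.of (A ⊕ B)

end FB

/-- Linear species (`FB`-modules) over a commutative ring `k`: functors from `FB` to `k`-modules. -/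
def FBMod (k : Type u) [CommRing k] : Type (max 1 (u + 1)) := FB ⥤ ModuleCat.{u} k

namespace FBMod

noncomputable section

variable (k : Type u) [CommRing k]

instance : Category (FBMod k) := inferInstanceAs (Category (FB ⥤ ModuleCat.{u} k))
instance : Preadditive (FBMod k) := inferInstanceAs (Preadditive (FB ⥤ ModuleCat.{u} k))
instance : Linear k (FBMod k) := inferInstanceAs (Linear k (FB ⥤ ModuleCat.{u} k))

variable {k}

/-- The underlying functor of a species. -/
abbrev toF (M : FBMod k) : FB ⥤ ModuleCat.{u} k := M

/-- The value of a species on a finite set. -/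
abbrev ev (M : FBMod k) (S : FB) : ModuleCat.{u} k := M.toF.obj S

/-- The action of a bijection on a species. -/
def mp (M : FBMod k) {S T : FB} (f : S ≃ T) : M.ev S →ₗ[k] M.ev T :=
  (M.toF.map (X := S) (Y := T) f).hom

/-- The component of a morphism of species. -/
def app {M N : FBMod k} (f : M ⟶ N) (S : FB) : M.ev S →ₗ[k] N.ev S :=
  (NatTrans.app (show M.toF ⟶ N.toF from f) S).hom

@[simp] theorem mp_refl (M : FBMod k) {S : FB} (x : M.ev S) : M.mp (Equiv.refl S) x = x := by
  have := M.toF.map_id S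
  exact congrArg (fun f => f.hom x) this

@[simp] theorem mp_mp (M : FBMod k) {S T U : FB} (f : S ≃ T) (g : T ≃ U) (x : M.ev S) :
    M.mp g (M.mp f x) = M.mp (f.trans g) x := by
  have := M.toF.map_comp (X := S) (Y := T) (Z := U) f g
  exact (congrArg (fun f => f.hom x) this).symm

@[simp] theorem app_mp {M N : FBMod k} (φ : M ⟶ N) {S T : FB} (f : S ≃ T) (x : M.ev S) :
    app φ T (M.mp f x) = N.mp f (app φ S x) := by
  have := NatTrans.naturality (show M.toF ⟶ N.toF from φ) (X := S) (Y := T) f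
  exact (congrArg (fun f => f.hom x) this)

@[simp] theorem app_id (M : FBMod k) (S : FB) (x : M.ev S) : app (𝟙 M) S x = x := rfl
@[simp] theorem app_comp {M N P : FBMod k} (f : M ⟶ N) (g : N ⟶ P) (S : FB) (x : M.ev S) :
    app (f ≫ g) S x = app g S (app f S x) := rfl
@[simp] theorem app_add {M N : FBMod k} (f g : M ⟶ N) (S : FB) (x : M.ev S) :
    app (f + g) S x = app f S x + app g S x := rfl
@[simp] theorem app_sub {M N : FBMod k} (f g : M ⟶ N) (S : FB) (x : M.ev S) :
    app (f - g) S x = app f S x - app g S x := rfl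
@[simp] theorem app_smul {M N : FBMod k} (c : k) (f : M ⟶ N) (S : FB) (x : M.ev S) :
    app (c • f) S x = c • app f S x := rfl

theorem hom_ext {M N : FBMod k} {f g : M ⟶ N} (h : ∀ S, app f S = app g S) : f = g := by
  apply NatTrans.ext
  funext S
  exact ModuleCat.hom_ext (h S)

/-- Constructor for species. -/
def mk' (X : FB → Type u) [∀ S, AddCommGroup (X S)] [∀ S, Module k (X S)]
    (r : ∀ S T : FB, (S ≃ T) → X S →ₗ[k] X T)
    (h1 : ∀ (S : FB) (x : X S), r S S (Equiv.refl S) x = x)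
    (h2 : ∀ {S T U : FB} (f : S ≃ T) (g : T ≃ U) (x : X S), r T U g (r S T f x) = r S U (f.trans g) x) :
    FBMod k :=
  show FB ⥤ ModuleCat.{u} k from
  { obj S := ModuleCat.of k (X S)
    map {S T} f := ModuleCat.ofHom (r S T f)
    map_id S := ModuleCat.hom_ext (LinearMap.ext (h1 S))
    map_comp _ _ := ModuleCat.hom_ext (LinearMap.ext fun x => (h2 _ _ x).symm) }

/-- Constructor for morphisms of species. -/
def homMk {M N : FBMod k} (r : ∀ S : FB, M.ev S →ₗ[k] N.ev S)
    (h : ∀ {S T : FB} (f : S ≃ T) (x : M.ev S), r T (M.mp f x) = N.mp f (r S x)) : M ⟶ N :=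
  show M.toF ⟶ N.toF from
  { app S := ModuleCat.ofHom (r S)
    naturality _ _ f := ModuleCat.hom_ext (LinearMap.ext fun x => h f x) }

@[simp] theorem app_homMk {M N : FBMod k} (r : ∀ S : FB, M.ev S →ₗ[k] N.ev S) (h) (S : FB) :
    app (homMk (M := M) (N := N) r h) S = r S := rfl

open scoped TensorProduct DirectSum

/-- `⨁_{T ⊆ S} M(T) ⊗ N(S \ T)`. -/
abbrev TensorEv (M N : FBMod k) (S : FB) : Type u :=
  ⨁ T : Set S, (M.ev (FB.sub T) ⊗[k] N.ev (FB.sub Tᶜ))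

open Classical in
/-- The inclusion of the summand of `T ⊆ S`. -/
def summand (M N : FBMod k) {S : FB} (T : Set S) :
    M.ev (FB.sub T) ⊗[k] N.ev (FB.sub Tᶜ) →ₗ[k] TensorEv M N S :=
  DirectSum.lof k (Set S) (fun T => M.ev (FB.sub T) ⊗[k] N.ev (FB.sub Tᶜ)) T

theorem summand_congr (M N : FBMod k) {S : FB} {T T' : Set S} (f : T ≃ T')
    (g : (Tᶜ : Set S) ≃ (T'ᶜ : Set S)) (hf : ∀ x, (f x : S) = x) (hg : ∀ x, (g x : S) = x)
    (m : M.ev (FB.sub T)) (n : N.ev (FB.sub Tᶜ)) :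
    summand M N T' (M.mp (S := FB.sub T) (T := FB.sub T') f m ⊗ₜ
      N.mp (S := FB.sub Tᶜ) (T := FB.sub T'ᶜ) g n) = summand M N T (m ⊗ₜ n) := by
  have h : T = T' := by
    ext x
    constructor
    · intro hx
      have := (f ⟨x, hx⟩).2
      rwa [hf] at this
    · intro hx
      have := (f.symm ⟨x, hx⟩).2
      rwa [← hf, Equiv.apply_symm_apply] at this
  subst h
  have hf' : f = Equiv.refl _ := Equiv.ext fun x => Subtype.ext (hf x)
  have hg' : g = Equiv.refl _ := Equiv.ext fun x => Subtype.ext (hg x)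
  subst hf' hg'
  erw [mp_refl, mp_refl]

/-- The bijection from `A` to its image. -/
def leftPart {A B S : FB} (e : A ⊕ B ≃ S) : A ≃ (Set.range fun a => e (Sum.inl a) : Set S) :=
  Equiv.ofInjective _ (e.injective.comp Sum.inl_injective)

/-- The bijection from `B` to the complement of the image of `A`. -/
def rightPart {A B S : FB} (e : A ⊕ B ≃ S) : B ≃ ((Set.range fun a => e (Sum.inl a))ᶜ : Set S) :=
  Equiv.ofBijective (fun b => ⟨e (Sum.inr b), by simp⟩) ⟨fun b b' h => by simpa using h, by
    rintro ⟨s, hs⟩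
    obtain ⟨x, rfl⟩ := e.surjective s
    rcases x with a | b
    · exact absurd ⟨a, rfl⟩ hs
    · exact ⟨b, rfl⟩⟩

@[simp] theorem leftPart_coe {A B S : FB} (e : A ⊕ B ≃ S) (a : A) :
    (leftPart e a : S) = e (Sum.inl a) := rfl
@[simp] theorem rightPart_coe {A B S : FB} (e : A ⊕ B ≃ S) (b : B) :
    (rightPart e b : S) = e (Sum.inr b) := rfl

/-- For a decomposition `e : A ⊔ B ≃ S`, the element `m ⊗ n` of the tensor product. -/
def tmul₀ {M N : FBMod k} {A B S : FB} (e : A ⊕ B ≃ S) : M.ev A →ₗ[k] N.ev B →ₗ[k] TensorEv M N S :=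
  (TensorProduct.mk k _ _).compr₂ (summand M N (Set.range fun a => e (Sum.inl a))) |>.compl₁₂
    (M.mp (T := FB.sub _) (leftPart e)) (N.mp (T := FB.sub _) (rightPart e))

theorem tmul₀_congr {M N : FBMod k} {A B A' B' S : FB} (f : A ≃ A') (g : B ≃ B') (e : A ⊕ B ≃ S)
    (e' : A' ⊕ B' ≃ S) (h : ∀ x, e x = e' (Sum.map f g x)) (m : M.ev A) (n : N.ev B) :
    tmul₀ e' (M.mp f m) (N.mp g n) = tmul₀ e m n := by
  have := summand_congr M N (S := S) (((leftPart e).symm.trans f).trans (leftPart e'))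
    (((rightPart e).symm.trans g).trans (rightPart e'))
    (by
      intro x
      obtain ⟨y, rfl⟩ := (leftPart e).surjective x
      simp [h])
    (by
      intro x
      obtain ⟨y, rfl⟩ := (rightPart e).surjective x
      simp [h])
    (M.mp (T := FB.sub _) (leftPart e) m) (N.mp (T := FB.sub _) (rightPart e) n)
  simp only [mp_mp] at this
  refine Eq.trans ?_ this
  have h1 : f.trans (leftPart e') =
      (leftPart e).trans (((leftPart e).symm.trans f).trans (leftPart e')) := by ext; simp
  have h2 : g.trans (rightPart e') =
      (rightPart e).trans (((rightPart e).symm.trans g).trans (rightPart e')) := by ext; simp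
  simp only [tmul₀, LinearMap.compl₁₂_apply, LinearMap.compr₂_apply, TensorProduct.mk_apply, mp_mp]
  rw [h1, h2]

/-- The decomposition of `S` given by a subset. -/
def cut {S : FB} (T : Set S) : FB.sub T ⊕ FB.sub Tᶜ ≃ S :=
  haveI := Classical.decPred (· ∈ T)
  Equiv.Set.sumCompl T

@[simp] theorem cut_inl {S : FB} (T : Set S) (x : FB.sub T) : cut T (Sum.inl x) = x.1 := rfl
@[simp] theorem cut_inr {S : FB} (T : Set S) (x : FB.sub Tᶜ) : cut T (Sum.inr x) = x.1 := rfl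

theorem tmul₀_cut {M N : FBMod k} {S : FB} (T : Set S) (m : M.ev (FB.sub T))
    (n : N.ev (FB.sub Tᶜ)) : tmul₀ (cut T) m n = summand M N T (m ⊗ₜ n) :=
  summand_congr M N (leftPart (cut T)) (rightPart (cut T)) (fun _ => rfl) (fun _ => rfl) m n

theorem tensor₀_ext {M N : FBMod k} {S : FB} {P : Type*} [AddCommGroup P] [Module k P]
    {φ ψ : TensorEv M N S →ₗ[k] P}
    (h : ∀ (A B : FB) (e : A ⊕ B ≃ S) (m : M.ev A) (n : N.ev B),
      φ (tmul₀ e m n) = ψ (tmul₀ e m n)) : φ = ψ := by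
  classical
  refine DirectSum.linearMap_ext _ fun T => TensorProduct.ext' fun m n => ?_
  have := h _ _ (cut T) m n
  rw [tmul₀_cut] at this
  convert this <;> (unfold summand; congr!)

/-- Linear maps out of a tensor product of species. -/
def desc₀ {M N : FBMod k} {S : FB} {P : Type*} [AddCommGroup P] [Module k P]
    (φ : ∀ {A B : FB}, (A ⊕ B ≃ S) → M.ev A →ₗ[k] N.ev B →ₗ[k] P) : TensorEv M N S →ₗ[k] P :=
  haveI := Classical.decEq (Set S)
  DirectSum.toModule k (Set S) P fun T => TensorProduct.lift (φ (cut T))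

theorem desc₀_tmul₀ {M N : FBMod k} {S : FB} {P : Type*} [AddCommGroup P] [Module k P]
    (φ : ∀ {A B : FB}, (A ⊕ B ≃ S) → M.ev A →ₗ[k] N.ev B →ₗ[k] P)
    (h : ∀ {A B A' B' : FB} (f : A ≃ A') (g : B ≃ B') (e' : A' ⊕ B' ≃ S)
      (m : M.ev A) (n : N.ev B), φ e' (M.mp f m) (N.mp g n) = φ ((Equiv.sumCongr f g).trans e') m n)
    {A B : FB} (e : A ⊕ B ≃ S) (m : M.ev A) (n : N.ev B) :
    desc₀ φ (tmul₀ e m n) = φ e m n := by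
  simp only [tmul₀, LinearMap.compl₁₂_apply, LinearMap.compr₂_apply, TensorProduct.mk_apply, desc₀, summand]
  erw [DirectSum.toModule_lof, TensorProduct.lift.tmul, h]
  have h1 : (Equiv.sumCongr (leftPart e) (rightPart e)).trans (cut _) = e := by
    ext x
    rcases x with x | x <;> rfl
  rw [← h1]
  rfl


/-- The tensor product of species, `(M ⊗ N)(S) = ⨁_{T ⊆ S} M(T) ⊗ N(S \ T)`. -/
def tensorObj (M N : FBMod k) : FBMod k :=
  mk' (TensorEv M N) (fun _ _ u => desc₀ fun e => tmul₀ (e.trans u))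
    (by
      intro S x
      refine LinearMap.congr_fun (g := LinearMap.id) (tensor₀_ext fun A B e m n => ?_) x
      rw [desc₀_tmul₀]
      · rfl
      · intro A B A' B' f g e' m n
        exact tmul₀_congr _ _ _ _ (by rintro (x | x) <;> rfl) _ _)
    (by
      intro S T U f g x
      have key : ∀ {S T : FB} (u : S ≃ T) {A B : FB} (e : A ⊕ B ≃ S) (m : M.ev A) (n : N.ev B),
          (desc₀ fun e => tmul₀ (e.trans u)) (tmul₀ e m n) = tmul₀ (e.trans u) m n := by
        intro S T u A B e m n
        rw [desc₀_tmul₀]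
        intro A B A' B' f g e' m n
        exact tmul₀_congr _ _ _ _ (by rintro (x | x) <;> rfl) _ _
      rw [← LinearMap.comp_apply]
      refine LinearMap.congr_fun (tensor₀_ext fun A B e m n => ?_) x
      rw [LinearMap.comp_apply, key, key, key]
      rfl)

/-- For a decomposition `e : A ⊔ B ≃ S`, the element `m ⊗ n` of `(M ⊗ N)(S)`. -/
def tmul {M N : FBMod k} {A B S : FB} (e : A ⊕ B ≃ S) :
    M.ev A →ₗ[k] N.ev B →ₗ[k] (tensorObj M N).ev S :=
  tmul₀ e

theorem tmul_eq {M N : FBMod k} {A B S : FB} {e e' : A ⊕ B ≃ S} (h : ∀ x, e x = e' x)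
    (m : M.ev A) (n : N.ev B) : tmul e m n = tmul e' m n := by
  rw [Equiv.ext h]

theorem tmul_mp {M N : FBMod k} {A B A' B' S : FB} (f : A ≃ A') (g : B ≃ B')
    (e' : A' ⊕ B' ≃ S) (m : M.ev A) (n : N.ev B) :
    tmul e' (M.mp f m) (N.mp g n) = tmul ((Equiv.sumCongr f g).trans e') m n :=
  tmul₀_congr _ _ _ _ (by rintro (x | x) <;> rfl) _ _

theorem tmul_mp_left {M N : FBMod k} {A B A' S : FB} (f : A ≃ A')
    (e' : A' ⊕ B ≃ S) (m : M.ev A) (n : N.ev B) :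
    tmul e' (M.mp f m) n = tmul ((Equiv.sumCongr f (Equiv.refl _)).trans e') m n := by
  rw [← tmul_mp, mp_refl]

theorem tmul_mp_right {M N : FBMod k} {A B B' S : FB} (g : B ≃ B')
    (e' : A ⊕ B' ≃ S) (m : M.ev A) (n : N.ev B) :
    tmul e' m (N.mp g n) = tmul ((Equiv.sumCongr (Equiv.refl _) g).trans e') m n := by
  rw [← tmul_mp, mp_refl]

theorem mp_tmul {M N : FBMod k} {A B S T : FB} (u : S ≃ T) (e : A ⊕ B ≃ S)
    (m : M.ev A) (n : N.ev B) : (tensorObj M N).mp u (tmul e m n) = tmul (e.trans u) m n := by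
  refine (desc₀_tmul₀ (fun e => tmul₀ (e.trans u)) ?_ e m n)
  intro A B A' B' f g e' m n
  exact tmul₀_congr _ _ _ _ (by rintro (x | x) <;> rfl) _ _

theorem tensor_ext {M N : FBMod k} {S : FB} {P : Type*} [AddCommGroup P] [Module k P]
    {φ ψ : (tensorObj M N).ev S →ₗ[k] P}
    (h : ∀ (A B : FB) (e : A ⊕ B ≃ S) (m : M.ev A) (n : N.ev B),
      φ (tmul e m n) = ψ (tmul e m n)) : φ = ψ :=
  tensor₀_ext h

theorem tensor_hom_ext {M N P : FBMod k} {φ ψ : tensorObj M N ⟶ P}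
    (h : ∀ (S A B : FB) (e : A ⊕ B ≃ S) (m : M.ev A) (n : N.ev B),
      app φ S (tmul e m n) = app ψ S (tmul e m n)) : φ = ψ :=
  hom_ext fun S => tensor_ext (h S)

/-- A family `φ_e(m, n)`, natural in the decomposition `e : A ⊔ B ≃ S`, induces a linear map out
of `(M ⊗ N)(S)`. -/
def desc {M N : FBMod k} {S : FB} {P : Type*} [AddCommGroup P] [Module k P]
    (φ : ∀ {A B : FB}, (A ⊕ B ≃ S) → M.ev A →ₗ[k] N.ev B →ₗ[k] P) :
    (tensorObj M N).ev S →ₗ[k] P :=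
  desc₀ φ

theorem desc_tmul {M N : FBMod k} {S : FB} {P : Type*} [AddCommGroup P] [Module k P]
    (φ : ∀ {A B : FB}, (A ⊕ B ≃ S) → M.ev A →ₗ[k] N.ev B →ₗ[k] P)
    (h : ∀ {A B A' B' : FB} (f : A ≃ A') (g : B ≃ B') (e' : A' ⊕ B' ≃ S)
      (m : M.ev A) (n : N.ev B), φ e' (M.mp f m) (N.mp g n) = φ ((Equiv.sumCongr f g).trans e') m n)
    {A B : FB} (e : A ⊕ B ≃ S) (m : M.ev A) (n : N.ev B) :
    desc φ (tmul e m n) = φ e m n :=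
  desc₀_tmul₀ φ h e m n

/-- Morphisms out of a tensor product of species. -/
def descHom {M N P : FBMod k}
    (φ : ∀ {S A B : FB}, (A ⊕ B ≃ S) → M.ev A →ₗ[k] N.ev B →ₗ[k] P.ev S)
    (h : ∀ {S A B A' B' : FB} (f : A ≃ A') (g : B ≃ B') (e' : A' ⊕ B' ≃ S)
      (m : M.ev A) (n : N.ev B), φ e' (M.mp f m) (N.mp g n) = φ ((Equiv.sumCongr f g).trans e') m n)
    (h' : ∀ {S T A B : FB} (u : S ≃ T) (e : A ⊕ B ≃ S) (m : M.ev A) (n : N.ev B),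
      φ (e.trans u) m n = P.mp u (φ e m n)) : tensorObj M N ⟶ P :=
  homMk (fun S => desc fun e => φ e) (by
    intro S T u x
    rw [← LinearMap.comp_apply, ← LinearMap.comp_apply]
    refine LinearMap.congr_fun (tensor_ext fun A B e m n => ?_) x
    rw [LinearMap.comp_apply, LinearMap.comp_apply, mp_tmul, desc_tmul _ h, desc_tmul _ h, h'])

theorem app_descHom {M N P : FBMod k}
    (φ : ∀ {S A B : FB}, (A ⊕ B ≃ S) → M.ev A →ₗ[k] N.ev B →ₗ[k] P.ev S) (h) (h')
    {S A B : FB} (e : A ⊕ B ≃ S) (m : M.ev A) (n : N.ev B) :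
    app (descHom (M := M) (N := N) (P := P) φ h h') S (tmul e m n) = φ e m n :=
  desc_tmul _ h e m n

/-- The tensor product of morphisms of species. -/
def tensorHom {M N M' N' : FBMod k} (f : M ⟶ M') (g : N ⟶ N') : tensorObj M N ⟶ tensorObj M' N' :=
  descHom (fun {_ A B} e => (tmul e).compl₁₂ (app f A) (app g B))
    (by intros; simp [tmul_mp])
    (by intros; simp [mp_tmul])

theorem app_tensorHom {M N M' N' : FBMod k} (f : M ⟶ M') (g : N ⟶ N') {S A B : FB}
    (e : A ⊕ B ≃ S) (m : M.ev A) (n : N.ev B) :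
    app (tensorHom f g) S (tmul e m n) = tmul e (app f A m) (app g B n) :=
  app_descHom _ _ _ e m n

theorem tensor_induction {M N : FBMod k} {S : FB} {p : (tensorObj M N).ev S → Prop}
    (x : (tensorObj M N).ev S) (add : ∀ x y, p x → p y → p (x + y))
    (tmul : ∀ (A B : FB) (e : A ⊕ B ≃ S) (m : M.ev A) (n : N.ev B), p (tmul e m n)) : p x := by
  classical
  have h0 : p 0 := by
    have := tmul _ _ (cut (∅ : Set S)) 0 0
    rwa [map_zero] at this
  refine DirectSum.induction_on x h0 (fun T y => ?_) add
  refine TensorProduct.induction_on y ?_ (fun m n => ?_) (fun a b ha hb => ?_)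
  · rw [map_zero]
    exact h0
  · have h := tmul _ _ (cut T) m n
    have h' : p (summand M N T (m ⊗ₜ n)) := Eq.subst (motive := p) (tmul₀_cut T m n) h
    exact h'
  · rw [map_add]
    exact add _ _ ha hb

theorem tmul_tmul {M N P : FBMod k} {A B C D S : FB} (e : A ⊕ D ≃ S) (e' : B ⊕ C ≃ D)
    (m : M.ev A) (n : N.ev B) (p : P.ev C) :
    tmul e m (tmul e' n p) = tmul (B := FB.sum B C) ((Equiv.sumCongr (Equiv.refl A) e').trans e) m
      (tmul (S := FB.sum B C) (Equiv.refl (B ⊕ C)) n p) := by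
  rw [← tmul_mp_right, mp_tmul]
  rfl

theorem tmul_tmul_left {M N P : FBMod k} {A B C D S : FB} (e : A ⊕ B ≃ S) (e' : C ⊕ D ≃ A)
    (m : M.ev C) (n : N.ev D) (p : P.ev B) :
    tmul e (tmul e' m n) p = tmul (A := FB.sum C D) ((Equiv.sumCongr e' (Equiv.refl B)).trans e)
      (tmul (S := FB.sum C D) (Equiv.refl (C ⊕ D)) m n) p := by
  rw [← tmul_mp_left, mp_tmul]
  rfl

/-- The component `(M ⊗ N)(A) ⊗ P(B) → (M ⊗ (N ⊗ P))(S)` of the associator. -/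
def assocAux (M N P : FBMod k) {A B S : FB} (e : A ⊕ B ≃ S) :
    (tensorObj M N).ev A →ₗ[k] P.ev B →ₗ[k] (tensorObj M (tensorObj N P)).ev S :=
  desc fun {A₁ A₂} e₁ => LinearMap.mk₂ k
    (fun m n => tmul (B := FB.sum A₂ B)
      (((Equiv.sumAssoc A₁ A₂ B).symm.trans (Equiv.sumCongr e₁ (Equiv.refl B))).trans e) m ∘ₗ
        tmul (S := FB.sum A₂ B) (Equiv.refl (A₂ ⊕ B)) n)
    (by intros; ext; simp) (by intros; ext; simp) (by intros; ext; simp) (by intros; ext; simp)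

theorem assocAux_tmul (M N P : FBMod k) {A A₁ A₂ B S : FB} (e : A ⊕ B ≃ S) (e₁ : A₁ ⊕ A₂ ≃ A)
    (m : M.ev A₁) (n : N.ev A₂) (p : P.ev B) :
    assocAux M N P e (tmul e₁ m n) p = tmul (B := FB.sum A₂ B)
      (((Equiv.sumAssoc A₁ A₂ B).symm.trans (Equiv.sumCongr e₁ (Equiv.refl B))).trans e) m
        (tmul (S := FB.sum A₂ B) (Equiv.refl (A₂ ⊕ B)) n p) := by
  rw [assocAux, desc_tmul]
  · rfl
  · intro A B A' B' f g e' m n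
    ext p
    simp only [LinearMap.mk₂_apply, LinearMap.comp_apply]
    rw [tmul_mp_left, tmul_mp_left, tmul_tmul]
    exact tmul_eq (by rintro (x | x | x) <;> rfl) _ _

/-- `(m ⊗ n) ⊗ p ↦ m ⊗ (n ⊗ p)`. -/
def assocHom (M N P : FBMod k) :
    tensorObj (tensorObj M N) P ⟶ tensorObj M (tensorObj N P) :=
  descHom (fun e => assocAux M N P e)
    (by
      intro S A B A' B' f g e' x p
      induction x using tensor_induction with
      | add x y hx hy => simp only [map_add, LinearMap.add_apply, hx, hy]
      | tmul A₁ A₂ e₁ m n =>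
        rw [mp_tmul, assocAux_tmul, assocAux_tmul, tmul_mp_right, tmul_tmul]
        exact tmul_eq (by rintro (x | x | x) <;> rfl) _ _)
    (by
      intro S T A B u e x p
      induction x using tensor_induction with
      | add x y hx hy => simp only [map_add, LinearMap.add_apply, hx, hy]
      | tmul A₁ A₂ e₁ m n =>
        rw [assocAux_tmul, assocAux_tmul, mp_tmul]
        rfl)

theorem app_assocHom (M N P : FBMod k) {A A₁ A₂ B S : FB} (e : A ⊕ B ≃ S) (e₁ : A₁ ⊕ A₂ ≃ A)
    (m : M.ev A₁) (n : N.ev A₂) (p : P.ev B) :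
    app (assocHom M N P) S (tmul e (tmul e₁ m n) p) = tmul (B := FB.sum A₂ B)
      (((Equiv.sumAssoc A₁ A₂ B).symm.trans (Equiv.sumCongr e₁ (Equiv.refl B))).trans e) m
        (tmul (S := FB.sum A₂ B) (Equiv.refl (A₂ ⊕ B)) n p) :=
  (app_descHom _ _ _ _ _ _).trans (assocAux_tmul M N P e e₁ m n p)

/-- `m ⊗ n ↦ n ⊗ m`. -/
def braidHom (M N : FBMod k) : tensorObj M N ⟶ tensorObj N M :=
  descHom (fun {_ A B} e => (tmul ((Equiv.sumComm B A).trans e)).flip)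
    (by
      intro S A B A' B' f g e' m n
      simp only [LinearMap.flip_apply]
      rw [tmul_mp]
      exact tmul_eq (by rintro (x | x) <;> rfl) _ _)
    (by
      intro S T A B u e m n
      simp only [LinearMap.flip_apply]
      rw [mp_tmul]
      rfl)

theorem app_braidHom (M N : FBMod k) {A B S : FB} (e : A ⊕ B ≃ S) (m : M.ev A) (n : N.ev B) :
    app (braidHom M N) S (tmul e m n) = tmul ((Equiv.sumComm B A).trans e) n m :=
  app_descHom _ _ _ _ _ _

theorem braid_braid (M N : FBMod k) : braidHom M N ≫ braidHom N M = 𝟙 _ :=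
  tensor_hom_ext fun S A B e m n => by
    rw [app_comp, app_braidHom, app_braidHom, app_id]
    exact tmul_eq (by rintro (x | x) <;> rfl) _ _

/-- The inverse associator. -/
def assocInv (M N P : FBMod k) :
    tensorObj M (tensorObj N P) ⟶ tensorObj (tensorObj M N) P :=
  braidHom _ _ ≫ tensorHom (braidHom _ _) (𝟙 _) ≫ assocHom P N M ≫ braidHom _ _ ≫
    tensorHom (braidHom _ _) (𝟙 _)

theorem app_assocInv (M N P : FBMod k) {A B B₁ B₂ S : FB} (e : A ⊕ B ≃ S) (e₁ : B₁ ⊕ B₂ ≃ B)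
    (m : M.ev A) (n : N.ev B₁) (p : P.ev B₂) :
    app (assocInv M N P) S (tmul e m (tmul e₁ n p)) = tmul (A := FB.sum A B₁)
      (((Equiv.sumAssoc A B₁ B₂).trans (Equiv.sumCongr (Equiv.refl A) e₁)).trans e)
        (tmul (S := FB.sum A B₁) (Equiv.refl (A ⊕ B₁)) m n) p := by
  simp only [assocInv, app_comp, app_braidHom, app_tensorHom, app_id, app_assocHom]
  rw [show (Equiv.sumComm A B₁).trans (Equiv.refl (B₁ ⊕ A)) =
    (Equiv.refl (A ⊕ B₁)).trans (Equiv.sumComm A B₁) from rfl]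
  rw [← mp_tmul (S := FB.sum A B₁) (T := FB.sum B₁ A), tmul_mp_left]
  exact tmul_eq (by rintro ((x | x) | x) <;> rfl) _ _

/-- The species that is `k` on sets of cardinality `n` and `0` on all other sets. -/
def std (n : ℕ) : FBMod k :=
  mk' (fun S => PLift (Nat.card S = n) → k)
    (fun _ _ f => LinearMap.funLeft k k fun h => ⟨(Nat.card_congr f).trans h.down⟩)
    (fun _ _ => rfl) (fun _ _ _ => rfl)

/-- The distinguished basis vector `t^S` (it is `0` when `S` does not have cardinality `n`). -/
def one (n : ℕ) (S : FB) : (std (k := k) n).ev S := fun _ => (1 : k)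

@[simp] theorem mp_one (n : ℕ) {S T : FB} (f : S ≃ T) : (std (k := k) n).mp f (one n S) = one n T :=
  rfl

open Classical in
/-- The coordinate with respect to `t^S`. -/
def coef (n : ℕ) (S : FB) : (std (k := k) n).ev S →ₗ[k] k where
  toFun x := if h : Nat.card S = n then (show PLift (Nat.card S = n) → k from x) ⟨h⟩ else 0
  map_add' x y := by
    split_ifs
    · rfl
    · exact (add_zero 0).symm
  map_smul' c x := by
    split_ifs
    · rfl
    · exact (smul_zero c).symm

theorem coef_eq {n : ℕ} {S : FB} (h : Nat.card S = n) (x : (std (k := k) n).ev S) :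
    coef n S x = (show PLift (Nat.card S = n) → k from x) ⟨h⟩ :=
  dif_pos h

theorem coef_one {n : ℕ} {S : FB} (h : Nat.card S = n) : coef n S (one (k := k) n S) = 1 :=
  coef_eq h _

theorem coef_eq_zero {n : ℕ} {S : FB} (h : Nat.card S ≠ n) (x : (std (k := k) n).ev S) :
    coef n S x = 0 :=
  dif_neg h

theorem coef_smul_one {n : ℕ} {S : FB} (x : (std (k := k) n).ev S) :
    coef n S x • one n S = x := by
  funext h
  rw [coef_eq h.down]
  exact mul_one _

@[simp] theorem coef_mp {n : ℕ} {S T : FB} (f : S ≃ T) (x : (std (k := k) n).ev S) :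
    coef n T ((std n).mp f x) = coef n S x := by
  by_cases h : Nat.card S = n
  · rw [coef_eq h, coef_eq ((Nat.card_congr f).symm.trans h)]
    rfl
  · rw [coef_eq_zero h, coef_eq_zero fun h' => h ((Nat.card_congr f).trans h')]

/-- If `A` is empty, a decomposition `A ⊔ B ≃ S` identifies `B` and `S`. -/
def emptyLeft {A B S : FB} (h : Nat.card A = 0) (e : A ⊕ B ≃ S) : B ≃ S :=
  haveI := Finite.card_eq_zero_iff.1 h
  (Equiv.emptySum A B).symm.trans e

open Classical in
/-- The left unitor. -/
def leftUnitHom (M : FBMod k) : tensorObj (std 0) M ⟶ M :=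
  descHom (fun {_ A _} e => if h : Nat.card A = 0 then
      (LinearMap.lsmul k _).compl₁₂ (coef 0 A) (M.mp (emptyLeft h e)) else 0)
    (by
      intro S A B A' B' f g e' c m
      by_cases h : Nat.card A = 0
      · have h' := (Nat.card_congr f).symm.trans h
        have h'' : g.trans (emptyLeft h' e') = emptyLeft h ((Equiv.sumCongr f g).trans e') :=
          Equiv.ext fun _ => rfl
        simp only [dif_pos h, dif_pos h', LinearMap.compl₁₂_apply, coef_mp, mp_mp, h'']
      · have h' : ¬ Nat.card A' = 0 := fun h' => h ((Nat.card_congr f).trans h')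
        simp only [dif_neg h, dif_neg h']
        rfl)
    (by
      intro S T A B u e c m
      by_cases h : Nat.card A = 0
      · simp only [dif_pos h, LinearMap.compl₁₂_apply, LinearMap.lsmul_apply, map_smul, mp_mp]
        rfl
      · simp only [dif_neg h, LinearMap.zero_apply, map_zero])

theorem app_leftUnitHom (M : FBMod k) {A B S : FB} (h : Nat.card A = 0) (e : A ⊕ B ≃ S)
    (c : (std (k := k) 0).ev A) (m : M.ev B) :
    app (leftUnitHom M) S (tmul e c m) = coef 0 A c • M.mp (emptyLeft h e) m := by
  refine (app_descHom _ _ _ _ _ _).trans ?_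
  rw [dif_pos h]
  rfl

/-- The inverse of the left unitor. -/
def leftUnitInv (M : FBMod k) : M ⟶ tensorObj (std 0) M :=
  homMk (fun S => tmul (A := FB.of Empty) (Equiv.emptySum Empty S) (one 0 _))
    (by
      intro S T f x
      rw [tmul_mp_right, mp_tmul]
      exact tmul_eq (by rintro (x | x) <;> [exact x.elim; rfl]) _ _)

theorem app_leftUnitInv (M : FBMod k) {S : FB} (x : M.ev S) : app (leftUnitInv M) S x =
    tmul (A := FB.of Empty) (Equiv.emptySum Empty S) (one 0 _) x := rfl

/-- The left unitor. -/
def leftUnitIso (M : FBMod k) : tensorObj (std 0) M ≅ M where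
  hom := leftUnitHom M
  inv := leftUnitInv M
  hom_inv_id := tensor_hom_ext fun S A B e c m => by
    rw [app_comp, app_id]
    by_cases h : Nat.card A = 0
    · have := Finite.card_eq_zero_iff.1 h
      rw [app_leftUnitHom M h, LinearMap.map_smul, app_leftUnitInv, ← LinearMap.smul_apply,
        ← LinearMap.map_smul, tmul_mp_right]
      conv_rhs => rw [← coef_smul_one c, ← mp_one 0 (Equiv.equivOfIsEmpty (FB.of Empty) A),
        ← LinearMap.map_smul, tmul_mp_left]
      exact tmul_eq (by rintro (x | x) <;> [exact x.elim; rfl]) _ _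
    · rw [← coef_smul_one c, coef_eq_zero h]
      simp
  inv_hom_id := hom_ext fun S => LinearMap.ext fun x => by
    rw [app_comp, app_id, app_leftUnitInv, app_leftUnitHom M (by simp), coef_one (by simp), one_smul]
    exact mp_refl _ _

/-- The braiding. -/
def braidIso (M N : FBMod k) : tensorObj M N ≅ tensorObj N M where
  hom := braidHom M N
  inv := braidHom N M
  hom_inv_id := braid_braid M N
  inv_hom_id := braid_braid N M

theorem triple_hom_ext {M N P Q : FBMod k} {φ ψ : tensorObj (tensorObj M N) P ⟶ Q}
    (h : ∀ (S A B C D : FB) (e : A ⊕ B ≃ S) (e' : C ⊕ D ≃ A) (m : M.ev C) (n : N.ev D) (p : P.ev B),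
      app φ S (tmul e (tmul e' m n) p) = app ψ S (tmul e (tmul e' m n) p)) : φ = ψ :=
  tensor_hom_ext fun S A B e x p => by
    induction x using tensor_induction with
    | add x y hx hy => simp only [map_add, LinearMap.add_apply, hx, hy]
    | tmul C D e' m n => exact h S A B C D e e' m n p

theorem triple_hom_ext' {M N P Q : FBMod k} {φ ψ : tensorObj M (tensorObj N P) ⟶ Q}
    (h : ∀ (S A B C D : FB) (e : A ⊕ B ≃ S) (e' : C ⊕ D ≃ B) (m : M.ev A) (n : N.ev C) (p : P.ev D),
      app φ S (tmul e m (tmul e' n p)) = app ψ S (tmul e m (tmul e' n p))) : φ = ψ :=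
  tensor_hom_ext fun S A B e m x => by
    induction x using tensor_induction with
    | add x y hx hy => simp only [map_add, hx, hy]
    | tmul C D e' n p => exact h S A B C D e e' m n p

/-- The associator. -/
def assocIso (M N P : FBMod k) :
    tensorObj (tensorObj M N) P ≅ tensorObj M (tensorObj N P) where
  hom := assocHom M N P
  inv := assocInv M N P
  hom_inv_id := triple_hom_ext fun S A B C D e e' m n p => by
    rw [app_comp, app_assocHom, app_assocInv, app_id, ← mp_refl _ (tmul e' m n)]
    conv_rhs => rw [← Equiv.refl_trans e', ← mp_tmul (S := FB.sum C D)]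
    rw [mp_refl, tmul_mp_left]
    exact tmul_eq (by rintro ((x | x) | x) <;> rfl) _ _
  inv_hom_id := triple_hom_ext' fun S A B C D e e' m n p => by
    rw [app_comp, app_assocInv, app_assocHom, app_id, tmul_tmul e]
    exact tmul_eq (by rintro (x | x | x) <;> rfl) _ _

instance : MonoidalCategoryStruct (FBMod k) where
  tensorObj M N := tensorObj M N
  tensorUnit := std 0
  tensorHom f g := tensorHom f g
  whiskerLeft M _ _ g := tensorHom (𝟙 M) g
  whiskerRight f N := tensorHom f (𝟙 N)
  associator M N P := assocIso M N P
  leftUnitor M := leftUnitIso M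
  rightUnitor M := braidIso M (std 0) ≪≫ leftUnitIso M

theorem app_tensorHom' {M N M' N' : FBMod k} (f : M ⟶ M') (g : N ⟶ N') {S A B : FB}
    (e : A ⊕ B ≃ S) (m : M.ev A) (n : N.ev B) :
    app (f ⊗ₘ g) S (tmul e m n) = tmul e (app f A m) (app g B n) :=
  app_tensorHom f g e m n

theorem app_associator (M N P : FBMod k) {A A₁ A₂ B S : FB} (e : A ⊕ B ≃ S) (e₁ : A₁ ⊕ A₂ ≃ A)
    (m : M.ev A₁) (n : N.ev A₂) (p : P.ev B) :
    app (α_ M N P).hom S (tmul e (tmul e₁ m n) p) = tmul (B := FB.sum A₂ B)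
      (((Equiv.sumAssoc A₁ A₂ B).symm.trans (Equiv.sumCongr e₁ (Equiv.refl B))).trans e) m
        (tmul (S := FB.sum A₂ B) (Equiv.refl (A₂ ⊕ B)) n p) :=
  app_assocHom M N P e e₁ m n p

theorem app_leftUnitor_smul (M : FBMod k) {A B S : FB} (e : A ⊕ B ≃ S)
    (c : (std (k := k) 0).ev A) (m : M.ev B) (f : B ≃ S) (hf : ∀ b, f b = e (Sum.inr b)) :
    app (λ_ M).hom S (tmul e c m) = coef 0 A c • M.mp f m := by
  by_cases h : Nat.card A = 0
  · rw [Equiv.ext (f := f) (g := emptyLeft h e) hf]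
    exact app_leftUnitHom M h e c m
  · rw [coef_eq_zero h, ← coef_smul_one c, coef_eq_zero h]
    simp

theorem app_rightUnitor_smul (M : FBMod k) {A B S : FB} (e : A ⊕ B ≃ S)
    (c : (std (k := k) 0).ev B) (m : M.ev A) (f : A ≃ S) (hf : ∀ a, f a = e (Sum.inl a)) :
    app (ρ_ M).hom S (tmul e m c) = coef 0 B c • M.mp f m := by
  refine Eq.trans ?_ (app_leftUnitor_smul M ((Equiv.sumComm B A).trans e) c m f hf)
  exact congrArg (app (leftUnitHom M) S) (app_braidHom M (std 0) e m c)

theorem tensor_hom_ext' {M N P : FBMod k} {φ ψ : M ⊗ N ⟶ P}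
    (h : ∀ (S A B : FB) (e : A ⊕ B ≃ S) (m : M.ev A) (n : N.ev B),
      app φ S (tmul e m n) = app ψ S (tmul e m n)) : φ = ψ :=
  tensor_hom_ext h

theorem leftUnit_ext {M N : FBMod k} {φ ψ : 𝟙_ (FBMod k) ⊗ M ⟶ N}
    (h : ∀ (S A B : FB) (e : A ⊕ B ≃ S) (f : B ≃ S) (_ : ∀ b, f b = e (Sum.inr b)) (m : M.ev B),
      app φ S (tmul e (one 0 A) m) = app ψ S (tmul e (one 0 A) m)) : φ = ψ :=
  tensor_hom_ext fun S A B e c m => by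
    by_cases hA : Nat.card A = 0
    · rw [← coef_smul_one c, LinearMap.map_smul, LinearMap.smul_apply, LinearMap.map_smul,
        LinearMap.map_smul, h S A B e (emptyLeft hA e) (fun _ => rfl)]
    · rw [← coef_smul_one c, coef_eq_zero hA]
      simp

instance : MonoidalCategory (FBMod k) := MonoidalCategory.ofTensorHom
  (id_tensorHom_id := fun M N => tensor_hom_ext fun S A B e m n => app_tensorHom _ _ e m n)
  (tensorHom_comp_tensorHom := fun f g f' g' => tensor_hom_ext fun S A B e m n => by
    rw [app_comp, app_tensorHom', app_tensorHom', app_tensorHom']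
    rfl)
  (associator_naturality := fun f g h => triple_hom_ext fun S A B C D e e' m n p => by
    rw [app_comp, app_comp, app_tensorHom', app_tensorHom', app_associator, app_associator,
      app_tensorHom', app_tensorHom'])
  (leftUnitor_naturality := fun f => tensor_hom_ext fun S A B e c m => by
    by_cases h : Nat.card A = 0
    · rw [app_comp, app_tensorHom', app_comp, app_leftUnitor_smul _ e _ _ (emptyLeft h e) fun _ => rfl,
        app_leftUnitor_smul _ e _ _ (emptyLeft h e) fun _ => rfl, LinearMap.map_smul, app_mp]
      rfl
    · rw [← coef_smul_one c, coef_eq_zero h]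
      simp)
  (rightUnitor_naturality := fun f => tensor_hom_ext fun S A B e m c => by
    by_cases h : Nat.card B = 0
    · rw [app_comp, app_tensorHom', app_comp,
        app_rightUnitor_smul _ e _ _ (emptyLeft h ((Equiv.sumComm B A).trans e)) fun _ => rfl,
        app_rightUnitor_smul _ e _ _ (emptyLeft h ((Equiv.sumComm B A).trans e)) fun _ => rfl,
        LinearMap.map_smul, app_mp]
      rfl
    · rw [← coef_smul_one c, coef_eq_zero h]
      simp)
  (pentagon := fun M N P Q => tensor_hom_ext fun S A B e x q => by
    induction x using tensor_induction with
    | add x y hx hy => simp only [map_add, LinearMap.add_apply, hx, hy]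
    | tmul C D e' x p =>
      induction x using tensor_induction with
      | add x y hx hy => simp only [map_add, LinearMap.add_apply, hx, hy]
      | tmul E F e'' m n =>
        rw [app_comp, app_comp, app_comp, app_tensorHom', app_associator, app_associator,
          app_tensorHom', app_associator, tmul_tmul, app_associator, app_associator,
          tmul_tmul, app_id, app_id]
        exact tmul_eq (by rintro (x | x | x | x) <;> rfl) _ _)
  (triangle := fun M N => triple_hom_ext fun S A B C D e e' m c n => by
    by_cases h : Nat.card D = 0
    · have := Finite.card_eq_zero_iff.1 h
      rw [app_comp, app_associator, app_tensorHom', app_tensorHom', app_id, app_id,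
        app_rightUnitor_smul _ _ _ _ (emptyLeft h ((Equiv.sumComm D C).trans e')) fun _ => rfl,
        app_leftUnitor_smul _ _ _ _ (Equiv.emptySum D B).symm fun _ => rfl,
        LinearMap.map_smul, LinearMap.map_smul, tmul_mp_right, LinearMap.smul_apply, tmul_mp_left]
      congr 1
    · rw [← coef_smul_one c, coef_eq_zero h]
      simp)

theorem app_braiding₀ (M N : FBMod k) {A B S : FB} (e : A ⊕ B ≃ S) (m : M.ev A) (n : N.ev B) :
    app (braidIso M N).hom S (tmul e m n) = tmul ((Equiv.sumComm B A).trans e) n m :=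
  app_braidHom M N e m n

theorem app_whiskerLeft (M : FBMod k) {N N' : FBMod k} (g : N ⟶ N') {S A B : FB}
    (e : A ⊕ B ≃ S) (m : M.ev A) (n : N.ev B) :
    app (M ◁ g) S (tmul e m n) = tmul e m (app g B n) :=
  app_tensorHom _ g e m n

theorem app_whiskerRight {M M' : FBMod k} (f : M ⟶ M') (N : FBMod k) {S A B : FB}
    (e : A ⊕ B ≃ S) (m : M.ev A) (n : N.ev B) :
    app (f ▷ N) S (tmul e m n) = tmul e (app f A m) n :=
  app_tensorHom f _ e m n

theorem app_associator_inv (M N P : FBMod k) {A B B₁ B₂ S : FB} (e : A ⊕ B ≃ S) (e₁ : B₁ ⊕ B₂ ≃ B)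
    (m : M.ev A) (n : N.ev B₁) (p : P.ev B₂) :
    app (α_ M N P).inv S (tmul e m (tmul e₁ n p)) = tmul (A := FB.sum A B₁)
      (((Equiv.sumAssoc A B₁ B₂).trans (Equiv.sumCongr (Equiv.refl A) e₁)).trans e)
        (tmul (S := FB.sum A B₁) (Equiv.refl (A ⊕ B₁)) m n) p :=
  app_assocInv M N P e e₁ m n p

instance : SymmetricCategory (FBMod k) where
  braiding M N := braidIso M N
  braiding_naturality_right M _ _ f := tensor_hom_ext fun S A B e m n => by
    rw [app_comp, app_comp, app_whiskerLeft, app_braiding₀, app_braiding₀, app_whiskerRight]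
  braiding_naturality_left f M := tensor_hom_ext fun S A B e m n => by
    rw [app_comp, app_comp, app_whiskerRight, app_braiding₀, app_braiding₀, app_whiskerLeft]
  hexagon_forward M N P := triple_hom_ext fun S A B C D e e' m n p => by
    rw [app_comp, app_comp, app_comp, app_comp, app_associator, app_braiding₀, app_associator,
      app_whiskerRight, app_braiding₀, app_associator, app_whiskerLeft, app_braiding₀]
    conv_rhs => rw [tmul_tmul]
    exact tmul_eq (by rintro (x | x | x) <;> rfl) _ _
  hexagon_reverse M N P := triple_hom_ext' fun S A B C D e e' m n p => by
    rw [app_comp, app_comp, app_comp, app_comp, app_associator_inv, app_braiding₀,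
      app_associator_inv, app_whiskerLeft, app_braiding₀, app_associator_inv, app_whiskerRight,
      app_braiding₀]
    conv_rhs => rw [tmul_tmul_left]
    exact tmul_eq (by rintro ((x | x) | x) <;> rfl) _ _
  symmetry M N := braid_braid M N

end
end FBMod

namespace Gluing

variable {X Y Z A B P : Type*}

theorem map_le {r : Setoid X} {f : X → Z} {s : Setoid Z} : r.map f ≤ s ↔ r ≤ s.comap f :=
  ⟨fun h _ _ hxy => h (Setoid.le_comap_map hxy),
    fun h => Setoid.eqvGen_le (by rintro _ _ ⟨a, b, hab, rfl, rfl⟩; exact h hab)⟩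

theorem map_sup (r s : Setoid X) (f : X → Z) : (r ⊔ s).map f = r.map f ⊔ s.map f :=
  eq_of_forall_ge_iff fun t => by
    have : t.comap f = t.comap f := rfl
    rw [sup_le_iff, map_le, map_le, map_le, sup_le_iff]

theorem map_map (r : Setoid X) (f : X → Y) (g : Y → Z) : (r.map f).map g = r.map (g ∘ f) :=
  eq_of_forall_ge_iff fun t => by rw [map_le, map_le, map_le]; rfl

theorem map_rel {r : Setoid X} {f : X → Z} (hf : f.Injective) {z w : Z} :
    r.map f z w ↔ z = w ∨ ∃ x y, r x y ∧ f x = z ∧ f y = w := by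
  rw [Setoid.coe_map_of_ker_le r f (Setoid.ker_eq_bot_iff.2 hf ▸ bot_le)]
  exact or_comm

/-- The number of equivalence classes of `r` that do not meet the image of `i`. -/
noncomputable def missed (r : Setoid Z) (i : A → Z) : ℕ :=
  Nat.card {c : Quotient r // ∀ a, c ≠ Quotient.mk r (i a)}

theorem sup_rel {r s : Setoid Z} {i : A → Z} (hs : ∀ z w, s z w → z = w ∨ ∃ a b, i a = z ∧ i b = w)
    {z w : Z} (h : (r ⊔ s) z w) :
    r z w ∨ ∃ a b, r z (i a) ∧ (r.comap i ⊔ s.comap i) a b ∧ r (i b) w := by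
  let t : Setoid Z :=
    { r := fun z w => r z w ∨ ∃ a b, r z (i a) ∧ (r.comap i ⊔ s.comap i) a b ∧ r (i b) w
      iseqv := by
        refine ⟨fun z => Or.inl (r.refl z), ?_, ?_⟩
        · rintro z w (h | ⟨a, b, h1, h2, h3⟩)
          · exact Or.inl (r.symm h)
          · exact Or.inr ⟨b, a, r.symm h3, Setoid.symm' _ h2, r.symm h1⟩
        · rintro x y z (h | ⟨a, b, h1, h2, h3⟩) (h' | ⟨a', b', h1', h2', h3'⟩)
          · exact Or.inl (r.trans h h')
          · exact Or.inr ⟨a', b', r.trans h h1', h2', h3'⟩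
          · exact Or.inr ⟨a, b, h1, h2, r.trans h3 h'⟩
          · refine Or.inr ⟨a, b', h1, Setoid.trans' _ h2 (Setoid.trans' _ ?_ h2'), h3'⟩
            exact (le_sup_left : r.comap i ≤ r.comap i ⊔ s.comap i) (r.trans h3 h1') }
  have h1 : r ≤ t := fun _ _ h => Or.inl h
  have h2 : s ≤ t := by
    intro z w h
    rcases hs z w h with rfl | ⟨a, b, rfl, rfl⟩
    · exact t.refl _
    · exact Or.inr ⟨a, b, r.refl _, (le_sup_right : s.comap i ≤ r.comap i ⊔ s.comap i) h, r.refl _⟩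
  exact sup_le h1 h2 h

theorem comap_sup {r s : Setoid Z} {i : A → Z}
    (hs : ∀ z w, s z w → z = w ∨ ∃ a b, i a = z ∧ i b = w) :
    (r ⊔ s).comap i = r.comap i ⊔ s.comap i := by
  refine le_antisymm (fun a b h => ?_)
    (sup_le (fun _ _ h => (le_sup_left : r ≤ r ⊔ s) h) (fun _ _ h => (le_sup_right : s ≤ r ⊔ s) h))
  have hl : r.comap i ≤ r.comap i ⊔ s.comap i := le_sup_left
  rcases sup_rel hs h with h | ⟨a', b', h1, h2, h3⟩
  · exact hl h
  · exact Setoid.trans' _ (hl h1) (Setoid.trans' _ h2 (hl h3))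

theorem missed_sup [Finite Z] {r s : Setoid Z} {i : A → Z}
    (hs : ∀ z w, s z w → z = w ∨ ∃ a b, i a = z ∧ i b = w) (j : B → A) :
    missed (r ⊔ s) (i ∘ j) = missed ((r ⊔ s).comap i) j + missed r i := by
  classical
  have e1 : {c : Quotient (r ⊔ s) // ∀ b, c ≠ Quotient.mk _ (i (j b))} ≃
      {c : {c : Quotient (r ⊔ s) // ∀ b, c ≠ Quotient.mk _ (i (j b))} //
        ∃ a, c.1 = Quotient.mk _ (i a)} ⊕
      {c : {c : Quotient (r ⊔ s) // ∀ b, c ≠ Quotient.mk _ (i (j b))} //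
        ¬ ∃ a, c.1 = Quotient.mk _ (i a)} := (Equiv.sumCompl _).symm
  have e2 : {c : Quotient ((r ⊔ s).comap i) // ∀ b, c ≠ Quotient.mk _ (j b)} ≃
      {c : {c : Quotient (r ⊔ s) // ∀ b, c ≠ Quotient.mk _ (i (j b))} //
        ∃ a, c.1 = Quotient.mk _ (i a)} := by
    refine Equiv.ofBijective (fun c => ⟨⟨Quotient.map (sa := (r ⊔ s).comap i) (sb := r ⊔ s) i
      (fun _ _ h => h) c.1, ?_⟩, ?_⟩) ⟨?_, ?_⟩
    · obtain ⟨c, hc⟩ := c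
      induction c using Quotient.inductionOn with
      | h a =>
        intro b h
        have h' : (r ⊔ s) (i a) (i (j b)) := Quotient.exact h
        exact hc b (Quotient.sound h')
    · obtain ⟨c, hc⟩ := c
      induction c using Quotient.inductionOn with
      | h a => exact ⟨a, rfl⟩
    · rintro ⟨c, hc⟩ ⟨c', hc'⟩ h
      induction c using Quotient.inductionOn with
      | h a =>
        induction c' using Quotient.inductionOn with
        | h a' =>
          have h' := congrArg (fun x => x.1.1) h
          have h'' : (r ⊔ s) (i a) (i a') := Quotient.exact h'
          exact Subtype.ext (Quotient.sound h'')
    · rintro ⟨⟨c, hc⟩, a, ha⟩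
      refine ⟨⟨Quotient.mk _ a, fun b h => hc b (Eq.trans ha ?_)⟩,
        Subtype.ext (Subtype.ext (Eq.symm ha))⟩
      have h' : (r ⊔ s).comap i a (j b) := Quotient.exact h
      exact Quotient.sound h'
  have key : ∀ z, (∀ a, ¬ r z (i a)) → ∀ w, (r ⊔ s) z w → r z w := by
    intro z hz w h
    rcases sup_rel hs h with h | ⟨a, b, h1, -, -⟩
    · exact h
    · exact absurd h1 (hz a)
  have e3 : {c : Quotient r // ∀ a, c ≠ Quotient.mk r (i a)} ≃
      {c : {c : Quotient (r ⊔ s) // ∀ b, c ≠ Quotient.mk _ (i (j b))} //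
        ¬ ∃ a, c.1 = Quotient.mk _ (i a)} := by
    have hle : r ≤ r ⊔ s := le_sup_left
    refine Equiv.ofBijective (fun c => ⟨⟨Quotient.map (sa := r) (sb := r ⊔ s) id
      (fun _ _ h => hle h) c.1, ?_⟩, ?_⟩) ⟨?_, ?_⟩
    · obtain ⟨c, hc⟩ := c
      induction c using Quotient.inductionOn with
      | h z =>
        exact fun b h => hc (j b) (Quotient.sound (key z (fun a h' => hc a (Quotient.sound h')) _
          (Quotient.exact h)))
    · obtain ⟨c, hc⟩ := c
      induction c using Quotient.inductionOn with
      | h z =>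
        rintro ⟨a, h⟩
        exact hc a (Quotient.sound (key z (fun a h' => hc a (Quotient.sound h')) _
          (Quotient.exact h)))
    · rintro ⟨c, hc⟩ ⟨c', hc'⟩ h
      induction c using Quotient.inductionOn with
      | h z =>
        induction c' using Quotient.inductionOn with
        | h z' =>
          have := congrArg (fun x => x.1.1) h
          exact Subtype.ext (Quotient.sound (key z (fun a h' => hc a (Quotient.sound h')) _
            (Quotient.exact this)))
    · rintro ⟨⟨c, hc⟩, h⟩
      induction c using Quotient.inductionOn with
      | h z =>
        refine ⟨⟨Quotient.mk _ z, fun a h' => h ⟨a, Quotient.sound (hle (Quotient.exact h'))⟩⟩, rfl⟩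
  unfold missed
  rw [Nat.card_congr e2, Nat.card_congr e3, ← Nat.card_sum]
  exact Nat.card_congr e1

/-- Data of an amalgam: `Z` is the union of the images of `X` and `A`, with intersection `P`. -/
structure IsAmalgam (h : X → Z) (i : A → Z) (p : P → X) (q : P → A) : Prop where
  hinj : h.Injective
  iinj : i.Injective
  comm : ∀ x, h (p x) = i (q x)
  inter : ∀ x a, h x = i a → ∃ y, p y = x ∧ q y = a
  cover : ∀ z, (∃ x, h x = z) ∨ ∃ a, i a = z

theorem IsAmalgam.qinj {h : X → Z} {i : A → Z} {p : P → X} {q : P → A} (H : IsAmalgam h i p q)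
    (pinj : p.Injective) : q.Injective := fun x y hxy =>
  pinj (H.hinj (by rw [H.comm, H.comm, hxy]))

theorem IsAmalgam.comap_map {h : X → Z} {i : A → Z} {p : P → X} {q : P → A}
    (H : IsAmalgam h i p q) (pinj : p.Injective) (J : Setoid X) :
    (J.map h).comap i = (J.comap p).map q := by
  refine le_antisymm (fun a b hab => ?_) (map_le.2 fun x y hxy => ?_)
  · rw [Setoid.comap_rel, map_rel H.hinj] at hab
    rw [map_rel (H.qinj pinj)]
    rcases hab with hab | ⟨x, y, hxy, hx, hy⟩
    · exact Or.inl (H.iinj hab)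
    · obtain ⟨x, rfl, rfl⟩ := H.inter _ _ hx
      obtain ⟨y, rfl, rfl⟩ := H.inter _ _ hy
      exact Or.inr ⟨x, y, hxy, rfl, rfl⟩
  · rw [Setoid.comap_rel, Setoid.comap_rel, ← H.comm, ← H.comm]
    exact Setoid.le_comap_map hxy

theorem IsAmalgam.missed_map {h : X → Z} {i : A → Z} {p : P → X} {q : P → A}
    (H : IsAmalgam h i p q) (J : Setoid X) : missed (J.map h) i = missed J p := by
  unfold missed
  symm
  have hr : ∀ {x y}, J.map h (h x) (h y) → J x y := fun {x y} hxy => by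
    rcases (map_rel H.hinj).1 hxy with h' | ⟨x', y', h1, h2, h3⟩
    · rw [H.hinj h']
    · rwa [← H.hinj h2, ← H.hinj h3]
  refine Nat.card_congr (Equiv.ofBijective (fun c => ⟨Quotient.map (sa := J) (sb := J.map h) h
    (fun _ _ h => Setoid.le_comap_map h) c.1, ?_⟩) ⟨?_, ?_⟩)
  · obtain ⟨c, hc⟩ := c
    induction c using Quotient.inductionOn with
    | h x =>
      intro a ha
      have ha : J.map h (h x) (i a) := Quotient.exact ha
      rcases (map_rel H.hinj).1 ha with h' | ⟨x', y', h1, h2, h3⟩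
      · obtain ⟨y, rfl, rfl⟩ := H.inter _ _ h'
        exact hc y rfl
      · obtain ⟨y, rfl, rfl⟩ := H.inter _ _ h3
        obtain rfl := H.hinj h2
        exact hc y (Quotient.sound h1)
  · rintro ⟨c, hc⟩ ⟨c', hc'⟩ h
    induction c using Quotient.inductionOn with
    | h z =>
      induction c' using Quotient.inductionOn with
      | h z' =>
        have := congrArg (fun x => x.1) h
        exact Subtype.ext (Quotient.sound (hr (Quotient.exact this)))
  · rintro ⟨c, hc⟩
    induction c using Quotient.inductionOn with
    | h z =>
      rcases H.cover z with ⟨x, rfl⟩ | ⟨a, rfl⟩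
      · refine ⟨⟨Quotient.mk _ x, fun y hy => hc (q y) (Quotient.sound ?_)⟩, rfl⟩
        have hy := Quotient.exact hy
        change J.map h (h x) (i (q y))
        rw [← H.comm]
        exact Setoid.le_comap_map hy
      · exact absurd rfl (hc a)

theorem IsAmalgam.isolated {h : X → Z} {i : A → Z} {p : P → X} {q : P → A}
    (H : IsAmalgam h i p q) {g : Y → A} (hg : g.Injective) (s : Setoid Y) (z w : Z)
    (hzw : s.map (i ∘ g) z w) : z = w ∨ ∃ a b, i a = z ∧ i b = w := by
  rcases (map_rel (H.iinj.comp hg)).1 hzw with h | ⟨x, y, -, rfl, rfl⟩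
  · exact Or.inl h
  · exact Or.inr ⟨g x, g y, rfl, rfl⟩

theorem IsAmalgam.comap_glue {h : X → Z} {i : A → Z} {p : P → X} {q : P → A}
    (H : IsAmalgam h i p q) (pinj : p.Injective) {g : Y → A} (hg : g.Injective) (J : Setoid X)
    (s : Setoid Y) :
    (J.map h ⊔ s.map (i ∘ g)).comap i = (J.comap p).map q ⊔ s.map g := by
  rw [comap_sup (H.isolated hg s), H.comap_map pinj, ← map_map, Setoid.comap_map_eq _ _ H.iinj]

theorem IsAmalgam.missed_glue [Finite Z] {h : X → Z} {i : A → Z} {p : P → X} {q : P → A}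
    (H : IsAmalgam h i p q) (pinj : p.Injective) {g : Y → A} (hg : g.Injective) (J : Setoid X)
    (s : Setoid Y) (j : B → A) :
    missed (J.map h ⊔ s.map (i ∘ g)) (i ∘ j) =
      missed ((J.comap p).map q ⊔ s.map g) j + missed J p := by
  rw [missed_sup (H.isolated hg s), H.comap_glue pinj hg, H.missed_map]

theorem dihedral [Finite Z] {p q : Z → Z} (hp : p.Involutive) (hq : q.Involutive)
    (hpq : ∀ z, p z = z → q z ≠ z) {J : Setoid Z} (hJp : ∀ z, J z (p z)) (hJq : ∀ z, J z (q z))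
    (hJ : ∀ t : Setoid Z, (∀ z, t z (p z)) → (∀ z, t z (q z)) → J ≤ t) {x : Z} (hx : q x = x) :
    ∃! y, y ≠ x ∧ J x y ∧ (p y = y ∨ q y = y) := by
  let P : Equiv.Perm Z := hp.toPerm
  let Q : Equiv.Perm Z := hq.toPerm
  let σ : Equiv.Perm Z := Q * P
  have hPP : P⁻¹ = P := rfl
  have hQQ : Q⁻¹ = Q := rfl
  have hQQ1 : Q * Q = 1 := Equiv.ext hq
  have hPx : ∀ z, P z = p z := fun _ => rfl
  have hQx : ∀ z, Q z = q z := fun _ => rfl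
  have hQ : ∀ n : ℤ, Q ((σ ^ n) x) = (σ ^ (-n)) x := by
    intro n
    have h1 : Q * σ ^ n * Q⁻¹ = σ ^ (-n) := by
      rw [← conj_zpow, zpow_neg, ← inv_zpow]
      congr 1
      simp only [σ, mul_inv_rev, hPP, hQQ]
      rw [← mul_assoc, hQQ1, one_mul]
    have h2 : Q x = x := hx
    rw [← h1, Equiv.Perm.mul_apply, Equiv.Perm.mul_apply, hQQ, h2]
  have hP : ∀ n : ℤ, P ((σ ^ n) x) = (σ ^ (-n - 1)) x := by
    intro n
    have h1 : P = σ⁻¹ * Q := by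
      simp only [σ, mul_inv_rev, hPP, hQQ, mul_assoc]
      rw [hQQ1, mul_one]
    rw [h1, Equiv.Perm.mul_apply, hQ, ← Equiv.Perm.mul_apply, sub_eq_neg_add, zpow_add, zpow_neg_one]
  have horb : ∀ y, J x y ↔ ∃ n : ℤ, (σ ^ n) x = y := by
    intro y
    constructor
    · intro h
      have := hJ (Setoid.ker fun z => ∃ n : ℤ, (σ ^ n) x = z) ?_ ?_ h
      · have : (∃ n : ℤ, (σ ^ n) x = x) = ∃ n : ℤ, (σ ^ n) x = y := this
        rw [← this]
        exact ⟨0, rfl⟩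
      · intro z
        refine propext ⟨?_, ?_⟩
        · rintro ⟨n, rfl⟩
          exact ⟨-n - 1, (hP n).symm⟩
        · rintro ⟨n, h⟩
          exact ⟨-n - 1, by rw [← hP n, h]; exact hp z⟩
      · intro z
        refine propext ⟨?_, ?_⟩
        · rintro ⟨n, rfl⟩
          exact ⟨-n, (hQ n).symm⟩
        · rintro ⟨n, h⟩
          exact ⟨-n, by rw [← hQ n, h]; exact hq z⟩
    · have hσ : ∀ z, J z (σ z) := fun z => J.trans (hJp z) (hJq _)
      rintro ⟨n, rfl⟩
      induction n using Int.induction_on with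
      | zero => exact J.refl x
      | succ n ih =>
        rw [add_comm, zpow_add, Equiv.Perm.mul_apply, zpow_one]
        exact J.trans ih (hσ _)
      | pred n ih =>
        rw [sub_eq_neg_add, zpow_add, Equiv.Perm.mul_apply, zpow_neg_one]
        refine J.trans ih (J.symm ?_)
        have := hσ (σ⁻¹ ((σ ^ (-(n : ℤ))) x))
        rwa [← Equiv.Perm.mul_apply σ σ⁻¹, mul_inv_cancel] at this
  set N := Function.minimalPeriod (fun z => σ • z) x with hN
  have hdvd : ∀ n : ℤ, (σ ^ n) x = x ↔ (N : ℤ) ∣ n := fun n =>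
    MulAction.zpow_smul_eq_iff_minimalPeriod_dvd (a := σ) (b := x)
  have heq : ∀ m n : ℤ, (σ ^ m) x = (σ ^ n) x ↔ (N : ℤ) ∣ m - n := by
    intro m n
    rw [← hdvd, sub_eq_neg_add, zpow_add, Equiv.Perm.mul_apply, zpow_neg, Equiv.Perm.inv_eq_iff_eq]
  have hNpos : 0 < N := by
    rcases Nat.eq_zero_or_pos N with h0 | h0
    · have hfin := isOfFinOrder_of_finite σ
      have h1 : (σ ^ (orderOf σ : ℤ)) x = x := by simp [pow_orderOf_eq_one]
      rw [hdvd, h0] at h1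
      have h2 := hfin.orderOf_pos
      rw [Nat.cast_zero, zero_dvd_iff, Nat.cast_eq_zero] at h1
      omega
    · exact h0
  have hPn : ∀ n : ℤ, p ((σ ^ n) x) = (σ ^ n) x ↔ (N : ℤ) ∣ 2 * n + 1 := by
    intro n
    rw [← hPx, hP, heq, ← dvd_neg]
    congr! 1
    ring
  have hQn : ∀ n : ℤ, q ((σ ^ n) x) = (σ ^ n) x ↔ (N : ℤ) ∣ 2 * n := by
    intro n
    rw [← hQx, hQ, heq, ← dvd_neg]
    congr! 1
    ring
  have hN1 : N ≠ 1 := by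
    intro h1
    have h2 := (hPn 0).2 (by simp [h1])
    exact hpq x h2 hx
  rcases Nat.even_or_odd' N with ⟨M, hM | hM⟩
  · refine ⟨(σ ^ (M : ℤ)) x, ⟨?_, (horb _).2 ⟨_, rfl⟩, Or.inr ((hQn _).2 (by simp [hM]))⟩, ?_⟩
    · rw [Ne, hdvd]
      rintro ⟨c, hc⟩
      rw [hM] at hc
      have hc' : (M : ℤ) * (1 - 2 * c) = 0 := by push_cast at hc; linarith
      rcases mul_eq_zero.1 hc' with h | h <;> omega
    · rintro y ⟨hy, hxy, hpqy⟩
      obtain ⟨n, rfl⟩ := (horb y).1 hxy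
      rw [heq]
      rw [Ne, hdvd] at hy
      rw [hPn, hQn] at hpqy
      rw [hM] at hy hpqy ⊢
      push_cast at *
      rcases hpqy with ⟨c, hc⟩ | ⟨c, hc⟩
      · have : 2 * ((M : ℤ) * c - n) = 1 := by linarith
        omega
      · have hn : n = M * c := by linarith
        rcases Int.even_or_odd' c with ⟨d, rfl | rfl⟩
        · exact absurd ⟨d, by rw [hn]; ring⟩ hy
        · exact ⟨d, by rw [hn]; ring⟩
  · refine ⟨(σ ^ (M : ℤ)) x, ⟨?_, (horb _).2 ⟨_, rfl⟩, Or.inl ((hPn _).2 (by simp [hM]))⟩, ?_⟩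
    · rw [Ne, hdvd]
      intro hd
      have := Int.le_of_dvd (by omega) hd
      omega
    · rintro y ⟨hy, hxy, hpqy⟩
      obtain ⟨n, rfl⟩ := (horb y).1 hxy
      rw [heq]
      rw [Ne, hdvd] at hy
      rw [hPn, hQn] at hpqy
      have hcop : IsCoprime (N : ℤ) 2 := ⟨1, -M, by rw [hM]; push_cast; ring⟩
      rcases hpqy with h | h
      · refine hcop.dvd_of_dvd_mul_left ?_
        have h2 := dvd_sub h (dvd_refl (N : ℤ))
        refine h2.trans (dvd_of_eq ?_)
        rw [hM]
        push_cast
        ring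
      · exact absurd (hcop.dvd_of_dvd_mul_left h) hy

end Gluing

/-- A Brauer diagram from `S` to `T`: a perfect matching on `S ⊔ T`, viewed as a partition of
`S ⊔ T` all of whose blocks have exactly two elements. -/
@[ext]
structure BrauerDiagram (S T : FB) where
  rel : Setoid (S ⊕ T)
  matching : ∀ x, ∃! y, y ≠ x ∧ rel x y

namespace BrauerDiagram

open Gluing

variable {S T U W : FB}

noncomputable section

/-- The element matched to `x`. -/
def partner (d : BrauerDiagram S T) (x : S ⊕ T) : S ⊕ T := (d.matching x).choose

theorem partner_ne (d : BrauerDiagram S T) (x : S ⊕ T) : d.partner x ≠ x :=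
  (d.matching x).choose_spec.1.1

theorem rel_partner (d : BrauerDiagram S T) (x : S ⊕ T) : d.rel x (d.partner x) :=
  (d.matching x).choose_spec.1.2

theorem eq_partner (d : BrauerDiagram S T) {x y : S ⊕ T} (h : d.rel x y) (hne : y ≠ x) :
    y = d.partner x :=
  (d.matching x).unique ⟨hne, h⟩ ⟨d.partner_ne x, d.rel_partner x⟩

theorem partner_partner (d : BrauerDiagram S T) (x : S ⊕ T) : d.partner (d.partner x) = x :=
  (d.eq_partner (d.rel.symm (d.rel_partner x)) (d.partner_ne x).symm).symm

/-- The inclusions of `S ⊔ T`, `T ⊔ U` and `S ⊔ U` into `S ⊔ T ⊔ U`. -/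
def i₁₂ {S T U : Type} : S ⊕ T → S ⊕ T ⊕ U := Sum.elim Sum.inl (Sum.inr ∘ Sum.inl)
def i₂₃ {S T U : Type} : T ⊕ U → S ⊕ T ⊕ U := Sum.inr
def i₁₃ {S T U : Type} : S ⊕ U → S ⊕ T ⊕ U := Sum.map id Sum.inr

theorem i₁₂_inj {S T U : Type} : (i₁₂ : S ⊕ T → S ⊕ T ⊕ U).Injective := by
  rintro (x | x) (y | y) h <;> simp_all [i₁₂]
theorem i₂₃_inj {S T U : Type} : (i₂₃ : T ⊕ U → S ⊕ T ⊕ U).Injective := Sum.inr_injective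
theorem i₁₃_inj {S T U : Type} : (i₁₃ : S ⊕ U → S ⊕ T ⊕ U).Injective := by
  rintro (x | x) (y | y) h <;> simp_all [i₁₃]

/-- The partition of `S ⊔ T ⊔ U` into the connected components of the graph obtained by stacking
two diagrams. -/
def stack (d : BrauerDiagram S T) (d' : BrauerDiagram T U) : Setoid (S ⊕ T ⊕ U) :=
  d.rel.map i₁₂ ⊔ d'.rel.map i₂₃

theorem stack_le {d : BrauerDiagram S T} {d' : BrauerDiagram T U} {t : Setoid (S ⊕ T ⊕ U)} :
    stack d d' ≤ t ↔ d.rel ≤ t.comap i₁₂ ∧ d'.rel ≤ t.comap i₂₃ := by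
  rw [stack, sup_le_iff, map_le, map_le]

theorem le_comap_stack_left (d : BrauerDiagram S T) (d' : BrauerDiagram T U) :
    d.rel ≤ (stack d d').comap i₁₂ := (stack_le.1 le_rfl).1
theorem le_comap_stack_right (d : BrauerDiagram S T) (d' : BrauerDiagram T U) :
    d'.rel ≤ (stack d d').comap i₂₃ := (stack_le.1 le_rfl).2

theorem stack_matching (d : BrauerDiagram S T) (d' : BrauerDiagram T U) (x : S ⊕ U) :
    ∃! y, y ≠ x ∧ (stack d d').comap i₁₃ x y := by
  let p : S ⊕ T ⊕ U → S ⊕ T ⊕ U := Sum.elim (fun s => i₁₂ (d.partner (Sum.inl s)))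
    (Sum.elim (fun t => i₁₂ (d.partner (Sum.inr t))) (fun u => Sum.inr (Sum.inr u)))
  let q : S ⊕ T ⊕ U → S ⊕ T ⊕ U := Sum.elim Sum.inl (fun y => i₂₃ (d'.partner y))
  have hpi : ∀ y, p (i₁₂ y) = i₁₂ (d.partner y) := by rintro (y | y) <;> rfl
  have hqi : ∀ y, q (i₂₃ y) = i₂₃ (d'.partner y) := fun _ => rfl
  have hpu : ∀ u, p (Sum.inr (Sum.inr u)) = Sum.inr (Sum.inr u) := fun _ => rfl
  have hqs : ∀ s, q (Sum.inl s) = Sum.inl s := fun _ => rfl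
  have hp : p.Involutive := by
    have h : ∀ y, p (p (i₁₂ y)) = i₁₂ y := fun y => by rw [hpi, hpi, partner_partner]
    rintro (z | z | z)
    · exact h (Sum.inl z)
    · exact h (Sum.inr z)
    · rfl
  have hq : q.Involutive := by
    rintro (z | z)
    · rfl
    · exact (hqi _).trans (congrArg _ (d'.partner_partner z))
  have hpn : ∀ y, p (i₁₂ y) ≠ i₁₂ y := fun y h => d.partner_ne y (i₁₂_inj ((hpi y).symm.trans h))
  have hqn : ∀ y, q (i₂₃ y) ≠ i₂₃ y := fun y h => d'.partner_ne y (i₂₃_inj ((hqi y).symm.trans h))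
  have hJp : ∀ z, stack d d' z (p z) := by
    have h : ∀ y, stack d d' (i₁₂ y) (p (i₁₂ y)) := fun y => by
      rw [hpi]
      exact le_comap_stack_left d d' (d.rel_partner y)
    rintro (z | z | z)
    · exact h (Sum.inl z)
    · exact h (Sum.inr z)
    · exact (stack d d').refl _
  have hJq : ∀ z, stack d d' z (q z) := by
    rintro (z | z)
    · exact (stack d d').refl _
    · exact le_comap_stack_right d d' (d'.rel_partner z)
  have hJ : ∀ t : Setoid (S ⊕ T ⊕ U), (∀ z, t z (p z)) → (∀ z, t z (q z)) → stack d d' ≤ t := by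
    intro t h1 h2
    refine stack_le.2 ⟨fun x y h => ?_, fun x y h => ?_⟩
    · by_cases hne : y = x
      · rw [hne]
      · rw [d.eq_partner h hne]
        have := h1 (i₁₂ x)
        rwa [hpi] at this
    · by_cases hne : y = x
      · rw [hne]
      · rw [d'.eq_partner h hne]
        exact h2 (i₂₃ x)
  have hpq : ∀ z, p z = z → q z ≠ z := by
    rintro (z | z | z) h
    · exact absurd h (hpn (Sum.inl z))
    · exact hqn (Sum.inl z)
    · exact hqn (Sum.inr z)
  have hfix : ∀ z, (p z = z ∨ q z = z) ↔ ∃ y, i₁₃ y = z := by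
    rintro (z | z | z)
    · exact ⟨fun _ => ⟨Sum.inl z, rfl⟩, fun _ => Or.inr rfl⟩
    · refine ⟨fun h => ?_, ?_⟩
      · rcases h with h | h
        · exact absurd h (hpn (Sum.inr z))
        · exact absurd h (hqn (Sum.inl z))
      · rintro ⟨y | y, h⟩ <;> simp [i₁₃] at h
    · exact ⟨fun _ => ⟨Sum.inr z, rfl⟩, fun _ => Or.inl rfl⟩
  have key : ∃! y, y ≠ i₁₃ x ∧ stack d d' (i₁₃ x) y ∧ (p y = y ∨ q y = y) := by
    rcases x with x | x
    · exact dihedral hp hq hpq hJp hJq hJ (hqs x)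
    · have := dihedral hq hp (fun z h h' => hpq z h' h) hJq hJp (fun t h1 h2 => hJ t h2 h1) (hpu x)
      refine (existsUnique_congr fun y => ?_).1 this
      rw [or_comm (a := q y = y)]
      rfl
  obtain ⟨y, ⟨h1, h2, h3⟩, h4⟩ := key
  obtain ⟨y, rfl⟩ := (hfix y).1 h3
  refine ⟨y, ⟨fun h => h1 (by rw [h]), h2⟩, fun y' ⟨h1', h2'⟩ => i₁₃_inj (h4 _ ⟨fun h => h1' (i₁₃_inj h), h2', ?_⟩)⟩
  exact (hfix _).2 ⟨_, rfl⟩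

/-- The diagram obtained by stacking two diagrams and forgetting the middle row. -/
def comp (d : BrauerDiagram S T) (d' : BrauerDiagram T U) : BrauerDiagram S U where
  rel := (stack d d').comap i₁₃
  matching := stack_matching d d'

/-- The number of closed loops (the components contained in the middle row) that appear when two
diagrams are stacked. -/
def loops (d : BrauerDiagram S T) (d' : BrauerDiagram T U) : ℕ :=
  missed (stack d d') i₁₃

theorem comp_comp (d₁ : BrauerDiagram S T) (d₂ : BrauerDiagram T U) (d₃ : BrauerDiagram U W) :
    (d₁.comp d₂).comp d₃ = d₁.comp (d₂.comp d₃) ∧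
      loops (d₁.comp d₂) d₃ + loops d₁ d₂ = loops d₁ (d₂.comp d₃) + loops d₂ d₃ := by
  let h : S ⊕ T ⊕ U → S ⊕ T ⊕ U ⊕ W := Sum.map id (Sum.map id Sum.inl)
  let i : S ⊕ U ⊕ W → S ⊕ T ⊕ U ⊕ W := Sum.map id Sum.inr
  let h' : T ⊕ U ⊕ W → S ⊕ T ⊕ U ⊕ W := Sum.inr
  let i' : S ⊕ T ⊕ W → S ⊕ T ⊕ U ⊕ W := Sum.map id (Sum.map id Sum.inr)
  have H : IsAmalgam h i (i₁₃ : S ⊕ U → S ⊕ T ⊕ U) (i₁₂ : S ⊕ U → S ⊕ U ⊕ W) := by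
    constructor
    · rintro (x | x | x) (y | y | y) hxy <;> simp_all [h]
    · rintro (x | x | x) (y | y | y) h <;> simp_all [i]
    · rintro (x | x) <;> rfl
    · rintro (x | x | x) (y | y | y) hxy <;> simp_all [h, i, i₁₃, i₁₂]
    · rintro (z | z | z | z)
      · exact Or.inl ⟨Sum.inl z, rfl⟩
      · exact Or.inl ⟨Sum.inr (Sum.inl z), rfl⟩
      · exact Or.inl ⟨Sum.inr (Sum.inr z), rfl⟩
      · exact Or.inr ⟨Sum.inr (Sum.inr z), rfl⟩
  have H' : IsAmalgam h' i' (i₁₃ : T ⊕ W → T ⊕ U ⊕ W) (i₂₃ : T ⊕ W → S ⊕ T ⊕ W) := by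
    constructor
    · rintro (x | x | x) (y | y | y) h <;> simp_all [h']
    · rintro (x | x | x) (y | y | y) h <;> simp_all [i']
    · rintro (x | x) <;> rfl
    · rintro (x | x | x) (y | y | y) hxy <;> simp_all [h', i', i₁₃, i₂₃]
    · rintro (z | z | z | z)
      · exact Or.inr ⟨Sum.inl z, rfl⟩
      · exact Or.inr ⟨Sum.inr (Sum.inl z), rfl⟩
      · exact Or.inl ⟨Sum.inr (Sum.inl z), rfl⟩
      · exact Or.inr ⟨Sum.inr (Sum.inr z), rfl⟩
  have hJ : (stack d₁ d₂).map h ⊔ d₃.rel.map (i ∘ i₂₃) =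
      (stack d₂ d₃).map h' ⊔ d₁.rel.map (i' ∘ i₁₂) := by
    have e1 : h ∘ (i₁₂ : S ⊕ T → S ⊕ T ⊕ U) = i' ∘ i₁₂ := by ext (x | x) <;> rfl
    have e2 : h ∘ (i₂₃ : T ⊕ U → S ⊕ T ⊕ U) = h' ∘ i₁₂ := by ext (x | x) <;> rfl
    have e3 : i ∘ (i₂₃ : U ⊕ W → S ⊕ U ⊕ W) = h' ∘ i₂₃ := by ext (x | x) <;> rfl
    rw [stack, stack, Gluing.map_sup, Gluing.map_sup, map_map, map_map, map_map, map_map, e1, e2, e3, sup_assoc,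
      sup_comm]
  have e4 : i ∘ (i₁₃ : S ⊕ W → S ⊕ U ⊕ W) = i' ∘ i₁₃ := by ext (x | x) <;> rfl
  have hl := H.missed_glue i₁₃_inj i₂₃_inj (stack d₁ d₂) d₃.rel (i₁₃ : S ⊕ W → S ⊕ U ⊕ W)
  have hr := H'.missed_glue i₁₃_inj i₁₂_inj (stack d₂ d₃) d₁.rel (i₁₃ : S ⊕ W → S ⊕ T ⊕ W)
  have gl := H.comap_glue i₁₃_inj i₂₃_inj (stack d₁ d₂) d₃.rel
  have gr := H'.comap_glue i₁₃_inj i₁₂_inj (stack d₂ d₃) d₁.rel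
  rw [hJ, e4] at hl
  rw [sup_comm (b := d₁.rel.map i₁₂)] at hr gr
  constructor
  · apply BrauerDiagram.ext
    have gl' := congrArg (Setoid.comap (i₁₃ : S ⊕ W → S ⊕ U ⊕ W)) gl
    have gr' := congrArg (Setoid.comap (i₁₃ : S ⊕ W → S ⊕ T ⊕ W)) gr
    rw [← Setoid.comap_comp] at gl' gr'
    rw [hJ, e4, gr'] at gl'
    exact gl'.symm
  · exact hl.symm.trans hr

/-- The diagram of a bijection. -/
def ofEquiv (f : S ≃ T) : BrauerDiagram S T where
  rel := Setoid.ker (Sum.elim f id)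
  matching := by
    rintro (x | x)
    · refine ⟨Sum.inr (f x), ⟨by simp, rfl⟩, ?_⟩
      rintro (y | y) ⟨h1, h2⟩
      · exact absurd (f.injective h2).symm (fun h => h1 (by rw [h]))
      · exact congrArg Sum.inr (Eq.symm h2)
    · refine ⟨Sum.inl (f.symm x), ⟨by simp, (f.apply_symm_apply x).symm⟩, ?_⟩
      rintro (y | y) ⟨h1, h2⟩
      · exact congrArg Sum.inl (f.eq_symm_apply.2 (Eq.symm h2))
      · exact absurd (Eq.symm h2) (fun h => h1 (congrArg Sum.inr h))

/-- Relabelling the points of a diagram. -/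
def relabel {S' T' : FB} (d : BrauerDiagram S T) (f : S ≃ S') (g : T ≃ T') : BrauerDiagram S' T' where
  rel := d.rel.comap (Sum.map f.symm g.symm)
  matching x := by
    obtain ⟨y, ⟨h1, h2⟩, h3⟩ := d.matching (Sum.map f.symm g.symm x)
    have e : ∀ z, Sum.map f.symm g.symm (Sum.map f g z) = z := by rintro (z | z) <;> simp
    have e' : ∀ z, Sum.map f g (Sum.map f.symm g.symm z) = z := by rintro (z | z) <;> simp
    refine ⟨Sum.map f g y, ⟨fun h => h1 (by rw [← h, e]), ?_⟩, fun z ⟨hz, hz'⟩ => ?_⟩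
    · rw [Setoid.comap_rel, e]
      exact h2
    · rw [← h3 _ ⟨fun h => hz ?_, hz'⟩, e']
      rw [← e' z, h, e']

theorem comp_ofEquiv (d : BrauerDiagram S T) (f : T ≃ U) :
    d.comp (ofEquiv f) = d.relabel (Equiv.refl S) f ∧ loops d (ofEquiv f) = 0 := by
  have hT : ∀ t, stack d (ofEquiv f) (Sum.inr (Sum.inl t)) (Sum.inr (Sum.inr (f t))) := fun t =>
    le_comap_stack_right d (ofEquiv f) (show (ofEquiv f).rel (Sum.inl t) (Sum.inr (f t)) from rfl)
  constructor
  · apply BrauerDiagram.ext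
    let ρ : S ⊕ T ⊕ U → S ⊕ T := Sum.map id (Sum.elim id f.symm)
    have h1 : stack d (ofEquiv f) ≤ d.rel.comap ρ := by
      refine stack_le.2 ⟨fun x y h => ?_, fun x y h => ?_⟩
      · have e : ∀ z, ρ (i₁₂ z) = z := by rintro (z | z) <;> rfl
        rw [Setoid.comap_rel, Setoid.comap_rel, e, e]
        exact h
      · have e : ∀ z, ρ (i₂₃ z) = Sum.inr (f.symm (Sum.elim f id z)) := by
          rintro (z | z) <;> simp [ρ, i₂₃]
        have h : Sum.elim f id x = Sum.elim f id y := h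
        rw [Setoid.comap_rel, Setoid.comap_rel, e, e, h]
    have h2 : ∀ x, stack d (ofEquiv f) (i₁₃ x) (i₁₂ (Sum.map id f.symm x)) := by
      rintro (x | x)
      · exact Setoid.refl' _ _
      · have := hT (f.symm x)
        rw [f.apply_symm_apply] at this
        exact Setoid.symm' _ this
    ext x y
    constructor
    · intro h
      have := h1 h
      rw [Setoid.comap_rel] at this
      have e : ∀ z, ρ (i₁₃ z) = Sum.map id f.symm z := by rintro (z | z) <;> rfl
      rwa [e, e] at this
    · intro h
      exact Setoid.trans' (stack d (ofEquiv f)) (h2 x) (Setoid.trans' (stack d (ofEquiv f)) (le_comap_stack_left d (ofEquiv f) h)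
        (Setoid.symm' (stack d (ofEquiv f)) (h2 y)))
  · have : IsEmpty {c : Quotient (stack d (ofEquiv f)) //
        ∀ a, c ≠ Quotient.mk (stack d (ofEquiv f)) (i₁₃ a)} := by
      refine ⟨fun ⟨c, hc⟩ => ?_⟩
      induction c using Quotient.inductionOn with
      | h z =>
        rcases z with z | z | z
        · exact hc (Sum.inl z) rfl
        · exact hc (Sum.inr (f z)) (Quotient.sound (hT z))
        · exact hc (Sum.inr z) rfl
    exact Nat.card_of_isEmpty

theorem ofEquiv_comp (f : S ≃ T) (d : BrauerDiagram T U) :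
    (ofEquiv f).comp d = d.relabel f.symm (Equiv.refl U) ∧ loops (ofEquiv f) d = 0 := by
  have hT : ∀ s, stack (ofEquiv f) d (Sum.inl s) (Sum.inr (Sum.inl (f s))) := fun s =>
    le_comap_stack_left (ofEquiv f) d (show (ofEquiv f).rel (Sum.inl s) (Sum.inr (f s)) from rfl)
  constructor
  · apply BrauerDiagram.ext
    let ρ : S ⊕ T ⊕ U → T ⊕ U := Sum.elim (Sum.inl ∘ f) id
    have h1 : stack (ofEquiv f) d ≤ d.rel.comap ρ := by
      refine stack_le.2 ⟨fun x y h => ?_, fun x y h => h⟩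
      have e : ∀ z, ρ (i₁₂ z) = Sum.inl (Sum.elim f id z) := by rintro (z | z) <;> rfl
      have h : Sum.elim f id x = Sum.elim f id y := h
      rw [Setoid.comap_rel, Setoid.comap_rel, e, e, h]
    have h2 : ∀ x, stack (ofEquiv f) d (i₁₃ x) (i₂₃ (Sum.map f id x)) := by
      rintro (x | x)
      · exact hT x
      · exact Setoid.refl' _ _
    ext x y
    constructor
    · intro h
      have := h1 h
      rw [Setoid.comap_rel] at this
      have e : ∀ z, ρ (i₁₃ z) = Sum.map f id z := by rintro (z | z) <;> rfl
      rwa [e, e] at this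
    · intro h
      exact Setoid.trans' (stack (ofEquiv f) d) (h2 x) (Setoid.trans' (stack (ofEquiv f) d) (le_comap_stack_right (ofEquiv f) d h)
        (Setoid.symm' (stack (ofEquiv f) d) (h2 y)))
  · have : IsEmpty {c : Quotient (stack (ofEquiv f) d) //
        ∀ a, c ≠ Quotient.mk (stack (ofEquiv f) d) (i₁₃ a)} := by
      refine ⟨fun ⟨c, hc⟩ => ?_⟩
      induction c using Quotient.inductionOn with
      | h z =>
        rcases z with z | z | z
        · exact hc (Sum.inl z) rfl
        · refine hc (Sum.inl (f.symm z)) (Quotient.sound ?_)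
          have := hT (f.symm z)
          rw [f.apply_symm_apply] at this
          exact Setoid.symm' _ this
        · exact hc (Sum.inr z) rfl
    exact Nat.card_of_isEmpty

/-- The diagram `B → S` with one edge in the target, obtained from a decomposition `A ⊔ B ≃ S`
where `A` has two elements: these two elements are joined, and the elements of `B` are joined to
their images in `S`. -/
def cup {A B S : FB} (e : A ⊕ B ≃ S) (h : Nat.card A = 2) : BrauerDiagram B S where
  rel := Setoid.ker (Sum.elim some fun s => Sum.elim (fun _ => none) some (e.symm s))
  matching := by
    rintro (b | s)
    · refine ⟨Sum.inr (e (Sum.inr b)), ⟨by simp, by simp [Setoid.ker_def]⟩, ?_⟩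
      rintro (b' | s) ⟨h1, h2⟩
      · exact absurd (Option.some_injective _ h2).symm (fun h => h1 (by rw [h]))
      · obtain ⟨a | b', rfl⟩ := e.surjective s <;> simp_all [Setoid.ker_def]
    · obtain ⟨a | b, rfl⟩ := e.surjective s
      · obtain ⟨a', h1, h2⟩ := (Nat.card_eq_two_iff' a).1 h
        refine ⟨Sum.inr (e (Sum.inl a')), ⟨by simpa using h1, by simp [Setoid.ker_def]⟩, ?_⟩
        rintro (b' | s) ⟨h3, h4⟩
        · simp [Setoid.ker_def] at h4
        · obtain ⟨a'' | b', rfl⟩ := e.surjective s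
          · rw [h2 a'' (by simpa using h3)]
          · simp [Setoid.ker_def] at h4
      · refine ⟨Sum.inl b, ⟨by simp, by simp [Setoid.ker_def]⟩, ?_⟩
        rintro (b' | s) ⟨h1, h2⟩
        · simp_all [Setoid.ker_def]
        · obtain ⟨a | b', rfl⟩ := e.surjective s <;> simp_all [Setoid.ker_def]

/-- The opposite diagram. -/
def opp (d : BrauerDiagram S T) : BrauerDiagram T S where
  rel := d.rel.comap Sum.swap
  matching x := by
    obtain ⟨y, ⟨h1, h2⟩, h3⟩ := d.matching x.swap
    refine ⟨y.swap, ⟨fun h => h1 (by rw [← h, Sum.swap_swap]), ?_⟩, fun z ⟨hz, hz'⟩ => ?_⟩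
    · rw [Setoid.comap_rel, Sum.swap_swap]
      exact h2
    · rw [← h3 _ ⟨fun h => hz ?_, hz'⟩, Sum.swap_swap]
      rw [← Sum.swap_swap z, h, Sum.swap_swap]

/-- The diagram `S → B` opposite to `cup`. -/
def cap {A B S : FB} (e : A ⊕ B ≃ S) (h : Nat.card A = 2) : BrauerDiagram S B :=
  (cup e h).opp

theorem cup_congr {A B S A' B' S' : FB} (e : A ⊕ B ≃ S) (h : Nat.card A = 2) (e' : A' ⊕ B' ≃ S')
    (h' : Nat.card A' = 2) (f : A ≃ A') (g : B ≃ B') (u : S ≃ S')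
    (H : ∀ x, u (e x) = e' (Sum.map f g x)) : (cup e h).relabel g u = cup e' h' := by
  have H' : ∀ s, e.symm (u.symm s) = Sum.map f.symm g.symm (e'.symm s) := by
    intro s
    obtain ⟨x, rfl⟩ := e'.surjective s
    obtain ⟨y, rfl⟩ := (Equiv.sumCongr f g).surjective x
    have h1 := H y
    rw [← u.eq_symm_apply, ← e.eq_symm_apply] at h1
    rcases y with y | y <;> simpa using h1.symm
  have e1 : ∀ z : B' ⊕ S', Sum.elim some (fun s => Sum.elim (fun _ => none) some (e.symm s))
      (Sum.map g.symm u.symm z) = Option.map g.symm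
        (Sum.elim some (fun s => Sum.elim (fun _ => none) some (e'.symm s)) z) := by
    rintro (z | z)
    · rfl
    · simp only [Sum.map_inr, Sum.elim_inr, H']
      rcases e'.symm z with x | x <;> rfl
  apply BrauerDiagram.ext
  ext x y
  change (Sum.elim some (fun s => Sum.elim (fun _ => none) some (e.symm s)) (Sum.map g.symm u.symm x)
    = Sum.elim some (fun s => Sum.elim (fun _ => none) some (e.symm s)) (Sum.map g.symm u.symm y)) ↔
    (Sum.elim some (fun s => Sum.elim (fun _ => none) some (e'.symm s)) x
    = Sum.elim some (fun s => Sum.elim (fun _ => none) some (e'.symm s)) y)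
  rw [e1, e1, (Option.map_injective g.symm.injective).eq_iff]

theorem relabel_opp {S' T' : FB} (d : BrauerDiagram S T) (f : S ≃ S') (g : T ≃ T') :
    (d.relabel f g).opp = d.opp.relabel g f := by
  apply BrauerDiagram.ext
  ext x y
  change d.rel _ _ ↔ d.rel _ _
  rcases x with x | x <;> rcases y with y | y <;> rfl

theorem cap_congr {A B S A' B' S' : FB} (e : A ⊕ B ≃ S) (h : Nat.card A = 2) (e' : A' ⊕ B' ≃ S')
    (h' : Nat.card A' = 2) (f : A ≃ A') (g : B ≃ B') (u : S ≃ S')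
    (H : ∀ x, u (e x) = e' (Sum.map f g x)) : (cap e h).relabel u g = cap e' h' := by
  rw [cap, cap, ← relabel_opp, cup_congr e h e' h' f g u H]

theorem relabel_ofEquiv {S' T' : FB} (u : S ≃ T) (f : S ≃ S') (g : T ≃ T') :
    (ofEquiv u).relabel f g = ofEquiv ((f.symm.trans u).trans g) := by
  apply BrauerDiagram.ext
  ext x y
  have e : ∀ z, Sum.elim ((f.symm.trans u).trans g) id z =
      g (Sum.elim u id (Sum.map f.symm g.symm z)) := by rintro (z | z) <;> simp
  change Sum.elim u id _ = Sum.elim u id _ ↔ Sum.elim _ id x = Sum.elim _ id y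
  rw [e, e, g.apply_eq_iff_eq]

theorem relabel_refl (d : BrauerDiagram S T) :
    d.relabel (Equiv.refl S) (Equiv.refl T) = d := by
  apply BrauerDiagram.ext
  ext x y
  change d.rel _ _ ↔ d.rel _ _
  rcases x with x | x <;> rcases y with y | y <;> rfl

end
end BrauerDiagram

/-- The Brauer category with parameter `δ`. Its objects are the finite sets, and its morphisms are
the formal `k`-linear combinations of Brauer diagrams. -/
structure Brauer {k : Type u} [CommRing k] (_δ : k) : Type 1 where
  of ::
  set : FB

namespace Brauer

open BrauerDiagram

noncomputable section

variable {k : Type u} [CommRing k] (δ : k)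

/-- Bilinear extension of the composition of diagrams: `d ⬝ d' = δ ^ (number of loops) • d.comp d'`,
where `d : S → T` and `d' : T → U`. -/
def compₗ (S T U : FB) : (BrauerDiagram S T →₀ k) →ₗ[k] (BrauerDiagram T U →₀ k) →ₗ[k]
    (BrauerDiagram S U →₀ k) :=
  Finsupp.linearCombination k fun d => Finsupp.linearCombination k fun d' =>
    Finsupp.single (d.comp d') (δ ^ loops d d')

theorem compₗ_single {S T U : FB} (d : BrauerDiagram S T) (d' : BrauerDiagram T U) (a b : k) :
    compₗ δ S T U (Finsupp.single d a) (Finsupp.single d' b) =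
      Finsupp.single (d.comp d') (a * b * δ ^ loops d d') := by
  rw [compₗ, Finsupp.linearCombination_single, LinearMap.smul_apply,
    Finsupp.linearCombination_single, Finsupp.smul_single, Finsupp.smul_single, smul_eq_mul,
    smul_eq_mul, mul_assoc]

theorem compₗ_assoc {S T U W : FB} (f : BrauerDiagram S T →₀ k) (g : BrauerDiagram T U →₀ k)
    (h : BrauerDiagram U W →₀ k) : compₗ δ S U W (compₗ δ S T U f g) h =
      compₗ δ S T W f (compₗ δ T U W g h) := by
  induction f using Finsupp.induction_linear with
  | zero => simp
  | add f f' hf hf' => simp only [map_add, LinearMap.add_apply, hf, hf']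
  | single d a =>
    induction g using Finsupp.induction_linear with
    | zero => simp
    | add f f' hf hf' => simp only [map_add, LinearMap.add_apply, hf, hf']
    | single d' b =>
      induction h using Finsupp.induction_linear with
      | zero => simp
      | add f f' hf hf' => simp only [map_add, hf, hf']
      | single d'' c =>
        obtain ⟨h1, h2⟩ := comp_comp d d' d''
        simp only [compₗ_single, h1]
        congr 1
        have h3 : δ ^ loops (d.comp d') d'' * δ ^ loops d d' =
            δ ^ loops d (d'.comp d'') * δ ^ loops d' d'' := by rw [← pow_add, ← pow_add, h2]
        linear_combination a * b * c * h3

instance : Category (Brauer δ) where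
  Hom S T := BrauerDiagram S.set T.set →₀ k
  id S := Finsupp.single (ofEquiv (Equiv.refl S.set)) 1
  comp f g := compₗ δ _ _ _ f g
  id_comp {S T} f := by
    refine LinearMap.congr_fun (g := LinearMap.id) (Finsupp.lhom_ext fun d a => ?_) f
    rw [compₗ_single, (ofEquiv_comp _ d).1, (ofEquiv_comp _ d).2]
    simp [relabel_refl]
  comp_id {S T} f := by
    refine LinearMap.congr_fun (f := (compₗ δ _ _ _).flip _) (g := LinearMap.id)
      (Finsupp.lhom_ext fun d a => ?_) f
    rw [LinearMap.flip_apply, compₗ_single, (comp_ofEquiv d _).1, (comp_ofEquiv d _).2]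
    simp [relabel_refl]
  assoc f g h := compₗ_assoc δ f g h

instance : Preadditive (Brauer δ) where
  homGroup S T := inferInstanceAs (AddCommGroup (BrauerDiagram S.set T.set →₀ k))
  add_comp S T U f f' g :=
    LinearMap.map_add₂ (compₗ δ S.set T.set U.set) (show BrauerDiagram S.set T.set →₀ k from f)
      (show BrauerDiagram S.set T.set →₀ k from f') g
  comp_add S T U f g g' :=
    map_add (compₗ δ S.set T.set U.set f) (show BrauerDiagram T.set U.set →₀ k from g)
      (show BrauerDiagram T.set U.set →₀ k from g')

instance : Linear k (Brauer δ) where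
  homModule S T := inferInstanceAs (Module k (BrauerDiagram S.set T.set →₀ k))
  smul_comp S T U r f g :=
    LinearMap.map_smul₂ (compₗ δ S.set T.set U.set) r (show BrauerDiagram S.set T.set →₀ k from f) g
  comp_smul S T U f r g :=
    map_smul (compₗ δ S.set T.set U.set f) r (show BrauerDiagram T.set U.set →₀ k from g)

/-- The morphism given by a diagram. -/
def diag {S T : FB} (d : BrauerDiagram S T) : Brauer.of (_δ := δ) S ⟶ Brauer.of T :=
  Finsupp.single d 1

theorem diag_comp {S T U : FB} (d : BrauerDiagram S T) (d' : BrauerDiagram T U) :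
    diag δ d ≫ diag δ d' = δ ^ loops d d' • diag δ (d.comp d') := by
  refine (compₗ_single δ d d' 1 1).trans ?_
  change _ = δ ^ loops d d' • Finsupp.single (d.comp d') (1 : k)
  rw [Finsupp.smul_single]
  simp

/-- The functor from finite sets and bijections to the Brauer category. -/
def ofFB : FB ⥤ Brauer δ where
  obj S := Brauer.of S
  map {S T} f := diag δ (ofEquiv (S := S) (T := T) f)
  map_id _ := rfl
  map_comp {S T U} f g := by
    rw [diag_comp, (comp_ofEquiv _ _).1, (comp_ofEquiv _ _).2, pow_zero, one_smul]
    exact congrArg (diag δ) (relabel_ofEquiv (S := S) (T := T) f (Equiv.refl S) g).symm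

/-- Modules over the Brauer category: `k`-linear functors to the category of `k`-modules. -/
abbrev Mod : Type (max 1 (u + 1)) :=
  ObjectProperty.FullSubcategory fun F : Brauer δ ⥤ ModuleCat.{u} k => F.Additive ∧ F.Linear k

end
end Brauer

namespace Curried

universe v w
variable {C : Type w} [Category.{v} C] [Preadditive C] [MonoidalCategory C] [SymmetricCategory C]

/-- Interchange of the first two factors of `V ⊗ W ⊗ M`. -/
def swap (V W M : C) : V ⊗ W ⊗ M ⟶ W ⊗ V ⊗ M :=
  (α_ V W M).inv ≫ (β_ V W).hom ▷ M ≫ (α_ W V M).hom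

/-- `a : V ⊗ M → V ⊗ M` is a representation of the curried general linear Lie algebra on `M`:
`[a₁, a₂] = τ (a₁ - a₂)`, where `τ` interchanges the two factors `V` of `V ⊗ V ⊗ M`,
`a₂ = id ⊗ a` and `a₁ = τ a₂ τ`. -/
def IsGlRep {V M : C} (a : V ⊗ M ⟶ V ⊗ M) : Prop :=
  let τ := swap V V M
  let a₂ := V ◁ a
  let a₁ := τ ≫ a₂ ≫ τ
  a₂ ≫ a₁ - a₁ ≫ a₂ = (a₁ - a₂) ≫ τ

/-- The action on a tensor product `W ⊗ M` of representations of the curried general linear Lie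
algebra on `V`. -/
def tensorAct {V W M : C} (c : V ⊗ W ⟶ V ⊗ W) (a : V ⊗ M ⟶ V ⊗ M) : V ⊗ W ⊗ M ⟶ V ⊗ W ⊗ M :=
  (α_ V W M).inv ≫ c ▷ M ≫ (α_ V W M).hom + swap V W M ≫ W ◁ a ≫ swap W V M

/-- A divided square `Div² V`, i.e., invariants of the symmetric group on `V ⊗ V`, together with
its comultiplication `Δ : Div² V → V ⊗ V`, and a symmetric square `Sym² V`, i.e., coinvariants
of the symmetric group on `V ⊗ V`, together with its multiplication `m : V ⊗ V → Sym² V`. -/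
structure Squares (V : C) where
  div : C
  sym : C
  Δ : div ⟶ V ⊗ V
  m : V ⊗ V ⟶ sym
  Δ_symm : Δ ≫ (β_ V V).hom = Δ ≫ 𝟙 (V ⊗ V)
  m_symm : (β_ V V).hom ≫ m = 𝟙 (V ⊗ V) ≫ m
  isInvariants : IsLimit (Fork.ofι Δ Δ_symm)
  isCoinvariants : IsColimit (Cofork.ofπ m m_symm)

namespace Squares

variable {V : C} (Q : Squares V)

theorem norm_symm : (𝟙 (V ⊗ V) + (β_ V V).hom) ≫ (β_ V V).hom =
    (𝟙 (V ⊗ V) + (β_ V V).hom) ≫ 𝟙 (V ⊗ V) := by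
  simp [add_comm]

theorem symm_norm : (β_ V V).hom ≫ (𝟙 (V ⊗ V) + (β_ V V).hom) =
    𝟙 (V ⊗ V) ≫ (𝟙 (V ⊗ V) + (β_ V V).hom) := by
  simp [add_comm]

/-- The multiplication `V ⊗ V → Div² V`, `v ⊗ w ↦ v ⊗ w + w ⊗ v`. -/
def divMul : V ⊗ V ⟶ Q.div := Fork.IsLimit.lift Q.isInvariants _ norm_symm

/-- The comultiplication `Sym² V → V ⊗ V`, `v w ↦ v ⊗ w + w ⊗ v`. -/
def symComul : Q.sym ⟶ V ⊗ V := Cofork.IsColimit.desc Q.isCoinvariants _ symm_norm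

@[simp]
theorem divMul_Δ : Q.divMul ≫ Q.Δ = 𝟙 (V ⊗ V) + (β_ V V).hom :=
  Fork.IsLimit.lift_ι' Q.isInvariants _ norm_symm

@[simp]
theorem m_symComul : Q.m ≫ Q.symComul = 𝟙 (V ⊗ V) + (β_ V V).hom :=
  Cofork.IsColimit.π_desc' Q.isCoinvariants _ symm_norm

/-- The natural action of the curried general linear Lie algebra on `Div² V`, given by
`v ⊗ w₁ w₂ ↦ w₁ ⊗ v w₂ + w₂ ⊗ v w₁` and `v ⊗ w^[2] ↦ w ⊗ v w`. -/
def divAct : V ⊗ Q.div ⟶ V ⊗ Q.div := V ◁ Q.Δ ≫ swap V V V ≫ V ◁ Q.divMul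

/-- The natural action of the curried general linear Lie algebra on `Sym² V`, given by
`v ⊗ w₁ w₂ ↦ w₁ ⊗ v w₂ + w₂ ⊗ v w₁`. -/
def symAct : V ⊗ Q.sym ⟶ V ⊗ Q.sym := V ◁ Q.symComul ≫ swap V V V ≫ V ◁ Q.m

theorem swap_braid : swap V V V ≫ V ◁ (β_ V V).hom ≫ swap V V V = V ◁ (β_ V V).hom ≫ swap V V V ≫ V ◁ (β_ V V).hom := by
  simpa [swap] using BraidedCategory.yang_baxter V V V

theorem divAct_Δ [MonoidalPreadditive C] : Q.divAct ≫ V ◁ Q.Δ = V ◁ Q.Δ ≫ tensorAct (β_ V V).hom (β_ V V).hom := by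
  have h : V ◁ Q.Δ ≫ V ◁ (β_ V V).hom = V ◁ Q.Δ := by
    rw [← MonoidalCategory.whiskerLeft_comp, Q.Δ_symm, Category.comp_id]
  rw [divAct, tensorAct, swap_braid, Preadditive.comp_add, reassoc_of% h]
  simp only [Category.assoc, ← MonoidalCategory.whiskerLeft_comp, divMul_Δ, MonoidalPreadditive.whiskerLeft_add, Preadditive.comp_add, MonoidalCategory.whiskerLeft_id, Category.comp_id]
  rfl

theorem m_symAct [MonoidalPreadditive C] : V ◁ Q.m ≫ Q.symAct = tensorAct (β_ V V).hom (β_ V V).hom ≫ V ◁ Q.m := by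
  have h : V ◁ (β_ V V).hom ≫ V ◁ Q.m = V ◁ Q.m := by
    rw [← MonoidalCategory.whiskerLeft_comp, Q.m_symm, Category.id_comp]
  rw [symAct, tensorAct, swap_braid, Preadditive.add_comp]
  simp only [Category.assoc, h]
  rw [← Category.assoc, ← MonoidalCategory.whiskerLeft_comp, m_symComul, MonoidalPreadditive.whiskerLeft_add, Preadditive.add_comp, MonoidalCategory.whiskerLeft_id, Category.id_comp]
  simp [swap]

end Squares

/-- An object `M` together with maps `a : V ⊗ M → V ⊗ M`, `b : Div² V ⊗ M → M` and
`b' : M → Sym² V ⊗ M`, not subject to any condition. -/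
structure SpData {V : C} (Q : Squares V) where
  M : C
  a : V ⊗ M ⟶ V ⊗ M
  b : Q.div ⊗ M ⟶ M
  b' : M ⟶ Q.sym ⊗ M

namespace SpData

variable {V : C} {Q : Squares V}

/-- Morphisms are the maps of the underlying objects that commute with `a`, `b` and `b'`. -/
@[ext]
structure Hom (X Y : SpData Q) where
  hom : X.M ⟶ Y.M
  comm_a : X.a ≫ V ◁ hom = V ◁ hom ≫ Y.a
  comm_b : X.b ≫ hom = Q.div ◁ hom ≫ Y.b
  comm_b' : X.b' ≫ Q.sym ◁ hom = hom ≫ Y.b'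

instance : Category (SpData Q) where
  Hom X Y := Hom X Y
  id X := ⟨𝟙 X.M, by simp, by simp, by simp⟩
  comp f g := ⟨f.hom ≫ g.hom, by simp [reassoc_of% f.comm_a, g.comm_a],
    by simp [reassoc_of% f.comm_b, g.comm_b], by simp [reassoc_of% f.comm_b', g.comm_b']⟩

/-- The conditions under which `(M, a, b, b')` is a module over the curried symplectic algebra
on `V ⊕ V*`. -/
structure IsSpModule (X : SpData Q) : Prop where
  /-- `a` defines a representation of the curried general linear Lie algebra. -/
  gl : IsGlRep X.a
  /-- `b b₂ = b b₁`, as maps `Div² V ⊗ Div² V ⊗ M → M`. -/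
  b_comm : Q.div ◁ X.b ≫ X.b = (swap Q.div Q.div X.M ≫ Q.div ◁ X.b) ≫ X.b
  /-- `b'₁ b' = b'₂ b'`, as maps `M → Sym² V ⊗ Sym² V ⊗ M`. -/
  b'_comm : X.b' ≫ Q.sym ◁ X.b' ≫ swap Q.sym Q.sym X.M = X.b' ≫ Q.sym ◁ X.b'
  /-- `b` is a map of representations of the curried general linear Lie algebra. -/
  b_equivariant : V ◁ X.b ≫ X.a = tensorAct Q.divAct X.a ≫ V ◁ X.b
  /-- `b'` is a map of representations of the curried general linear Lie algebra. -/
  b'_equivariant : X.a ≫ V ◁ X.b' = V ◁ X.b' ≫ tensorAct Q.symAct X.a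
  /-- `b' b - b₁ b'₂ = (m ⊗ 1) (1 ⊗ a) (Δ ⊗ 1)`, as maps `Div² V ⊗ M → Sym² V ⊗ M`. -/
  bracket : X.b ≫ X.b' - Q.div ◁ X.b' ≫ swap Q.div Q.sym X.M ≫ Q.sym ◁ X.b =
    Q.Δ ▷ X.M ≫ (α_ V V X.M).hom ≫ V ◁ X.a ≫ (α_ V V X.M).inv ≫ Q.m ▷ X.M

end SpData

end Curried

namespace FBMod

noncomputable section

variable {k : Type u} [CommRing k]

instance (S : FB) : Fintype S := Fintype.ofFinite S

instance : MonoidalPreadditive (FBMod k) where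
  whiskerLeft_zero := tensor_hom_ext fun S A B e m n => by
    rw [app_whiskerLeft]
    exact map_zero _
  zero_whiskerRight := tensor_hom_ext fun S A B e m n => by
    rw [app_whiskerRight]
    exact LinearMap.map_zero₂ _ _
  whiskerLeft_add f g := tensor_hom_ext fun S A B e m n => by
    rw [app_add, app_whiskerLeft, app_whiskerLeft, app_whiskerLeft, app_add, map_add]
  add_whiskerRight f g := tensor_hom_ext fun S A B e m n => by
    rw [app_add, app_whiskerRight, app_whiskerRight, app_whiskerRight, app_add, LinearMap.map_add₂]

instance : MonoidalLinear k (FBMod k) where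
  whiskerLeft_smul X _ _ r f := tensor_hom_ext fun S A B e m n => by
    rw [app_smul, app_whiskerLeft, app_whiskerLeft, app_smul, map_smul]
  smul_whiskerRight r _ _ f X := tensor_hom_ext fun S A B e m n => by
    rw [app_smul, app_whiskerRight, app_whiskerRight, app_smul, LinearMap.map_smul₂]

theorem app_braiding (M N : FBMod k) {A B S : FB} (e : A ⊕ B ≃ S) (m : M.ev A) (n : N.ev B) :
    app (β_ M N).hom S (tmul e m n) = tmul ((Equiv.sumComm B A).trans e) n m :=
  app_braidHom M N e m n

/-- The standard species: `k` on sets of cardinality `1` and `0` on all other sets. -/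
abbrev V (k : Type u) [CommRing k] : FBMod k := std 1

theorem range_inl_eq {A B S : FB} (h : Nat.card A = 1) (e : A ⊕ B ≃ S) (a : A) :
    (Set.range fun a => e (Sum.inl a)) = {e (Sum.inl a)} := by
  have := (Nat.card_eq_one_iff_unique.1 h).1
  ext s
  constructor
  · rintro ⟨a', rfl⟩
    rw [Subsingleton.elim a a']
    rfl
  · rintro rfl
    exact ⟨a, rfl⟩

/-- The element `t^i ⊗ t^j` of `(V ⊗ V)(S)`, where `S = {i, j}` has two elements (it is `0` if the
cardinality of `S` is not two). -/
def pt {S : FB} (i : S) : (V k ⊗ V k : FBMod k).ev S :=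
  tmul (cut {i}) (one 1 (FB.sub {i})) (one 1 (FB.sub {i}ᶜ))

theorem tmul_eq_cut {M N : FBMod k} {A B S : FB} (e : A ⊕ B ≃ S) (m : M.ev A) (n : N.ev B) :
    tmul e m n = tmul (cut (Set.range fun a => e (Sum.inl a))) (M.mp (T := FB.sub _) (leftPart e) m)
      (N.mp (T := FB.sub _) (rightPart e) n) := by
  rw [tmul_mp (A' := FB.sub _) (B' := FB.sub _)]
  exact tmul_eq (by rintro (x | x) <;> rfl) _ _

theorem tmul_one_one {A B S : FB} (h : Nat.card A = 1) (e : A ⊕ B ≃ S) (a : A) :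
    tmul e (one (k := k) 1 A) (one (k := k) 1 B) = pt (e (Sum.inl a)) := by
  rw [tmul_eq_cut, mp_one, mp_one, range_inl_eq h e a]
  rfl

theorem mp_pt {S T : FB} (f : S ≃ T) (i : S) :
    (V k ⊗ V k : FBMod k).mp f (pt i) = pt (f i) := by
  rw [pt]
  refine (mp_tmul _ _ _ _).trans ?_
  exact tmul_one_one (A := FB.sub {i}) (by simp) _ ⟨i, rfl⟩

/-- The comultiplication `t^{ij} ↦ t^i ⊗ t^j + t^j ⊗ t^i`. -/
def comul : std 2 ⟶ (V k ⊗ V k : FBMod k) :=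
  homMk (fun S => LinearMap.toSpanSingleton k _ (∑ i : S, pt i) ∘ₗ coef 2 S) (by
    intro S T f x
    simp only [LinearMap.comp_apply, LinearMap.toSpanSingleton_apply, coef_mp, map_smul, map_sum,
      mp_pt]
    rw [Equiv.sum_comp f (fun i => pt (k := k) i)])

/-- The multiplication `t^i ⊗ t^j ↦ t^{ij}`. -/
def mul : (V k ⊗ V k : FBMod k) ⟶ std 2 :=
  descHom (fun {S A B} _ => ((LinearMap.mul k k).compl₁₂ (coef 1 A) (coef 1 B)).compr₂
      (LinearMap.toSpanSingleton k _ (one 2 S)))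
    (by intros; simp) (by intros; simp)

theorem app_comul {S : FB} (x : (std (k := k) 2).ev S) :
    app comul S x = coef 2 S x • ∑ i : S, pt i := rfl

theorem app_mul {A B S : FB} (e : A ⊕ B ≃ S) (x : (V k).ev A) (y : (V k).ev B) :
    app mul S (tmul e x y) = (coef 1 A x * coef 1 B y) • one 2 S :=
  app_descHom _ _ _ _ _ _

open Classical in
/-- The coefficient of `t^i ⊗ t^j`. -/
def ptCoef {S : FB} (i : S) : (V k ⊗ V k : FBMod k).ev S →ₗ[k] k :=
  desc fun {A B} e => if ∃ a, e (Sum.inl a) = i then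
    (LinearMap.mul k k).compl₁₂ (coef 1 A) (coef 1 B) else 0

open Classical in
theorem ptCoef_tmul {A B S : FB} (i : S) (e : A ⊕ B ≃ S) (x : (V k).ev A) (y : (V k).ev B) :
    ptCoef i (tmul e x y) = if ∃ a, e (Sum.inl a) = i then coef 1 A x * coef 1 B y else 0 := by
  rw [ptCoef, desc_tmul]
  · split_ifs <;> rfl
  · intro A B A' B' f g e' m n
    have : (∃ a, e' (Sum.inl a) = i) ↔ ∃ a, ((Equiv.sumCongr f g).trans e') (Sum.inl a) = i :=
      f.symm.exists_congr_left.trans (by simp)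
    by_cases h : ∃ a, e' (Sum.inl a) = i
    · rw [if_pos h, if_pos (this.1 h)]
      simp
    · rw [if_neg h, if_neg (this.not.1 h)]
      rfl

theorem eq_sum_ptCoef {S : FB} (w : (V k ⊗ V k : FBMod k).ev S) :
    w = ∑ i : S, ptCoef i w • pt i := by
  classical
  induction w using tensor_induction with
  | add x y hx hy =>
    conv_lhs => rw [hx, hy]
    simp only [map_add, add_smul, Finset.sum_add_distrib]
  | tmul A B e x y =>
    by_cases hA : Nat.card A = 1
    · have a : A := (Nat.card_eq_one_iff_unique.1 hA).2.some
      have := (Nat.card_eq_one_iff_unique.1 hA).1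
      rw [Finset.sum_eq_single (e (Sum.inl a)), ptCoef_tmul, if_pos ⟨a, rfl⟩]
      · conv_lhs => rw [← coef_smul_one x, ← coef_smul_one y]
        rw [map_smul, map_smul, LinearMap.smul_apply, tmul_one_one hA e a, smul_smul, mul_comm]
      · intro i _ hi
        rw [ptCoef_tmul, if_neg, zero_smul]
        rintro ⟨a', rfl⟩
        exact hi (by rw [Subsingleton.elim a a'])
      · exact fun h => absurd (Finset.mem_univ _) h
    · have hx : x = 0 := by rw [← coef_smul_one x, coef_eq_zero hA, zero_smul]
      rw [hx, LinearMap.map_zero₂]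
      refine (Finset.sum_eq_zero fun i _ => ?_).symm
      rw [map_zero, zero_smul]

theorem app_braiding_pt {S : FB} (hS : Nat.card S = 2) {i j : S} (h : j ≠ i) :
    app (β_ (V k) (V k)).hom S (pt i) = pt j := by
  rw [pt, app_braiding]
  have hij : ∀ z, z ∈ ({i}ᶜ : Set S) ↔ z = j := by
    obtain ⟨y, hy, hy'⟩ := (Nat.card_eq_two_iff' i).1 hS
    intro z
    rw [hy' j h]
    exact ⟨fun hz => hy' z hz, fun hz => by rw [hz]; exact hy⟩
  refine tmul_one_one (A := FB.sub {i}ᶜ) ?_ _ ⟨j, (hij j).2 rfl⟩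
  rw [Nat.card_eq_one_iff_unique]
  exact ⟨⟨fun x y => Subtype.ext (((hij _).1 x.2).trans ((hij _).1 y.2).symm)⟩, ⟨⟨j, (hij j).2 rfl⟩⟩⟩

theorem card_compl {S : FB} (i : S) :
    Nat.card (FB.sub ({i}ᶜ : Set S)) = 1 ↔ Nat.card S = 2 := by
  have h := Nat.card_congr (cut ({i} : Set S))
  have h' : Nat.card (FB.sub ({i} : Set S)) = 1 := by simp
  rw [Nat.card_sum, h'] at h
  omega

theorem pt_eq_zero {S : FB} (hS : Nat.card S ≠ 2) (i : S) : pt (k := k) i = 0 := by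
  rw [pt, ← coef_smul_one (one 1 (FB.sub ({i}ᶜ : Set S))),
    coef_eq_zero ((card_compl i).not.2 hS), zero_smul]
  exact map_zero _

theorem ptCoef_pt {S : FB} (hS : Nat.card S = 2) (i j : S) [Decidable (i = j)] :
    ptCoef (k := k) i (pt j) = if i = j then 1 else 0 := by
  rw [pt, ptCoef_tmul, coef_one (S := FB.sub {j}) (by simp), coef_one ((card_compl j).2 hS), mul_one]
  by_cases h : i = j
  · rw [if_pos h, if_pos ⟨⟨j, rfl⟩, h.symm⟩]
  · rw [if_neg h, if_neg]
    rintro ⟨a, ha⟩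
    exact h (ha.symm.trans a.2)

theorem mul_pt {S : FB} (hS : Nat.card S = 2) (i : S) : app mul S (pt (k := k) i) = one 2 S := by
  rw [pt, app_mul, coef_one (S := FB.sub {i}) (by simp), coef_one ((card_compl i).2 hS), mul_one,
    one_smul]

theorem exists_pair {S : FB} (hS : Nat.card S = 2) : ∃ i j : S, j ≠ i ∧ i ≠ j ∧
    ∀ {P : Type u} [AddCommGroup P] (f : S → P), ∑ s : S, f s = f i + f j := by
  classical
  have : Nonempty S := (Nat.card_pos_iff.1 (by omega)).1
  obtain ⟨i⟩ := this
  obtain ⟨j, hj, hj'⟩ := (Nat.card_eq_two_iff' i).1 hS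
  refine ⟨i, j, hj, hj.symm, fun f => ?_⟩
  have : (Finset.univ : Finset S) = {i, j} := by
    ext s
    by_cases hs : s = i
    · simp [hs]
    · simp [hj' s hs]
  rw [this, Finset.sum_pair hj.symm]

theorem comul_injective (S : FB) : Function.Injective (app (comul (k := k)) S) := by
  classical
  rw [injective_iff_map_eq_zero]
  intro x hx
  by_cases hS : Nat.card S = 2
  · obtain ⟨i, j, hji, hij, hsum⟩ := exists_pair.{u} hS
    have h := congrArg (ptCoef i) hx
    rw [app_comul, hsum, map_smul, map_add, ptCoef_pt hS, ptCoef_pt hS, if_pos rfl, if_neg hij,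
      map_zero, add_zero, smul_eq_mul, mul_one] at h
    rw [← coef_smul_one x, h, zero_smul]
  · rw [← coef_smul_one x, coef_eq_zero hS, zero_smul]

theorem exists_comul {S : FB} (w : (V k ⊗ V k : FBMod k).ev S)
    (hw : app (β_ (V k) (V k)).hom S w = w) : ∃ x, app comul S x = w := by
  classical
  by_cases hS : Nat.card S = 2
  · obtain ⟨i, j, hji, hij, hsum⟩ := exists_pair.{u} hS
    have h1 := eq_sum_ptCoef w
    rw [hsum] at h1
    have h2 := congrArg (fun w => ptCoef i (app (β_ (V k) (V k)).hom S w)) h1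
    simp only [hw, map_add, map_smul, app_braiding_pt hS hji, app_braiding_pt hS hij, ptCoef_pt hS,
      if_neg hij, if_true, smul_eq_mul, mul_zero, mul_one, zero_add] at h2
    refine ⟨ptCoef i w • one 2 S, ?_⟩
    rw [app_comul, map_smul, coef_one hS, smul_eq_mul, mul_one, hsum, smul_add]
    conv_rhs => rw [h1, ← h2]
  · refine ⟨0, ?_⟩
    conv_rhs => rw [eq_sum_ptCoef w]
    rw [map_zero]
    exact (Finset.sum_eq_zero fun i _ => by rw [pt_eq_zero hS, smul_zero]).symm

theorem mul_surjective (S : FB) : Function.Surjective (app (mul (k := k)) S) := by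
  intro x
  by_cases hS : Nat.card S = 2
  · obtain ⟨i, -⟩ := exists_pair.{u} hS
    exact ⟨coef 2 S x • pt i, by rw [map_smul, mul_pt hS, coef_smul_one]⟩
  · exact ⟨0, by rw [← coef_smul_one x, coef_eq_zero hS, zero_smul, map_zero]⟩

theorem eq_zero_of_mul {S : FB} {P : Type u} [AddCommGroup P] [Module k P]
    (φ : (V k ⊗ V k : FBMod k).ev S →ₗ[k] P)
    (hφ : ∀ w, φ (app (β_ (V k) (V k)).hom S w) = φ w) (w : (V k ⊗ V k : FBMod k).ev S)
    (hw : app mul S w = 0) : φ w = 0 := by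
  by_cases hS : Nat.card S = 2
  · obtain ⟨i, j, hji, hij, hsum⟩ := exists_pair.{u} hS
    have h1 := eq_sum_ptCoef w
    rw [hsum] at h1
    have h2 := congrArg (coef 2 S) hw
    rw [h1, map_add, map_smul, map_smul, mul_pt hS, mul_pt hS, ← add_smul, map_smul, coef_one hS,
      map_zero, smul_eq_mul, mul_one] at h2
    have h3 := hφ (pt i)
    rw [app_braiding_pt hS hji] at h3
    rw [h1, map_add, map_smul, map_smul, h3, ← add_smul, h2, zero_smul]
  · rw [eq_sum_ptCoef w, map_sum]
    exact Finset.sum_eq_zero fun i _ => by rw [pt_eq_zero hS, smul_zero, map_zero]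

theorem braiding_braiding_app {S : FB} (w : (V k ⊗ V k : FBMod k).ev S) :
    app (β_ (V k) (V k)).hom S (app (β_ (V k) (V k)).hom S w) = w := by
  rw [← app_comp, SymmetricCategory.symmetry, app_id]

theorem comul_symm : comul ≫ (β_ (V k) (V k)).hom = comul ≫ 𝟙 _ :=
  hom_ext fun S => LinearMap.ext fun x => by
    classical
    rw [app_comp, Category.comp_id, app_comul, map_smul]
    by_cases hS : Nat.card S = 2
    · obtain ⟨i, j, hji, hij, hsum⟩ := exists_pair.{u} hS
      rw [hsum, map_add, app_braiding_pt hS hji, app_braiding_pt hS hij, add_comm]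
    · rw [coef_eq_zero hS, zero_smul, zero_smul]

theorem symm_mul : (β_ (V k) (V k)).hom ≫ mul = 𝟙 _ ≫ mul :=
  tensor_hom_ext' fun S A B e x y => by
    rw [app_comp, app_braiding, app_mul, Category.id_comp, app_mul, mul_comm]

/-- A linear map to the invariants of `(V ⊗ V)(S)`, as a map to `Div²(S)`. -/
def invLift {S : FB} {P : Type u} [AddCommGroup P] [Module k P]
    (φ : P →ₗ[k] (V k ⊗ V k : FBMod k).ev S)
    (hφ : ∀ x, app (β_ (V k) (V k)).hom S (φ x) = φ x) : P →ₗ[k] (std (k := k) 2).ev S :=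
  (LinearEquiv.ofInjective (app comul S) (comul_injective S)).symm.toLinearMap ∘ₗ
    φ.codRestrict (LinearMap.range (app comul S)) (fun x => exists_comul _ (hφ x))

theorem comul_invLift {S : FB} {P : Type u} [AddCommGroup P] [Module k P]
    (φ : P →ₗ[k] (V k ⊗ V k : FBMod k).ev S) (hφ) (x : P) :
    app comul S (invLift φ hφ x) = φ x :=
  congrArg Subtype.val ((LinearEquiv.ofInjective (app comul S) (comul_injective S)).apply_symm_apply
    (φ.codRestrict (LinearMap.range (app comul S)) (fun x => exists_comul _ (hφ x)) x))

/-- A linear map out of the coinvariants of `(V ⊗ V)(S)`, as a map out of `Sym²(S)`. -/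
def coinvDesc {S : FB} {P : Type u} [AddCommGroup P] [Module k P]
    (φ : (V k ⊗ V k : FBMod k).ev S →ₗ[k] P)
    (hφ : ∀ w, φ (app (β_ (V k) (V k)).hom S w) = φ w) : (std (k := k) 2).ev S →ₗ[k] P :=
  (LinearMap.ker (app mul S)).liftQ φ (fun w hw => eq_zero_of_mul φ hφ w hw) ∘ₗ
    ((app mul S).quotKerEquivOfSurjective (mul_surjective S)).symm.toLinearMap

theorem coinvDesc_mul {S : FB} {P : Type u} [AddCommGroup P] [Module k P]
    (φ : (V k ⊗ V k : FBMod k).ev S →ₗ[k] P) (hφ) (w : (V k ⊗ V k : FBMod k).ev S) :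
    coinvDesc φ hφ (app mul S w) = φ w := by
  have : ((app mul S).quotKerEquivOfSurjective (mul_surjective S)).symm (app mul S w) =
      Submodule.Quotient.mk w := by
    rw [LinearEquiv.symm_apply_eq]
    rfl
  rw [coinvDesc, LinearMap.comp_apply, LinearEquiv.coe_coe, this]
  rfl

theorem app_symm {X : FBMod k} {φ : X ⟶ V k ⊗ V k} (h : φ ≫ (β_ (V k) (V k)).hom = φ) (S : FB)
    (x : X.ev S) : app (β_ (V k) (V k)).hom S (app φ S x) = app φ S x := by
  rw [← app_comp, h]

theorem symm_app {X : FBMod k} {φ : V k ⊗ V k ⟶ X} (h : (β_ (V k) (V k)).hom ≫ φ = φ) (S : FB)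
    (w : (V k ⊗ V k : FBMod k).ev S) : app φ S (app (β_ (V k) (V k)).hom S w) = app φ S w := by
  rw [← app_comp, h]

/-- The factorization through `Div² V` of a map to `V ⊗ V` with symmetric image. -/
def invHom {X : FBMod k} (φ : X ⟶ V k ⊗ V k) (h : φ ≫ (β_ (V k) (V k)).hom = φ) : X ⟶ std 2 :=
  homMk (fun S => invLift (app φ S) (app_symm h S))
    (by
      intro S T f x
      apply comul_injective T
      rw [comul_invLift, app_mp, app_mp, comul_invLift])

theorem invHom_comul {X : FBMod k} (φ : X ⟶ V k ⊗ V k) (h) : invHom φ h ≫ comul = φ :=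
  hom_ext fun S => LinearMap.ext fun x =>
    comul_invLift (app φ S) (app_symm h S) x

theorem comul_cancel {X : FBMod k} {φ ψ : X ⟶ std (k := k) 2} (h : φ ≫ comul = ψ ≫ comul) : φ = ψ :=
  hom_ext fun S => LinearMap.ext fun x => comul_injective S (congrArg (fun f => app f S x) h)

/-- The factorization through `Sym² V` of a symmetric map out of `V ⊗ V`. -/
def coinvHom {X : FBMod k} (φ : V k ⊗ V k ⟶ X) (h : (β_ (V k) (V k)).hom ≫ φ = φ) : std 2 ⟶ X :=
  homMk (fun S => coinvDesc (app φ S) (symm_app h S))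
    (by
      intro S T f x
      obtain ⟨w, rfl⟩ := mul_surjective S x
      rw [← app_mp, coinvDesc_mul, coinvDesc_mul, app_mp])

theorem mul_coinvHom {X : FBMod k} (φ : V k ⊗ V k ⟶ X) (h) : mul ≫ coinvHom φ h = φ :=
  hom_ext fun S => LinearMap.ext fun x =>
    coinvDesc_mul (app φ S) (symm_app h S) x

theorem mul_cancel {X : FBMod k} {φ ψ : std (k := k) 2 ⟶ X} (h : mul ≫ φ = mul ≫ ψ) : φ = ψ :=
  hom_ext fun S => LinearMap.ext fun x => by
    obtain ⟨w, rfl⟩ := mul_surjective S x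
    exact congrArg (fun f => app f S w) h

/-- `Div²` and `Sym²` of the standard species: both are `k` on sets of cardinality `2` and `0` on
all other sets. -/
def squares (k : Type u) [CommRing k] : Curried.Squares (V k) where
  div := std 2
  sym := std 2
  Δ := comul
  m := mul
  Δ_symm := comul_symm
  m_symm := symm_mul
  isInvariants := Fork.IsLimit.mk _
    (fun s => invHom s.ι (s.condition.trans (Category.comp_id _)))
    (fun _ => invHom_comul _ _)
    (fun _ _ hm => comul_cancel (hm.trans (invHom_comul _ _).symm))
  isCoinvariants := Cofork.IsColimit.mk _
    (fun s => coinvHom s.π (s.condition.trans (Category.id_comp _)))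
    (fun _ => mul_coinvHom _ _)
    (fun _ _ hm => mul_cancel (hm.trans (mul_coinvHom _ _).symm))

theorem mp_tmul' {M N : FBMod k} {A B S T : FB} (u : S ≃ T) (e : A ⊕ B ≃ S) (m : M.ev A) (n : N.ev B) :
    (M ⊗ N).mp u (tmul e m n) = tmul (e.trans u) m n :=
  mp_tmul _ _ _ _

open Classical in
/-- The `δ`-standard representation of the curried general linear Lie algebra on a species:
`t^j ⊗ x ↦ δ t^j ⊗ x + ∑_{i ∈ S \ j} t^i ⊗ ι_{i,j}(x)`, where `ι_{i,j} : S \ j → S \ i` sends `i`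
to `j` and fixes all other elements. Here `t^i ⊗ ι_{i,j}(x)` is described by composing the
decomposition `e : {j} ⊔ (S \ j) ≃ S` with the transposition of `j` and `i`. -/
def glStd (δ : k) (M : FBMod k) : V k ⊗ M ⟶ V k ⊗ M :=
  descHom (fun {_ A B} e => δ • tmul e +
      ∑ a : A, ∑ b : B, tmul ((Equiv.swap (Sum.inl a) (Sum.inr b)).trans e))
    (by
      intro S A B A' B' f g e' v x
      simp only [LinearMap.add_apply, LinearMap.smul_apply, LinearMap.sum_apply, tmul_mp]
      congr 1
      rw [← Equiv.sum_comp f]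
      refine Finset.sum_congr rfl fun a _ => ?_
      rw [← Equiv.sum_comp g]
      refine Finset.sum_congr rfl fun b _ => tmul_eq (fun z => ?_) _ _
      exact congrArg e' ((Equiv.sumCongr f g).injective.map_swap (Sum.inl a) (Sum.inr b) z).symm)
    (by
      intro S T A B u e v x
      simp only [LinearMap.add_apply, LinearMap.smul_apply, LinearMap.sum_apply, map_add, map_smul,
        map_sum, mp_tmul']
      rfl)

open Classical in
theorem app_glStd (δ : k) (M : FBMod k) {A B S : FB} (e : A ⊕ B ≃ S) (v : (V k).ev A) (x : M.ev B) :
    app (glStd δ M) S (tmul e v x) = δ • tmul e v x +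
      ∑ a : A, ∑ b : B, tmul ((Equiv.swap (Sum.inl a) (Sum.inr b)).trans e) v x := by
  refine (app_descHom _ _ _ _ _ _).trans ?_
  simp only [LinearMap.add_apply, LinearMap.smul_apply, LinearMap.sum_apply]

end
end FBMod

namespace Brauer

open BrauerDiagram FBMod

noncomputable section

variable {k : Type u} [CommRing k] {δ : k}

/-- The restriction of a module over the Brauer category to the category of finite sets and
bijections. -/
def res : Mod δ ⥤ FBMod k :=
  show Mod δ ⥤ (FB ⥤ ModuleCat.{u} k) from
    ObjectProperty.ι _ ⋙ (Functor.whiskeringLeft _ _ _).obj (ofFB δ)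

/-- The action of a Brauer diagram on a module over the Brauer category. -/
def act (M : Mod δ) {S T : FB} (d : BrauerDiagram S T) : (res.obj M).ev S →ₗ[k] (res.obj M).ev T :=
  (M.obj.map (diag δ d)).hom

theorem mp_eq (M : Mod δ) {S T : FB} (f : S ≃ T) (x : (res.obj M).ev S) :
    (res.obj M).mp f x = act M (ofEquiv f) x := rfl

theorem act_act (M : Mod δ) {S T U : FB} (d : BrauerDiagram S T) (d' : BrauerDiagram T U)
    (h : loops d d' = 0) (x : (res.obj M).ev S) : act M d' (act M d x) = act M (d.comp d') x := by
  have := M.obj.map_comp (diag δ d) (diag δ d')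
  rw [diag_comp, h, pow_zero, one_smul] at this
  exact (congrArg (fun f => f.hom x) this).symm

theorem relabel_act (M : Mod δ) {S T S' T' : FB} (d : BrauerDiagram S T) (f : S ≃ S') (g : T ≃ T')
    (x : (res.obj M).ev S) :
    act M (d.relabel f g) ((res.obj M).mp f x) = (res.obj M).mp g (act M d x) := by
  rw [mp_eq, mp_eq, act_act _ _ _ (ofEquiv_comp _ _).2, act_act _ _ _ (comp_ofEquiv _ _).2,
    (ofEquiv_comp _ _).1, (comp_ofEquiv _ _).1]
  congr 2
  apply BrauerDiagram.ext
  ext x y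
  change d.rel _ _ ↔ d.rel _ _
  rcases x with x | x <;> rcases y with y | y <;> simp

theorem app_act {M N : Mod δ} (φ : M ⟶ N) {S T : FB} (d : BrauerDiagram S T)
    (x : (res.obj M).ev S) :
    app (res.map φ) T (act M d x) = act N d (app (res.map φ) S x) :=
  congrArg (fun f => f.hom x) (φ.hom.naturality (diag δ d))

/-- The map `Div² V ⊗ M → M`, `t^{ij} ⊗ x ↦ M(cup)(x)`, where the cup joins `i` and `j`. -/
def cupMap (M : Mod δ) : std 2 ⊗ res.obj M ⟶ res.obj M :=
  open Classical in
  descHom (fun {_ A _} e => if h : Nat.card A = 2 then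
      (LinearMap.lsmul k _).compl₁₂ (coef 2 A) (act M (cup e h)) else 0)
    (by
      intro S A B A' B' f g e' v x
      by_cases h : Nat.card A = 2
      · have h' : Nat.card A' = 2 := (Nat.card_congr f).symm.trans h
        rw [dif_pos h, dif_pos h']
        simp only [LinearMap.compl₁₂_apply, coef_mp, LinearMap.lsmul_apply]
        rw [← cup_congr ((Equiv.sumCongr f g).trans e') h e' h' f g (Equiv.refl S) (fun x => by
          rcases x with x | x <;> rfl), relabel_act, mp_refl]
      · have h' : Nat.card A' ≠ 2 := fun h' => h ((Nat.card_congr f).trans h')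
        rw [dif_neg h, dif_neg h']
        rfl)
    (by
      intro S T A B u e v x
      by_cases h : Nat.card A = 2
      · rw [dif_pos h, dif_pos h]
        simp only [LinearMap.compl₁₂_apply, LinearMap.lsmul_apply, map_smul]
        rw [← relabel_act _ _ (Equiv.refl B) u, mp_refl,
          cup_congr e h (e.trans u) h (Equiv.refl A) (Equiv.refl B) u (fun x => by
            rcases x with x | x <;> rfl)]
      · rw [dif_neg h, dif_neg h]
        exact (map_zero _).symm)

theorem app_cupMap (M : Mod δ) {A B S : FB} (e : A ⊕ B ≃ S) (h : Nat.card A = 2)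
    (v : (std (k := k) 2).ev A) (x : (res.obj M).ev B) :
    app (cupMap M) S (tmul e v x) = coef 2 A v • act M (cup e h) x := by
  refine (app_descHom _ _ _ _ _ _).trans ?_
  rw [dif_pos h]
  rfl

theorem app_cupMap_zero (M : Mod δ) {A B S : FB} (e : A ⊕ B ≃ S) (h : Nat.card A ≠ 2)
    (v : (std (k := k) 2).ev A) (x : (res.obj M).ev B) :
    app (cupMap M) S (tmul e v x) = 0 := by
  refine (app_descHom _ _ _ _ _ _).trans ?_
  rw [dif_neg h]
  rfl

/-- The summand `t^{ij} ⊗ M(cap)(x)` of `capMap`, where `T = {i, j}` and the cap joins `i` and `j`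
(it is `0` if `T` does not have two elements). -/
def capTerm (M : Mod δ) {S : FB} (T : Set S) :
    (res.obj M).ev S →ₗ[k] (std 2 ⊗ res.obj M : FBMod k).ev S :=
  open Classical in
  if h : Nat.card (FB.sub T) = 2 then tmul (cut T) (one 2 (FB.sub T)) ∘ₗ act M (cap (cut T) h) else 0

theorem mp_capTerm (M : Mod δ) {S S' : FB} (f : S ≃ S') (T : Set S) (x : (res.obj M).ev S) :
    capTerm M (f '' T) ((res.obj M).mp f x) = (std 2 ⊗ res.obj M : FBMod k).mp f (capTerm M T x) := by
  let f₁ : FB.sub T ≃ FB.sub (f '' T) := f.image T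
  let f₂ : FB.sub Tᶜ ≃ FB.sub (f '' T)ᶜ := (f.image Tᶜ).trans
    (Equiv.setCongr (Set.image_compl_eq f.bijective))
  have H : ∀ z, f (cut T z) = cut (f '' T) (Sum.map f₁ f₂ z) := by rintro (z | z) <;> rfl
  by_cases h : Nat.card (FB.sub T) = 2
  · have h' : Nat.card (FB.sub (f '' T)) = 2 := (Nat.card_congr f₁).symm.trans h
    rw [capTerm, capTerm, dif_pos h, dif_pos h', LinearMap.comp_apply, LinearMap.comp_apply,
      ← cap_congr (cut T) h (cut (f '' T)) h' f₁ f₂ f H, relabel_act, mp_tmul', ← mp_one 2 f₁,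
      tmul_mp]
    exact tmul_eq (fun z => (H z).symm) _ _
  · have h' : Nat.card (FB.sub (f '' T)) ≠ 2 := fun h' => h ((Nat.card_congr f₁).trans h')
    rw [capTerm, capTerm, dif_neg h, dif_neg h']
    exact (map_zero _).symm

/-- The map `M → Sym² V ⊗ M`, `x ↦ ∑ t^{ij} ⊗ M(cap)(x)`, the sum over all two-element subsets
`{i, j}` of the given finite set, where the cap joins `i` and `j`. -/
def capMap (M : Mod δ) : res.obj M ⟶ std 2 ⊗ res.obj M :=
  homMk (fun S => ∑ T : Set S, capTerm M T) (by
    intro S S' f x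
    rw [LinearMap.sum_apply, LinearMap.sum_apply, map_sum]
    refine Fintype.sum_equiv (Equiv.Set.congr f).symm _ _ fun T => ?_
    rw [← mp_capTerm]
    congr 1
    exact congrArg _ ((Equiv.Set.congr f).apply_symm_apply T).symm)

theorem app_capMap (M : Mod δ) {S : FB} (x : (res.obj M).ev S) :
    app (capMap M) S x = ∑ T : Set S, capTerm M T x :=
  LinearMap.sum_apply _ _ _

theorem glStd_naturality (δ : k) {M N : FBMod k} (φ : M ⟶ N) :
    glStd δ M ≫ V k ◁ φ = V k ◁ φ ≫ glStd δ N :=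
  tensor_hom_ext' fun S A B e v x => by
    rw [app_comp, app_comp, app_whiskerLeft, app_glStd, app_glStd]
    simp only [map_add, map_smul, map_sum, app_whiskerLeft]

theorem cupMap_naturality {M N : Mod δ} (φ : M ⟶ N) :
    cupMap M ≫ res.map φ = std 2 ◁ res.map φ ≫ cupMap N :=
  tensor_hom_ext' fun S A B e v x => by
    rw [app_comp, app_comp, app_whiskerLeft]
    by_cases h : Nat.card A = 2
    · rw [app_cupMap _ _ h, app_cupMap _ _ h, map_smul, app_act]
    · rw [app_cupMap_zero _ _ h, app_cupMap_zero _ _ h, map_zero]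

theorem capMap_naturality {M N : Mod δ} (φ : M ⟶ N) :
    capMap M ≫ std 2 ◁ res.map φ = res.map φ ≫ capMap N :=
  hom_ext fun S => LinearMap.ext fun x => by
    rw [app_comp, app_comp, app_capMap, app_capMap, map_sum]
    refine Finset.sum_congr rfl fun T _ => ?_
    by_cases h : Nat.card (FB.sub T) = 2
    · rw [capTerm, capTerm, dif_pos h, dif_pos h, LinearMap.comp_apply, LinearMap.comp_apply,
        app_whiskerLeft, app_act]
    · rw [capTerm, capTerm, dif_neg h, dif_neg h]
      exact map_zero _

/-- The data `(a, b, b')` on the underlying species of a module over the Brauer category with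
parameter `2δ`: `a` is the `δ`-standard representation of the curried general linear Lie algebra,
`b` is given by the cups, and `b'` is given by the caps. Morphisms are sent to the underlying maps
of species. -/
def toSpData (δ : k) : Mod (2 * δ) ⥤ Curried.SpData (squares k) where
  obj M :=
    { M := res.obj M
      a := glStd δ (res.obj M)
      b := cupMap M
      b' := capMap M }
  map φ :=
    { hom := res.map φ
      comm_a := glStd_naturality δ (res.map φ)
      comm_b := cupMap_naturality φ
      comm_b' := capMap_naturality φ }
  map_id _ := rfl
  map_comp _ _ := rfl

end

end Brauer

/-- The `δ`-standard representations of the curried symplectic algebra: the modules over the curried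
symplectic algebra such that the underlying representation of the curried general linear Lie
algebra is the `δ`-standard one. -/
def IsStandardSpRep {k : Type u} [CommRing k] (δ : k) :
    ObjectProperty (Curried.SpData (FBMod.squares k)) :=
  fun X => X.IsSpModule ∧ X.a = FBMod.glStd δ X.M

/-! A `δ`-standard module is the same thing as a species with an operator for every cup and every
cap, subject to the relations between cups and caps in the Brauer category of parameter `2δ`. The
values of `b` on `t^{ij} ⊗ x` and the coefficients of `t^{ij}` in `b'` are such operators, and they
determine `b` and `b'` (`std_tensor_hom_ext`, `comp_ext`). The structure `CupCap` records the
relations.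

Half of the axioms of a symplectic module are automatic in the standard case. The standard map
commutes with all maps of species, its parameters add up on tensor products (`tensorAct_glStd`), and
`V`, `Div²` and `Sym²` are `0`-standard. So any `b` and `b'` are equivariant, and naturality applied
to the standard map itself is the relation of the curried general linear algebra (`isGlRep_glStd`).
The remaining axioms are compared component by component. Axiom (b) says that operators of disjoint
pairs commute. In (d), the pair that is created and the pair that is contracted are equal, disjoint,
or share one point (`FB.trichotomy`). The term `b₁ b'₂` contributes only for disjoint pairs. The
right-hand side is `2δ` for equal pairs, since `Δ` has two terms and each contributes `δ`; it is a
bijection for pairs that share one point, and `0` for disjoint pairs. These are the removal of a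
loop, the straightening of a zigzag, and the commutation of a cup with a distant cap.

The heart of the matter is to extend a `CupCap` to all diagrams. Removing one arc at a time shows
that bijections, cups and caps generate (`generation`). The operator so obtained does not depend on
the order of removal (`Act.unique`): two arcs on the same side of a diagram are equal or disjoint,
so naturality and commutation move any given arc to the outermost position (`Act.cup_inv`,
`Act.cap_inv`). Compatibility with composition (`op_op`) comes down to a single cap applied after a
diagram (`cap_op`); there the mixed relations enter and the loops are counted.

Neither functor changes the underlying modules, so the two composites are identities on the nose
(`toMod_eq`, `toSpData_ofRep`). -/

namespace BrauerDiagram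

/-! ### Adding arcs to a Brauer diagram and removing them. -/

open Gluing

variable {S T U W : FB}

/-- All blocks of both partitions have exactly two elements, so a block of `d` contained in a block
of `d'` fills it. Identities between diagrams therefore need only one inclusion. -/
theorem ext_of_le {d d' : BrauerDiagram S T} (h : d.rel ≤ d'.rel) : d = d' := by
  apply BrauerDiagram.ext
  refine le_antisymm h fun x y hxy => ?_
  by_cases hne : y = x
  · subst hne
    exact d.rel.refl _
  · rw [d'.eq_partner hxy hne, ← d'.eq_partner (h (d.rel_partner x)) (d.partner_ne x)]
    exact d.rel_partner x

theorem stack_of_left {d : BrauerDiagram S T} {d' : BrauerDiagram T U} {x y : S ⊕ T}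
    (h : d.rel x y) : stack d d' (i₁₂ x) (i₁₂ y) := le_comap_stack_left d d' h

theorem stack_of_right {d : BrauerDiagram S T} {d' : BrauerDiagram T U} {x y : T ⊕ U}
    (h : d'.rel x y) : stack d d' (i₂₃ x) (i₂₃ y) := le_comap_stack_right d d' h

/-- A closed loop is a component inside the middle row, so it is ruled out by a path from each
middle point to an outer row. -/
theorem loops_eq_zero {d : BrauerDiagram S T} {d' : BrauerDiagram T U}
    (h : ∀ t, ∃ x, stack d d' (Sum.inr (Sum.inl t)) (i₁₃ x)) : loops d d' = 0 := by
  have : IsEmpty {c : Quotient (stack d d') // ∀ a, c ≠ Quotient.mk (stack d d') (i₁₃ a)} := by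
    refine ⟨fun ⟨c, hc⟩ => ?_⟩
    induction c using Quotient.inductionOn with
    | h z =>
      rcases z with z | z | z
      · exact hc (Sum.inl z) rfl
      · obtain ⟨x, hx⟩ := h z
        exact hc x (Quotient.sound hx)
      · exact hc (Sum.inr z) rfl
  exact Nat.card_of_isEmpty

@[simp] theorem opp_opp (d : BrauerDiagram S T) : d.opp.opp = d := by
  apply ext_of_le
  intro x y h
  change d.rel _ _ at h
  rwa [Sum.swap_swap, Sum.swap_swap] at h

/-- Reversing the order of the three rows carries one stack to the other. This turns statements
about cups into statements about caps. -/
theorem opp_comp (d : BrauerDiagram S T) (d' : BrauerDiagram T U) :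
    (d.comp d').opp = d'.opp.comp d.opp := by
  let σ : S ⊕ T ⊕ U → U ⊕ T ⊕ S :=
    Sum.elim (Sum.inr ∘ Sum.inr) (Sum.elim (Sum.inr ∘ Sum.inl) Sum.inl)
  have h : stack d d' ≤ (stack d'.opp d.opp).comap σ := by
    refine stack_le.2 ⟨fun x y hxy => ?_, fun x y hxy => ?_⟩
    · have e : ∀ z, σ (i₁₂ z) = i₂₃ z.swap := by rintro (z | z) <;> rfl
      rw [Setoid.comap_rel, Setoid.comap_rel, e, e]
      refine stack_of_right ?_
      change d.rel _ _
      rwa [Sum.swap_swap, Sum.swap_swap]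
    · have e : ∀ z, σ (i₂₃ z) = i₁₂ z.swap := by rintro (z | z) <;> rfl
      rw [Setoid.comap_rel, Setoid.comap_rel, e, e]
      refine stack_of_left ?_
      change d'.rel _ _
      rwa [Sum.swap_swap, Sum.swap_swap]
  apply ext_of_le
  intro x y hxy
  have e : ∀ z : U ⊕ S, σ (i₁₃ z.swap) = i₁₃ z := by rintro (z | z) <;> rfl
  have := h hxy
  rwa [Setoid.comap_rel, e, e] at this

theorem opp_ofEquiv (f : S ≃ T) : (ofEquiv f).opp = ofEquiv f.symm := by
  apply ext_of_le
  intro x y h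
  change Sum.elim f id x.swap = Sum.elim f id y.swap at h
  change Sum.elim f.symm id x = Sum.elim f.symm id y
  have e : ∀ z : T ⊕ S, Sum.elim f.symm id z = f.symm (Sum.elim f id z.swap) := by
    rintro (z | z) <;> simp
  rw [e, e, h]

theorem opp_cap {A B : FB} (e : A ⊕ B ≃ S) (h : Nat.card A = 2) : (cap e h).opp = cup e h :=
  opp_opp _

theorem cup_rel_inr {A B : FB} (e : A ⊕ B ≃ S) (h : Nat.card A = 2) (b : B) :
    (cup e h).rel (Sum.inl b) (Sum.inr (e (Sum.inr b))) := by
  change Sum.elim _ _ _ = Sum.elim _ _ _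
  simp

theorem cup_rel_inl {A B : FB} (e : A ⊕ B ≃ S) (h : Nat.card A = 2) (a a' : A) :
    (cup e h).rel (Sum.inr (e (Sum.inl a))) (Sum.inr (e (Sum.inl a'))) := by
  change Sum.elim _ _ _ = Sum.elim _ _ _
  simp

theorem cap_rel_inr {A B : FB} (e : A ⊕ B ≃ S) (h : Nat.card A = 2) (b : B) :
    (cap e h).rel (Sum.inl (e (Sum.inr b))) (Sum.inr b) :=
  Setoid.symm' _ (cup_rel_inr e h b)

theorem cap_rel_inl {A B : FB} (e : A ⊕ B ≃ S) (h : Nat.card A = 2) (a a' : A) :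
    (cap e h).rel (Sum.inl (e (Sum.inl a))) (Sum.inl (e (Sum.inl a'))) :=
  cup_rel_inl e h a a'

/-- For a decomposition `A ⊔ B ≃ T`, the inclusion of `S ⊔ B` into `S ⊔ T`. -/
def emb {A B T : FB} (S : FB) (e : A ⊕ B ≃ T) : S ⊕ B → S ⊕ T := Sum.map id fun b => e (Sum.inr b)

theorem emb_injective {A B : FB} (e : A ⊕ B ≃ T) : Function.Injective (emb S e) :=
  Sum.map_injective.2 ⟨Function.injective_id, e.injective.comp Sum.inr_injective⟩

theorem emb_or_arc {A B : FB} (e : A ⊕ B ≃ T) (x : S ⊕ T) :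
    (∃ x', x = emb S e x') ∨ ∃ a, x = Sum.inr (e (Sum.inl a)) := by
  rcases x with s | t
  · exact Or.inl ⟨Sum.inl s, rfl⟩
  · obtain ⟨a | b, rfl⟩ := e.surjective t
    · exact Or.inr ⟨a, rfl⟩
    · exact Or.inl ⟨Sum.inr b, rfl⟩

section cup

variable {A B : FB} (d : BrauerDiagram S B) (e : A ⊕ B ≃ T) (h : Nat.card A = 2)

theorem stack_cup (x : S ⊕ B) : stack d (cup e h) (i₁₂ x) (i₁₃ (emb S e x)) := by
  rcases x with s | b
  · exact Setoid.refl' _ _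
  · exact stack_of_right (cup_rel_inr e h b)

theorem loops_cup : loops d (cup e h) = 0 :=
  loops_eq_zero fun b => ⟨_, stack_cup d e h (Sum.inr b)⟩

theorem comp_cup_arc (a a' : A) :
    (d.comp (cup e h)).rel (Sum.inr (e (Sum.inl a))) (Sum.inr (e (Sum.inl a'))) :=
  stack_of_right (d := d) (cup_rel_inl e h a a')

/-- The strands of the cup prolong the edges of `d`, so these survive. Conversely, the partner of
`x` in `d` is carried to the partner of `emb S e x`, and partners are unique. -/
theorem comp_cup_emb {x y : S ⊕ B} :
    (d.comp (cup e h)).rel (emb S e x) (emb S e y) ↔ d.rel x y := by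
  have key : ∀ {x y}, d.rel x y → (d.comp (cup e h)).rel (emb S e x) (emb S e y) := fun {x y} hxy =>
    Setoid.trans' (stack d (cup e h)) (Setoid.symm' (stack d (cup e h)) (stack_cup d e h x))
      (Setoid.trans' (stack d (cup e h)) (stack_of_left hxy) (stack_cup d e h y))
  refine ⟨fun hxy => ?_, key⟩
  by_cases hne : y = x
  · subst hne
    exact d.rel.refl _
  · have h1 := eq_partner _ hxy ((emb_injective e).ne hne)
    rw [← eq_partner _ (key (d.rel_partner x)) ((emb_injective e).ne (d.partner_ne x))] at h1
    rw [emb_injective e h1]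
    exact d.rel_partner x

/-- The prolonged edges of `d` and the new arc already match all points, so they generate the
partition. -/
theorem comp_cup_le {t : Setoid (S ⊕ T)} (h1 : ∀ x y, d.rel x y → t (emb S e x) (emb S e y))
    (h2 : ∀ a a', t (Sum.inr (e (Sum.inl a))) (Sum.inr (e (Sum.inl a')))) :
    (d.comp (cup e h)).rel ≤ t := by
  intro x y hxy
  by_cases hne : y = x
  · subst hne
    exact t.refl _
  rw [eq_partner _ hxy hne]
  rcases emb_or_arc e x with ⟨x, rfl⟩ | ⟨a, rfl⟩
  · rw [← eq_partner _ ((comp_cup_emb d e h).2 (d.rel_partner x))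
      ((emb_injective e).ne (d.partner_ne x))]
    exact h1 _ _ (d.rel_partner x)
  · obtain ⟨a', ha', -⟩ := (Nat.card_eq_two_iff' a).1 h
    rw [← eq_partner _ (comp_cup_arc d e h a a') (by simpa using ha')]
    exact h2 _ _

end cup

/-- The diagram joins the points of the target that form the first part of a decomposition. -/
def HasArc {A B : FB} (d : BrauerDiagram S T) (e : A ⊕ B ≃ T) : Prop :=
  ∀ a a', d.rel (Sum.inr (e (Sum.inl a))) (Sum.inr (e (Sum.inl a')))

/-- As `A` has two elements, its image is a whole block. -/
theorem HasArc.mem {A B : FB} {d : BrauerDiagram S T} {e : A ⊕ B ≃ T} (H : d.HasArc e)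
    (h : Nat.card A = 2) {a : A} {y : S ⊕ T} (hy : d.rel (Sum.inr (e (Sum.inl a))) y) :
    ∃ a', y = Sum.inr (e (Sum.inl a')) := by
  by_cases hne : y = Sum.inr (e (Sum.inl a))
  · exact ⟨a, hne⟩
  · obtain ⟨a', ha', -⟩ := (Nat.card_eq_two_iff' a).1 h
    refine ⟨a', ?_⟩
    rw [eq_partner _ hy hne, ← eq_partner _ (H a a') (by simpa using ha')]

/-- Only this direction holds in general: if `d` does not have the arc, the cap connects the two
edges that end at the points of `A`. By `ext_of_le` one direction is enough. -/
theorem comp_cap_of_emb {A B : FB} (d : BrauerDiagram S T) (e : A ⊕ B ≃ T) (h : Nat.card A = 2)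
    {x y : S ⊕ B} (hxy : d.rel (emb S e x) (emb S e y)) : (d.comp (cap e h)).rel x y := by
  have key : ∀ x : S ⊕ B, stack d (cap e h) (i₁₂ (emb S e x)) (i₁₃ x) := by
    rintro (s | b)
    · exact Setoid.refl' _ _
    · exact stack_of_right (cap_rel_inr e h b)
  exact Setoid.trans' (stack d (cap e h)) (Setoid.symm' (stack d (cap e h)) (key x))
      (Setoid.trans' (stack d (cap e h)) (stack_of_left hxy) (key y))

/-- Removing an arc from a diagram and adding it again. -/
theorem HasArc.comp_cap_comp_cup {A B : FB} {d : BrauerDiagram S T} {e : A ⊕ B ≃ T}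
    (H : d.HasArc e) (h : Nat.card A = 2) : (d.comp (cap e h)).comp (cup e h) = d := by
  symm
  apply ext_of_le
  intro x y hxy
  rcases emb_or_arc e x with ⟨x, rfl⟩ | ⟨a, rfl⟩
  · rcases emb_or_arc e y with ⟨y, rfl⟩ | ⟨a, rfl⟩
    · exact (comp_cup_emb _ e h).2 (comp_cap_of_emb d e h hxy)
    · obtain ⟨a', ha'⟩ := H.mem h (d.rel.symm hxy)
      rw [ha']
      exact comp_cup_arc _ e h _ _
  · obtain ⟨a', rfl⟩ := H.mem h hxy
    exact comp_cup_arc _ e h _ _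

/-- Capping off the new arc produces a closed loop, which `comp` forgets; it is counted separately
by `loops`. As a consequence, cups can be cancelled on the right and caps on the left. -/
theorem comp_cup_comp_cap {A B : FB} (d : BrauerDiagram S B) (e : A ⊕ B ≃ T) (h : Nat.card A = 2) :
    (d.comp (cup e h)).comp (cap e h) = d := by
  symm
  exact ext_of_le fun x y hxy => comp_cap_of_emb _ e h ((comp_cup_emb d e h).2 hxy)

theorem comp_cup_cancel {A B : FB} {d d' : BrauerDiagram S B} {e : A ⊕ B ≃ T} {h : Nat.card A = 2}
    (H : d.comp (cup e h) = d'.comp (cup e h)) : d = d' := by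
  rw [← comp_cup_comp_cap d e h, H, comp_cup_comp_cap]

theorem cap_comp_cancel {A B : FB} {d d' : BrauerDiagram B T} {e : A ⊕ B ≃ S} {h : Nat.card A = 2}
    (H : (cap e h).comp d = (cap e h).comp d') : d = d' := by
  have H' := congrArg opp H
  rw [opp_comp, opp_comp, opp_cap] at H'
  rw [← opp_opp d, comp_cup_cancel H', opp_opp]

theorem cup_comp_cap_comp {A B : FB} (d : BrauerDiagram B T) (e : A ⊕ B ≃ S) (h : Nat.card A = 2) :
    (cup e h).comp ((cap e h).comp d) = d := by
  have := congrArg opp (comp_cup_comp_cap d.opp e h)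
  rwa [opp_comp, opp_comp, opp_opp, opp_cap] at this

theorem HasArc.cap_comp_cup_comp {A B : FB} {d : BrauerDiagram S T} {e : A ⊕ B ≃ S}
    (H : d.opp.HasArc e) (h : Nat.card A = 2) : (cap e h).comp ((cup e h).comp d) = d := by
  have := congrArg opp (H.comp_cap_comp_cup h)
  rwa [opp_comp, opp_comp, opp_opp, opp_cap] at this

theorem loops_cap {A B : FB} (e : A ⊕ B ≃ S) (h : Nat.card A = 2) (d : BrauerDiagram B T) :
    loops (cap e h) d = 0 :=
  loops_eq_zero fun b => ⟨Sum.inl (e (Sum.inr b)),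
    Setoid.symm' _ (stack_of_left (cap_rel_inr e h b))⟩

theorem assoc (d₁ : BrauerDiagram S T) (d₂ : BrauerDiagram T U) (d₃ : BrauerDiagram U W) :
    (d₁.comp d₂).comp d₃ = d₁.comp (d₂.comp d₃) := (comp_comp d₁ d₂ d₃).1

theorem loops_assoc (d₁ : BrauerDiagram S T) (d₂ : BrauerDiagram T U) (d₃ : BrauerDiagram U W) :
    loops (d₁.comp d₂) d₃ + loops d₁ d₂ = loops d₁ (d₂.comp d₃) + loops d₂ d₃ :=
  (comp_comp d₁ d₂ d₃).2

end BrauerDiagram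

/-! ### Relative positions of two pairs of points. -/

/-- Two decompositions `A ⊔ B` and `A' ⊔ B'` of a set with the same first part. -/
structure FB.Same {A B A' B' T : FB} (e : A ⊕ B ≃ T) (e' : A' ⊕ B' ≃ T) where
  left : A' ≃ A
  right : B' ≃ B
  eq : ∀ x, e' x = e (Sum.map left right x)

/-- Two decompositions `A ⊔ B` and `A' ⊔ B'` of a set with disjoint first parts. -/
structure FB.Disj {A B A' B' T : FB} (e : A ⊕ B ≃ T) (e' : A' ⊕ B' ≃ T) where
  rest : FB
  p : A' ⊕ rest ≃ B
  q : A ⊕ rest ≃ B'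
  inl_left : ∀ a, e (Sum.inl a) = e' (Sum.inr (q (Sum.inl a)))
  inl_right : ∀ a, e' (Sum.inl a) = e (Sum.inr (p (Sum.inl a)))
  inr : ∀ c, e (Sum.inr (p (Sum.inr c))) = e' (Sum.inr (q (Sum.inr c)))

open Classical in
/-- Two decompositions `A ⊔ B` and `A' ⊔ B'` of a set, such that transposing an element of `A` and
an element of `B` yields decompositions with the same first part. -/
structure FB.Meet {A B A' B' T : FB} (e : A ⊕ B ≃ T) (e' : A' ⊕ B' ≃ T) where
  i : A
  l : B
  same : FB.Same ((Equiv.swap (Sum.inl i) (Sum.inr l)).trans e) e'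

namespace FB

variable {A B A' B' T : FB}

/-- Equal first parts have equal complements, so both bijections arise from choosing preimages. -/
theorem exists_same {e : A ⊕ B ≃ T} {e' : A' ⊕ B' ≃ T}
    (h : ∀ t, (∃ a, e (Sum.inl a) = t) ↔ ∃ a, e' (Sum.inl a) = t) : Nonempty (Same e e') := by
  have h1 : ∀ a', ∃ a, e (Sum.inl a) = e' (Sum.inl a') := fun a' => (h _).2 ⟨a', rfl⟩
  have h2 : ∀ b', ∃ b, e (Sum.inr b) = e' (Sum.inr b') := by
    intro b'
    obtain ⟨a | b, hx⟩ := e.surjective (e' (Sum.inr b'))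
    · obtain ⟨a', ha'⟩ := (h _).1 ⟨a, hx⟩
      simp at ha'
    · exact ⟨b, hx⟩
  choose f hf using h1
  choose g hg using h2
  refine ⟨⟨Equiv.ofBijective f ⟨fun x y hxy => ?_, fun a => ?_⟩,
    Equiv.ofBijective g ⟨fun x y hxy => ?_, fun b => ?_⟩, ?_⟩⟩
  · have := hf x
    rw [hxy, hf y] at this
    simpa using this.symm
  · obtain ⟨a', ha'⟩ := (h _).1 ⟨a, rfl⟩
    refine ⟨a', ?_⟩
    have := hf a'
    rw [ha'] at this
    simpa using this
  · have := hg x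
    rw [hxy, hg y] at this
    simpa using this.symm
  · obtain ⟨a' | b', hx⟩ := e'.surjective (e (Sum.inr b))
    · have := hf a'
      rw [hx] at this
      simp at this
    · refine ⟨b', ?_⟩
      have := hg b'
      rw [hx] at this
      simpa using this
  · rintro (x | x)
    · exact (hf x).symm
    · exact (hg x).symm

/-- The common rest `C` consists of the points that belong to the second part of both
decompositions; then `B` is `A' ⊔ C` and `B'` is `A ⊔ C`. -/
theorem exists_disj {e : A ⊕ B ≃ T} {e' : A' ⊕ B' ≃ T}
    (h : ∀ a a', e (Sum.inl a) ≠ e' (Sum.inl a')) : Nonempty (Disj e e') := by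
  let C : FB := FB.of {b : B // ∃ b', e' (Sum.inr b') = e (Sum.inr b)}
  have h1 : ∀ a, ∃ b', e' (Sum.inr b') = e (Sum.inl a) := by
    intro a
    obtain ⟨a' | b', hx⟩ := e'.surjective (e (Sum.inl a))
    · exact absurd hx.symm (h a a')
    · exact ⟨b', hx⟩
  have h2 : ∀ a', ∃ b, e (Sum.inr b) = e' (Sum.inl a') := by
    intro a'
    obtain ⟨a | b, hx⟩ := e.surjective (e' (Sum.inl a'))
    · exact absurd hx (h a a')
    · exact ⟨b, hx⟩
  have h3 : ∀ c : C, ∃ b', e' (Sum.inr b') = e (Sum.inr c.1) := fun c => c.2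
  choose f hf using h1
  choose g hg using h2
  choose c hc using h3
  have hp : Function.Bijective (Sum.elim g fun c : C => c.1) := by
    constructor
    · rintro (x | x) (y | y) hxy
      · have := hg x
        rw [show g x = g y from hxy, hg y] at this
        simpa using this.symm
      · have h1 := hg x
        rw [show g x = y.1 from hxy, ← hc y] at h1
        simp at h1
      · have h1 := hg y
        rw [show g y = x.1 from hxy.symm, ← hc x] at h1
        simp at h1
      · exact congrArg Sum.inr (Subtype.ext hxy)
    · intro b
      obtain ⟨a' | b', hx⟩ := e'.surjective (e (Sum.inr b))
      · refine ⟨Sum.inl a', ?_⟩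
        have := hg a'
        rw [hx] at this
        simpa using this
      · exact ⟨Sum.inr ⟨b, b', hx⟩, rfl⟩
  have hq : Function.Bijective (Sum.elim f c) := by
    constructor
    · rintro (x | x) (y | y) hxy
      · have := hf x
        rw [show f x = f y from hxy, hf y] at this
        simpa using this.symm
      · have h1 := hf x
        rw [show f x = c y from hxy, hc y] at h1
        simp at h1
      · have h1 := hf y
        rw [show f y = c x from hxy.symm, hc x] at h1
        simp at h1
      · have h1 := hc x
        rw [show c x = c y from hxy, hc y] at h1
        exact congrArg Sum.inr (Subtype.ext (by simpa using h1.symm))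
    · intro b'
      obtain ⟨a | b, hx⟩ := e.surjective (e' (Sum.inr b'))
      · refine ⟨Sum.inl a, ?_⟩
        have := hf a
        rw [hx] at this
        simpa using this
      · refine ⟨Sum.inr ⟨b, b', hx.symm⟩, ?_⟩
        simpa using (hc ⟨b, b', hx.symm⟩).trans hx
  exact ⟨⟨C, Equiv.ofBijective _ hp, Equiv.ofBijective _ hq, fun a => (hf a).symm,
    fun a => (hg a).symm, fun x => (hc x).symm⟩⟩

/-- Two sets of two elements share two, no or one point. In the last case, write them as `{i, j}`
and `{j, l}`; the transposition of `i` and `l` carries one to the other. -/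
theorem trichotomy (e : A ⊕ B ≃ T) (e' : A' ⊕ B' ≃ T) (h : Nat.card A = 2) (h' : Nat.card A' = 2) :
    Nonempty (Same e e') ∨ Nonempty (Disj e e') ∨ Nonempty (Meet e e') := by
  classical
  by_cases hd : ∀ a a', e (Sum.inl a) ≠ e' (Sum.inl a')
  · exact Or.inr (Or.inl (exists_disj hd))
  push Not at hd
  obtain ⟨j, j', hj⟩ := hd
  obtain ⟨i, hi, hi'⟩ := (Nat.card_eq_two_iff' j).1 h
  obtain ⟨l, hl, hl'⟩ := (Nat.card_eq_two_iff' j').1 h'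
  have hA : ∀ a, a = j ∨ a = i := fun a => or_iff_not_imp_left.2 (hi' a)
  have hA' : ∀ a, a = j' ∨ a = l := fun a => or_iff_not_imp_left.2 (hl' a)
  by_cases hs : e (Sum.inl i) = e' (Sum.inl l)
  · refine Or.inl (exists_same fun t => ⟨?_, ?_⟩)
    · rintro ⟨a, rfl⟩
      rcases hA a with rfl | rfl
      exacts [⟨j', hj.symm⟩, ⟨l, hs.symm⟩]
    · rintro ⟨a, rfl⟩
      rcases hA' a with rfl | rfl
      exacts [⟨j, hj⟩, ⟨i, hs⟩]
  · obtain ⟨a | b, hb⟩ := e.surjective (e' (Sum.inl l))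
    · rcases hA a with rfl | rfl
      · rw [hj] at hb
        exact absurd (Sum.inl_injective (e'.injective hb)).symm hl
      · exact absurd hb hs
    · refine Or.inr (Or.inr ?_)
      have e1 : ((Equiv.swap (Sum.inl i) (Sum.inr b)).trans e) (Sum.inl j) = e' (Sum.inl j') := by
        rw [Equiv.trans_apply, Equiv.swap_apply_of_ne_of_ne _ _, hj]
        · simpa using hi.symm
        · simp
      have e2 : ((Equiv.swap (Sum.inl i) (Sum.inr b)).trans e) (Sum.inl i) = e' (Sum.inl l) := by
        rw [Equiv.trans_apply, Equiv.swap_apply_left, hb]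
      obtain ⟨s⟩ : Nonempty (Same ((Equiv.swap (Sum.inl i) (Sum.inr b)).trans e) e') := by
        refine exists_same fun t => ⟨?_, ?_⟩
        · rintro ⟨a, rfl⟩
          rcases hA a with rfl | rfl
          exacts [⟨j', e1.symm⟩, ⟨l, e2.symm⟩]
        · rintro ⟨a, rfl⟩
          rcases hA' a with rfl | rfl
          exacts [⟨j, e1⟩, ⟨i, e2⟩]
      refine ⟨⟨i, b, ?_⟩⟩
      convert s

end FB

/-! ### Relations between cups and caps, and generation of all diagrams. -/

namespace BrauerDiagram

open Gluing

variable {S T U W : FB}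

/-- The partition of a bijection is generated by its strands. Together with `cup_le` and `cap_le`,
this reduces inclusions of partitions to a check on edges. -/
theorem ofEquiv_le {f : S ≃ T} {t : Setoid (S ⊕ T)} (h : ∀ s, t (Sum.inl s) (Sum.inr (f s))) :
    (ofEquiv f).rel ≤ t := by
  have key : ∀ x, t x (Sum.inr (Sum.elim f id x)) := by
    rintro (x | x)
    exacts [h x, t.refl _]
  intro x y hxy
  have hxy : Sum.elim f id x = Sum.elim f id y := hxy
  have := key x
  rw [hxy] at this
  exact t.trans this (t.symm (key y))

theorem refl_comp (d : BrauerDiagram S T) : (ofEquiv (Equiv.refl S)).comp d = d := by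
  rw [(ofEquiv_comp _ _).1]
  exact relabel_refl d

theorem comp_refl (d : BrauerDiagram S T) : d.comp (ofEquiv (Equiv.refl T)) = d := by
  rw [(comp_ofEquiv _ _).1]
  exact relabel_refl d

theorem ofEquiv_comp_ofEquiv (f : S ≃ T) (g : T ≃ U) :
    (ofEquiv f).comp (ofEquiv g) = ofEquiv (f.trans g) := by
  rw [(comp_ofEquiv _ _).1, relabel_ofEquiv]
  rfl

/-- A cup is the identity diagram with one arc added, so this is a case of `comp_cup_le`. -/
theorem cup_le {A B : FB} {e : A ⊕ B ≃ T} {h : Nat.card A = 2} {t : Setoid (B ⊕ T)}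
    (h1 : ∀ b, t (Sum.inl b) (Sum.inr (e (Sum.inr b))))
    (h2 : ∀ a a', t (Sum.inr (e (Sum.inl a))) (Sum.inr (e (Sum.inl a')))) :
    (cup e h).rel ≤ t := by
  rw [← refl_comp (cup e h)]
  exact comp_cup_le _ e h (fun x y hxy => ofEquiv_le (f := Equiv.refl B) (t := t.comap (emb B e)) h1 hxy) h2

theorem cap_le {A B : FB} {e : A ⊕ B ≃ T} {h : Nat.card A = 2} {t : Setoid (T ⊕ B)}
    (h1 : ∀ b, t (Sum.inl (e (Sum.inr b))) (Sum.inr b))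
    (h2 : ∀ a a', t (Sum.inl (e (Sum.inl a))) (Sum.inl (e (Sum.inl a')))) :
    (cap e h).rel ≤ t := by
  intro x y hxy
  have := cup_le (e := e) (h := h) (t := t.comap Sum.swap) (fun b => t.symm (h1 b)) h2 hxy
  rwa [Setoid.comap_rel, Sum.swap_swap, Sum.swap_swap] at this

theorem cup_hasArc {A B : FB} (e : A ⊕ B ≃ T) (h : Nat.card A = 2) : (cup e h).HasArc e :=
  cup_rel_inl e h

theorem comp_hasArc {A B : FB} (d : BrauerDiagram S T) {d' : BrauerDiagram T U} {e : A ⊕ B ≃ U}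
    (H : d'.HasArc e) : (d.comp d').HasArc e :=
  fun a a' => stack_of_right (d := d) (H a a')

/-- In the diagram of a bijection, distinct points of the target lie on distinct strands. -/
theorem not_ofEquiv_hasArc {A B : FB} (f : S ≃ T) (e : A ⊕ B ≃ T) (h : Nat.card A = 2) :
    ¬ (ofEquiv f).HasArc e := by
  intro H
  have : Nonempty A := (Nat.card_pos_iff.1 (by omega)).1
  obtain ⟨a⟩ := this
  obtain ⟨a', ha', -⟩ := (Nat.card_eq_two_iff' a).1 h
  have h1 : e (Sum.inl a) = e (Sum.inl a') := H a a'
  exact ha' (Sum.inl_injective (e.injective h1)).symm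

theorem ofEquiv_injective {f g : S ≃ T} (h : ofEquiv f = ofEquiv g) : f = g := by
  ext s
  have h1 : (ofEquiv f).rel (Sum.inl s) (Sum.inr (f s)) := rfl
  rw [h] at h1
  exact (Eq.symm h1 : f s = g s)

section pairs

variable {A B A' B' : FB} {e : A ⊕ B ≃ T} {e' : A' ⊕ B' ≃ T} {h : Nat.card A = 2}
  {h' : Nat.card A' = 2}

theorem cup_eq_of_same (s : FB.Same e e') : cup e' h' = (ofEquiv s.right).comp (cup e h) := by
  rw [(ofEquiv_comp _ _).1]
  refine (cup_congr e h e' h' s.left.symm s.right.symm (Equiv.refl T) fun x => ?_).symm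
  rw [s.eq]
  rcases x with x | x <;> simp

theorem cap_eq_of_same (s : FB.Same e e') : cap e' h' = (cap e h).comp (ofEquiv s.right.symm) := by
  rw [cap, cup_eq_of_same (h := h) s, opp_comp, opp_ofEquiv]
  rfl

/-- Both sides consist of the two arcs and of the strands that start at `D.rest`. -/
theorem cup_comp_cup_of_disj (D : FB.Disj e e') :
    (cup D.p h').comp (cup e h) = (cup D.q h).comp (cup e' h') := by
  apply ext_of_le
  refine comp_cup_le _ _ _ (fun x y hxy => ?_) fun a a' => ?_
  · refine cup_le (t := ((cup D.q h).comp (cup e' h')).rel.comap (emb _ e)) (fun c => ?_)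
      (fun a a' => ?_) hxy
    · change ((cup D.q h).comp (cup e' h')).rel (Sum.inl c) (Sum.inr (e _))
      rw [D.inr]
      exact (comp_cup_emb _ e' h').2 (cup_rel_inr D.q h c)
    · change ((cup D.q h).comp (cup e' h')).rel (Sum.inr (e _)) (Sum.inr (e _))
      rw [← D.inl_right, ← D.inl_right]
      exact comp_cup_arc _ e' h' a a'
  · rw [D.inl_left, D.inl_left]
    exact (comp_cup_emb _ e' h').2 (cup_rel_inl D.q h a a')

theorem cap_comp_cap_of_disj (D : FB.Disj e e') :
    (cap e h).comp (cap D.p h') = (cap e' h').comp (cap D.q h) := by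
  have := congrArg opp (cup_comp_cup_of_disj (h := h) (h' := h') D)
  rwa [opp_comp, opp_comp] at this

/-- The cup and the cap close up on the image of `A` in the middle row; every other middle point is
joined to the outside by a strand. -/
theorem loops_cup_cap (e : A ⊕ B ≃ T) (h : Nat.card A = 2) : loops (cup e h) (cap e h) = 1 := by
  let J := stack (cup e h) (cap e h)
  let z : A → B ⊕ T ⊕ B := fun a => Sum.inr (Sum.inl (e (Sum.inl a)))
  have h0 : ∀ a a', J (z a) (z a') := fun a a' => stack_of_left (cup_rel_inl e h a a')
  -- No edge of either diagram leaves the set of the points `z a`, so this set is a union of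
  -- components.
  have h1 : J ≤ Setoid.ker fun x => ∃ a, z a = x := by
    refine stack_le.2 ⟨cup_le (fun b => ?_) fun a a' => ?_, cap_le (fun b => ?_) fun a a' => ?_⟩
    · exact propext ⟨by rintro ⟨a, ha⟩; simp [z, i₁₂] at ha, by rintro ⟨a, ha⟩; simp [z, i₁₂] at ha⟩
    · exact propext ⟨fun _ => ⟨a', rfl⟩, fun _ => ⟨a, rfl⟩⟩
    · exact propext ⟨by rintro ⟨a, ha⟩; simp [z, i₂₃] at ha, by rintro ⟨a, ha⟩; simp [z, i₂₃] at ha⟩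
    · exact propext ⟨fun _ => ⟨a', rfl⟩, fun _ => ⟨a, rfl⟩⟩
  have : Nonempty A := (Nat.card_pos_iff.1 (by omega)).1
  obtain ⟨a₀⟩ := this
  refine Nat.card_eq_one_iff_unique.2 ⟨⟨?_⟩, ⟨⟨Quotient.mk J (z a₀), fun x hx => ?_⟩⟩⟩
  · have key : ∀ c : {c : Quotient J // ∀ a, c ≠ Quotient.mk J (i₁₃ a)},
        c.1 = Quotient.mk J (z a₀) := by
      rintro ⟨c, hc⟩
      induction c using Quotient.inductionOn with
      | h x =>
        rcases x with x | x | x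
        · exact absurd rfl (hc (Sum.inl x))
        · obtain ⟨a | b, rfl⟩ := e.surjective x
          · exact Quotient.sound (h0 a a₀)
          · exact absurd (Quotient.sound (Setoid.symm' J (stack_of_left (cup_rel_inr e h b))))
              (hc (Sum.inl b))
        · exact absurd rfl (hc (Sum.inr x))
    exact fun c c' => Subtype.ext ((key c).trans (key c').symm)
  · have h2 : (∃ a, z a = z a₀) = ∃ a, z a = i₁₃ x := h1 (Quotient.exact hx)
    obtain ⟨a, ha⟩ := h2 ▸ (⟨a₀, rfl⟩ : ∃ a, z a = z a₀)
    rcases x with x | x <;> simp [z, i₁₃] at ha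

theorem cup_comp_cap_of_same (s : FB.Same e e') :
    (cup e' h').comp (cap e h) = ofEquiv s.right ∧ loops (cup e' h') (cap e h) = 1 := by
  rw [cup_eq_of_same (h := h) s]
  refine ⟨comp_cup_comp_cap _ e h, ?_⟩
  -- Bijections create no loops, so the count reduces to the case of equal decompositions.
  have := loops_assoc (ofEquiv s.right) (cup e h) (cap e h)
  rwa [(ofEquiv_comp _ _).2, (ofEquiv_comp _ _).2, loops_cup_cap, add_zero, zero_add] at this

/-- A zigzag is straightened: the cap joins `i` and `j`, the cup joins `j` and `l`, so the strand
that reaches `i` in the middle row runs on through `j` to `l` and leaves there. No middle point is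
left over for a loop. -/
theorem cup_comp_cap_of_meet (m : FB.Meet e e') :
    (cup e' h').comp (cap e h) = ofEquiv m.same.right ∧ loops (cup e' h') (cap e h) = 0 := by
  classical
  obtain ⟨i, l, s⟩ := m
  dsimp only at s ⊢
  obtain ⟨j, hj, -⟩ := (Nat.card_eq_two_iff' i).1 h
  have e1 : e' (Sum.inl (s.left.symm i)) = e (Sum.inr l) := by
    simp [s.eq]
  have e2 : e' (Sum.inl (s.left.symm j)) = e (Sum.inl j) := by
    rw [s.eq]
    simp only [Sum.map_inl, Equiv.apply_symm_apply, Equiv.trans_apply]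
    rw [Equiv.swap_apply_of_ne_of_ne (by simpa using hj) (by simp)]
  have e3 : ∀ b', s.right b' = l → e' (Sum.inr b') = e (Sum.inl i) := fun b' hb => by
    simp [s.eq, hb]
  have e4 : ∀ b', s.right b' ≠ l → e' (Sum.inr b') = e (Sum.inr (s.right b')) := fun b' hb => by
    rw [s.eq]
    simp only [Sum.map_inr, Equiv.trans_apply]
    rw [Equiv.swap_apply_of_ne_of_ne (by simp) (by simpa using hb)]
  let J := stack (cup e' h') (cap e h)
  have j1 : ∀ a, J (Sum.inr (Sum.inl (e (Sum.inl a)))) (i₁₃ (Sum.inr l)) := by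
    intro a
    refine J.trans (stack_of_right (cap_rel_inl e h a j)) ?_
    rw [← e2]
    refine J.trans (stack_of_left (cup_rel_inl e' h' _ (s.left.symm i))) ?_
    rw [e1]
    exact stack_of_right (cap_rel_inr e h l)
  constructor
  · symm
    refine ext_of_le (ofEquiv_le fun b' => ?_)
    refine J.trans (stack_of_left (cup_rel_inr e' h' b')) ?_
    by_cases hb : s.right b' = l
    · rw [e3 b' hb, hb]
      exact j1 i
    · rw [e4 b' hb]
      exact stack_of_right (cap_rel_inr e h _)
  · refine loops_eq_zero fun t => ?_
    obtain ⟨a | b, rfl⟩ := e.surjective t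
    · exact ⟨_, j1 a⟩
    · exact ⟨Sum.inr b, stack_of_right (cap_rel_inr e h b)⟩

/-- The arc of the cup lies on strands of the cap, which carry it to the target, and the arc of the
cap is carried to the source in the same way. So the two arcs slide past each other. -/
theorem cup_comp_cap_of_disj (D : FB.Disj e e') :
    (cup e' h').comp (cap e h) = (cap D.q h).comp (cup D.p h') ∧
      loops (cup e' h') (cap e h) = 0 := by
  let J := stack (cup e' h') (cap e h)
  have j1 : ∀ b', J (i₁₃ (Sum.inl b')) (Sum.inr (Sum.inl (e' (Sum.inr b')))) := fun b' =>
    stack_of_left (cup_rel_inr e' h' b')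
  have j2 : ∀ b, J (Sum.inr (Sum.inl (e (Sum.inr b)))) (i₁₃ (Sum.inr b)) := fun b =>
    stack_of_right (cap_rel_inr e h b)
  constructor
  · symm
    apply ext_of_le
    refine comp_cup_le _ _ _ (fun x y hxy => ?_) fun a a' => ?_
    · refine cap_le (t := ((cup e' h').comp (cap e h)).rel.comap (emb _ D.p)) (fun c => ?_)
        (fun a a' => ?_) hxy
      · refine J.trans (j1 (D.q (Sum.inr c))) ?_
        rw [← D.inr]
        exact j2 _
      · refine J.trans (j1 (D.q (Sum.inl a))) (J.trans ?_ (J.symm (j1 (D.q (Sum.inl a')))))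
        rw [← D.inl_left, ← D.inl_left]
        exact stack_of_right (cap_rel_inl e h a a')
    · refine J.trans (J.symm (j2 _)) (J.trans ?_ (j2 _))
      rw [← D.inl_right, ← D.inl_right]
      exact stack_of_left (cup_rel_inl e' h' a a')
  · refine loops_eq_zero fun t => ?_
    obtain ⟨a | b, rfl⟩ := e.surjective t
    · rw [D.inl_left]
      exact ⟨_, J.symm (j1 _)⟩
    · exact ⟨Sum.inr b, j2 b⟩

/-- Two arcs of a diagram are equal or disjoint. -/
theorem same_or_disj {d : BrauerDiagram S T} (H : d.HasArc e) (H' : d.HasArc e')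
    (h : Nat.card A = 2) (h' : Nat.card A' = 2) : Nonempty (FB.Same e e') ∨ Nonempty (FB.Disj e e') := by
  by_cases hd : ∀ a a', e (Sum.inl a) ≠ e' (Sum.inl a')
  · exact Or.inr (FB.exists_disj hd)
  · push Not at hd
    obtain ⟨j, j', hj⟩ := hd
    -- Arcs are whole blocks, so two arcs with a common point coincide.
    refine Or.inl (FB.exists_same fun t => ⟨?_, ?_⟩)
    · rintro ⟨a, rfl⟩
      have h1 := H j a
      rw [hj] at h1
      obtain ⟨a', ha'⟩ := H'.mem h' h1
      exact ⟨a', (Sum.inr_injective ha').symm⟩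
    · rintro ⟨a, rfl⟩
      have h1 := H' j' a
      rw [← hj] at h1
      obtain ⟨a', ha'⟩ := H.mem h h1
      exact ⟨a', (Sum.inr_injective ha').symm⟩

end pairs

theorem exists_hasArc (d : BrauerDiagram S T) {t t' : T} (hne : t ≠ t')
    (h : d.rel (Sum.inr t) (Sum.inr t')) :
    ∃ (A B : FB) (e : A ⊕ B ≃ T), Nat.card A = 2 ∧ d.HasArc e := by
  refine ⟨_, _, FBMod.cut {t, t'}, ?_, ?_⟩
  · exact (Set.ncard_pair hne : _)
  · have key : ∀ a : FB.sub ({t, t'} : Set T), d.rel (Sum.inr t) (Sum.inr a.1) := by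
      rintro ⟨a, rfl | rfl⟩
      exacts [d.rel.refl _, h]
    exact fun a a' => d.rel.trans (d.rel.symm (key a)) (key a')

/-- Every Brauer diagram is built from bijections, cups and caps. -/
theorem generation {P : ∀ {S T : FB}, BrauerDiagram S T → Prop}
    (hE : ∀ {S T : FB} (f : S ≃ T), P (ofEquiv f))
    (hU : ∀ {S T A B : FB} (d : BrauerDiagram S B) (e : A ⊕ B ≃ T) (h : Nat.card A = 2), P d →
      P (d.comp (cup e h)))
    (hA : ∀ {S T A B : FB} (d : BrauerDiagram B T) (e : A ⊕ B ≃ S) (h : Nat.card A = 2), P d →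
      P ((cap e h).comp d)) (d : BrauerDiagram S T) : P d := by
  -- Induction on the number of points: removing an arc, in the target or in the source, lowers it
  -- by two.
  suffices ∀ n (S T : FB), Nat.card S + Nat.card T = n → ∀ d : BrauerDiagram S T, P d from
    this _ S T rfl d
  intro n
  induction n using Nat.strong_induction_on with
  | h n ih =>
    intro S T hn d
    have hcard : ∀ {A B T : FB}, (A ⊕ B ≃ T) → Nat.card A = 2 → Nat.card T = 2 + Nat.card B :=
      fun e h => by rw [← Nat.card_congr e, Nat.card_sum, h]
    by_cases h1 : ∃ t t', t ≠ t' ∧ d.rel (Sum.inr t) (Sum.inr t')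
    · obtain ⟨t, t', hne, ht⟩ := h1
      obtain ⟨A, B, e, h, H⟩ := d.exists_hasArc hne ht
      rw [← H.comp_cap_comp_cup h]
      have := hcard e h
      exact hU _ e h (ih _ (by omega) S B rfl _)
    by_cases h2 : ∃ s s', s ≠ s' ∧ d.rel (Sum.inl s) (Sum.inl s')
    · obtain ⟨s, s', hne, hs⟩ := h2
      obtain ⟨A, B, e, h, H⟩ := d.opp.exists_hasArc hne hs
      rw [← H.cap_comp_cup_comp h]
      have := hcard e h
      exact hA _ e h (ih _ (by omega) B T rfl _)
    push Not at h1 h2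
    -- Without arcs on either side, every edge joins the source to the target, so the matching is
    -- the graph of a bijection.
    have h3 : ∀ s, ∃ t, d.rel (Sum.inl s) (Sum.inr t) := by
      intro s
      rcases hp : d.partner (Sum.inl s) with s' | t
      · refine absurd (d.rel_partner (Sum.inl s)) ?_
        rw [hp]
        refine h2 _ _ fun h => d.partner_ne (Sum.inl s) ?_
        rw [hp, h]
      · exact ⟨t, hp ▸ d.rel_partner (Sum.inl s)⟩
    choose f hf using h3
    have hb : Function.Bijective f := by
      constructor
      · intro s s' hs
        by_contra hne
        exact h2 s s' hne (d.rel.trans (hf s) (hs ▸ d.rel.symm (hf s')))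
      · intro t
        rcases hp : d.partner (Sum.inr t) with s | t'
        · refine ⟨s, ?_⟩
          by_contra hne
          refine h1 _ _ hne (d.rel.trans (d.rel.symm (hf s)) (d.rel.symm ?_))
          exact hp ▸ d.rel_partner (Sum.inr t)
        · refine absurd (d.rel_partner (Sum.inr t)) ?_
          rw [hp]
          refine h1 _ _ fun h => d.partner_ne (Sum.inr t) ?_
          rw [hp, h]
    rw [← ext_of_le (ofEquiv_le (f := Equiv.ofBijective f hb) (t := d.rel) hf)]
    exact hE _

end BrauerDiagram

/-! ### From operators for cups and caps to operators for all diagrams. -/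

/-- Operators on a species attached to cups and caps, subject to the relations between cups and caps
in the Brauer category with parameter `δ`. -/
structure CupCap {k : Type u} [CommRing k] (δ : k) (M : FBMod k) where
  cup : ∀ {A B S : FB}, (A ⊕ B ≃ S) → Nat.card A = 2 → (M.ev B →ₗ[k] M.ev S)
  cap : ∀ {A B S : FB}, (A ⊕ B ≃ S) → Nat.card A = 2 → (M.ev S →ₗ[k] M.ev B)
  cup_congr : ∀ {A B S A' B' S' : FB} (e : A ⊕ B ≃ S) (h : Nat.card A = 2) (e' : A' ⊕ B' ≃ S')
    (h' : Nat.card A' = 2) (f : A ≃ A') (g : B ≃ B') (v : S ≃ S'),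
    (∀ x, v (e x) = e' (Sum.map f g x)) → ∀ x, cup e' h' (M.mp g x) = M.mp v (cup e h x)
  cap_congr : ∀ {A B S A' B' S' : FB} (e : A ⊕ B ≃ S) (h : Nat.card A = 2) (e' : A' ⊕ B' ≃ S')
    (h' : Nat.card A' = 2) (f : A ≃ A') (g : B ≃ B') (v : S ≃ S'),
    (∀ x, v (e x) = e' (Sum.map f g x)) → ∀ y, cap e' h' (M.mp v y) = M.mp g (cap e h y)
  cup_cup : ∀ {A B A' B' T : FB} {e : A ⊕ B ≃ T} {e' : A' ⊕ B' ≃ T} (h : Nat.card A = 2)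
    (h' : Nat.card A' = 2) (D : FB.Disj e e') (x), cup e h (cup D.p h' x) = cup e' h' (cup D.q h x)
  cap_cap : ∀ {A B A' B' T : FB} {e : A ⊕ B ≃ T} {e' : A' ⊕ B' ≃ T} (h : Nat.card A = 2)
    (h' : Nat.card A' = 2) (D : FB.Disj e e') (y), cap D.p h' (cap e h y) = cap D.q h (cap e' h' y)
  cap_cup_same : ∀ {A B A' B' T : FB} {e : A ⊕ B ≃ T} {e' : A' ⊕ B' ≃ T} (h : Nat.card A = 2)
    (h' : Nat.card A' = 2) (s : FB.Same e e') (x), cap e h (cup e' h' x) = δ • M.mp s.right x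
  cap_cup_meet : ∀ {A B A' B' T : FB} {e : A ⊕ B ≃ T} {e' : A' ⊕ B' ≃ T} (h : Nat.card A = 2)
    (h' : Nat.card A' = 2) (m : FB.Meet e e') (x), cap e h (cup e' h' x) = M.mp m.same.right x
  cap_cup_disj : ∀ {A B A' B' T : FB} {e : A ⊕ B ≃ T} {e' : A' ⊕ B' ≃ T} (h : Nat.card A = 2)
    (h' : Nat.card A' = 2) (D : FB.Disj e e') (x), cap e h (cup e' h' x) = cup D.p h' (cap D.q h x)

namespace CupCap

open BrauerDiagram

variable {k : Type u} [CommRing k] {δ : k} {M : FBMod k}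

/-- The relation between diagrams and operators generated by bijections, cups and caps. -/
inductive Act (R : CupCap δ M) :
    ∀ {S T : FB}, BrauerDiagram S T → (M.ev S →ₗ[k] M.ev T) → Prop
  | ofEquiv {S T : FB} (f : S ≃ T) : Act R (ofEquiv f) (M.mp f)
  | cup {S T A B : FB} (d : BrauerDiagram S B) (e : A ⊕ B ≃ T) (h : Nat.card A = 2)
      (φ : M.ev S →ₗ[k] M.ev B) : Act R d φ → Act R (d.comp (BrauerDiagram.cup e h)) (R.cup e h ∘ₗ φ)
  | cap {S T A B : FB} (d : BrauerDiagram B T) (e : A ⊕ B ≃ S) (h : Nat.card A = 2)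
      (φ : M.ev B →ₗ[k] M.ev T) : Act R d φ → Act R ((BrauerDiagram.cap e h).comp d) (φ ∘ₗ R.cap e h)

variable {R : CupCap δ M} {S T U : FB}

/-- `Act` has no constructor for a bijection applied last. By naturality it is absorbed into an
outermost cup; past an outermost cap, which works at the source, it moves to the inner diagram. -/
theorem Act.comp_ofEquiv {d : BrauerDiagram S T} {φ : M.ev S →ₗ[k] M.ev T} (H : R.Act d φ)
    (f : T ≃ U) : R.Act (d.comp (BrauerDiagram.ofEquiv f)) (M.mp f ∘ₗ φ) := by
  induction H with
  | @ofEquiv S T g =>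
    rw [ofEquiv_comp_ofEquiv, show M.mp f ∘ₗ M.mp g = M.mp (g.trans f) from
      LinearMap.ext fun x => FBMod.mp_mp M g f x]
    exact .ofEquiv _
  | @cup S T A B d e h φ H ih =>
    rw [assoc, (BrauerDiagram.comp_ofEquiv _ f).1, BrauerDiagram.cup_congr e h (e.trans f) h
      (Equiv.refl A) (Equiv.refl B) f (fun x => by rcases x with x | x <;> rfl)]
    rw [show M.mp f ∘ₗ R.cup e h ∘ₗ φ = R.cup (e.trans f) h ∘ₗ φ from LinearMap.ext fun x => ?_]
    · exact .cup d _ h φ H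
    · refine (R.cup_congr e h (e.trans f) h (Equiv.refl A) (Equiv.refl B) f (fun x => by
        rcases x with x | x <;> rfl) (φ x)).symm.trans ?_
      rw [FBMod.mp_refl]
      rfl
  | cap d e h φ H ih =>
    rw [assoc]
    exact .cap _ e h _ (ih f)

theorem Act.ofEquiv_comp {d : BrauerDiagram S T} {φ : M.ev S →ₗ[k] M.ev T} (H : R.Act d φ)
    (f : U ≃ S) : R.Act ((BrauerDiagram.ofEquiv f).comp d) (φ ∘ₗ M.mp f) := by
  induction H with
  | @ofEquiv S T g =>
    rw [ofEquiv_comp_ofEquiv, show M.mp g ∘ₗ M.mp f = M.mp (f.trans g) from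
      LinearMap.ext fun x => FBMod.mp_mp M f g x]
    exact .ofEquiv _
  | cup d e h φ H ih =>
    rw [← assoc]
    exact .cup _ e h _ (ih f)
  | @cap S T A B d e h φ H ih =>
    rw [← assoc, (BrauerDiagram.ofEquiv_comp f _).1, BrauerDiagram.cap_congr e h (e.trans f.symm) h
      (Equiv.refl A) (Equiv.refl B) f.symm (fun x => by rcases x with x | x <;> rfl)]
    rw [show (φ ∘ₗ R.cap e h) ∘ₗ M.mp f = φ ∘ₗ R.cap (e.trans f.symm) h from
      LinearMap.ext fun x => ?_]
    · exact .cap d _ h φ H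
    · refine congrArg φ ?_
      refine (R.cap_congr (e.trans f.symm) h e h (Equiv.refl A) (Equiv.refl B) f (fun x => by
        rcases x with x | x <;> simp) x).trans ?_
      rw [FBMod.mp_refl]

/-- Any arc in the target can be made the last one that was added. If the last step added an arc, it
is equal to the given one, and naturality applies, or disjoint from it, and the two cups can be
exchanged by `cup_cup`. If the last step was a cap, it takes place at the source and does not
interfere. A bijection has no arc. -/
theorem Act.cup_inv {d : BrauerDiagram S T} {ψ : M.ev S →ₗ[k] M.ev T} (H : R.Act d ψ) :
    ∀ {A B : FB} (e : A ⊕ B ≃ T) (h : Nat.card A = 2) (d₁ : BrauerDiagram S B),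
      d = d₁.comp (BrauerDiagram.cup e h) → ∃ ψ₁, R.Act d₁ ψ₁ ∧ ψ = R.cup e h ∘ₗ ψ₁ := by
  induction H with
  | ofEquiv f =>
    intro A B e h d₁ hd
    refine absurd ?_ (not_ofEquiv_hasArc f e h)
    rw [hd]
    exact comp_hasArc _ (cup_hasArc e h)
  | @cup S T A' B' d₂ e' h' ψ₂ H ih =>
    intro A B e h d₁ hd
    have h1 : (d₂.comp (BrauerDiagram.cup e' h')).HasArc e' := comp_hasArc _ (cup_hasArc e' h')
    have h2 : (d₂.comp (BrauerDiagram.cup e' h')).HasArc e := by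
      rw [hd]
      exact comp_hasArc _ (cup_hasArc e h)
    rcases same_or_disj h1 h2 h' h with ⟨⟨s⟩⟩ | ⟨⟨D⟩⟩
    · rw [cup_eq_of_same (h := h') s, ← assoc] at hd
      have hd' := comp_cup_cancel hd
      refine ⟨M.mp s.right.symm ∘ₗ ψ₂, ?_, LinearMap.ext fun x => ?_⟩
      · have := H.comp_ofEquiv s.right.symm
        rwa [hd', assoc, ofEquiv_comp_ofEquiv, Equiv.self_trans_symm, comp_refl] at this
      · refine ((R.cup_congr e' h' e h s.left.symm s.right.symm (Equiv.refl _) (fun x => ?_)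
          (ψ₂ x)).trans (FBMod.mp_refl _ _)).symm
        rw [s.eq]
        rcases x with x | x <;> simp
    -- The given arc is disjoint from the outermost one, so it was present in `d₂`, and the
    -- induction hypothesis makes it outermost there.
    · have hq : d₂.HasArc D.p := by
        intro a a'
        refine (comp_cup_emb d₂ e' h').1 ?_
        change (d₂.comp (BrauerDiagram.cup e' h')).rel (Sum.inr (e' _)) (Sum.inr (e' _))
        rw [← D.inl_right, ← D.inl_right]
        exact h2 a a'
      have hd₂ := hq.comp_cap_comp_cup h
      obtain ⟨ψ₃, H₃, rfl⟩ := ih D.p h _ hd₂.symm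
      refine ⟨R.cup D.q h' ∘ₗ ψ₃, ?_, LinearMap.ext fun x => R.cup_cup h' h D _⟩
      rw [← hd₂, assoc, cup_comp_cup_of_disj D, ← assoc] at hd
      rw [← comp_cup_cancel hd]
      exact .cup _ _ h' _ H₃
  | @cap S T A' B' d₂ e' h' ψ₂ H ih =>
    intro A B e h d₁ hd
    -- Composing with the cup at the source undoes the outermost cap and exhibits the given arc in
    -- `d₂`.
    have hd₂ : d₂ = ((BrauerDiagram.cup e' h').comp d₁).comp (BrauerDiagram.cup e h) := by
      rw [assoc, ← hd, cup_comp_cap_comp]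
    obtain ⟨ψ₃, H₃, rfl⟩ := ih e h _ hd₂
    refine ⟨ψ₃ ∘ₗ R.cap e' h', ?_, rfl⟩
    rw [hd₂, ← assoc] at hd
    rw [← comp_cup_cancel hd]
    exact .cap _ e' h' _ H₃

theorem not_ofEquiv_eq_cap_comp {A B : FB} (f : S ≃ T) (e : A ⊕ B ≃ S) (h : Nat.card A = 2)
    (d : BrauerDiagram B T) : BrauerDiagram.ofEquiv f ≠ (BrauerDiagram.cap e h).comp d := by
  intro hd
  have := congrArg opp hd
  rw [opp_ofEquiv, opp_comp, opp_cap] at this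
  refine not_ofEquiv_hasArc f.symm e h ?_
  rw [this]
  exact comp_hasArc _ (cup_hasArc e h)

/-- The mirror image of `Act.cup_inv`: arcs of the source are arcs of the opposite diagram, and
`cap_cap` replaces `cup_cup`. -/
theorem Act.cap_inv {d : BrauerDiagram S T} {ψ : M.ev S →ₗ[k] M.ev T} (H : R.Act d ψ) :
    ∀ {A B : FB} (e : A ⊕ B ≃ S) (h : Nat.card A = 2) (d₁ : BrauerDiagram B T),
      d = (BrauerDiagram.cap e h).comp d₁ → ∃ ψ₁, R.Act d₁ ψ₁ ∧ ψ = ψ₁ ∘ₗ R.cap e h := by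
  induction H with
  | ofEquiv f =>
    intro A B e h d₁ hd
    exact absurd hd (not_ofEquiv_eq_cap_comp f e h d₁)
  | @cap S T A' B' d₂ e' h' ψ₂ H ih =>
    intro A B e h d₁ hd
    have h1 : ((BrauerDiagram.cap e' h').comp d₂).opp.HasArc e' := by
      rw [opp_comp, opp_cap]
      exact comp_hasArc _ (cup_hasArc e' h')
    have h2 : ((BrauerDiagram.cap e' h').comp d₂).opp.HasArc e := by
      rw [hd, opp_comp, opp_cap]
      exact comp_hasArc _ (cup_hasArc e h)
    rcases same_or_disj h1 h2 h' h with ⟨⟨s⟩⟩ | ⟨⟨D⟩⟩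
    · rw [cap_eq_of_same (h := h') s, assoc] at hd
      have hd' := cap_comp_cancel hd
      refine ⟨ψ₂ ∘ₗ M.mp s.right, ?_, LinearMap.ext fun x => congrArg ψ₂ ?_⟩
      · have := H.ofEquiv_comp s.right
        rwa [hd', ← assoc, ofEquiv_comp_ofEquiv, Equiv.self_trans_symm, refl_comp] at this
      · have := R.cap_congr e h e' h' s.left s.right (Equiv.refl _) s.eq x
        rwa [FBMod.mp_refl] at this
    · have hq : d₂.opp.HasArc D.p := by
        intro a a'
        refine (comp_cup_emb d₂.opp e' h').1 ?_
        rw [← opp_cap, ← opp_comp]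
        change ((BrauerDiagram.cap e' h').comp d₂).opp.rel (Sum.inr (e' _)) (Sum.inr (e' _))
        rw [← D.inl_right, ← D.inl_right]
        exact h2 a a'
      have hd₂ := hq.cap_comp_cup_comp h
      obtain ⟨ψ₃, H₃, rfl⟩ := ih D.p h _ hd₂.symm
      refine ⟨ψ₃ ∘ₗ R.cap D.q h', ?_, LinearMap.ext fun x => congrArg ψ₃ (R.cap_cap h' h D _)⟩
      rw [← hd₂, ← assoc, cap_comp_cap_of_disj D, assoc] at hd
      rw [← cap_comp_cancel hd]
      exact .cap _ _ h' _ H₃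
  | @cup S T A' B' d₂ e' h' ψ₂ H ih =>
    intro A B e h d₁ hd
    have hd₂ : d₂ = (BrauerDiagram.cap e h).comp (d₁.comp (BrauerDiagram.cap e' h')) := by
      rw [← assoc, ← hd, comp_cup_comp_cap]
    obtain ⟨ψ₃, H₃, rfl⟩ := ih e h _ hd₂
    refine ⟨R.cup e' h' ∘ₗ ψ₃, ?_, rfl⟩
    rw [hd₂, assoc] at hd
    rw [← cap_comp_cancel hd]
    exact .cup _ e' h' _ H₃

theorem Act.ofEquiv_inv {d : BrauerDiagram S T} {ψ : M.ev S →ₗ[k] M.ev T} (H : R.Act d ψ)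
    (f : S ≃ T) (hd : d = BrauerDiagram.ofEquiv f) : ψ = M.mp f := by
  cases H with
  | ofEquiv g => rw [ofEquiv_injective hd]
  | cup d e h φ H =>
    refine absurd ?_ (not_ofEquiv_hasArc f e h)
    rw [← hd]
    exact comp_hasArc _ (cup_hasArc e h)
  | cap d e h φ H => exact absurd hd.symm (not_ofEquiv_eq_cap_comp f e h d)

/-- By the inversion lemmas, the second derivation can be rearranged to end with the same step as
the first. Only naturality and the commutation of cups with cups and of caps with caps are used; the
mixed relations play no role before `cap_op`. -/
theorem Act.unique {d : BrauerDiagram S T} {φ ψ : M.ev S →ₗ[k] M.ev T} (H : R.Act d φ)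
    (H' : R.Act d ψ) : φ = ψ := by
  induction H with
  | ofEquiv f => exact (H'.ofEquiv_inv f rfl).symm
  | cup d e h φ H ih =>
    obtain ⟨ψ₁, H₁, rfl⟩ := H'.cup_inv e h d rfl
    rw [ih H₁]
  | cap d e h φ H ih =>
    obtain ⟨ψ₁, H₁, rfl⟩ := H'.cap_inv e h d rfl
    rw [ih H₁]

variable (R)

theorem exists_act (d : BrauerDiagram S T) : ∃ φ, R.Act d φ :=
  generation (P := fun {_ _} d => ∃ φ, R.Act d φ) (fun f => ⟨_, .ofEquiv f⟩)
    (fun d e h ⟨φ, H⟩ => ⟨_, .cup d e h φ H⟩) (fun d e h ⟨φ, H⟩ => ⟨_, .cap d e h φ H⟩) d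

/-- The operator attached to a diagram. -/
noncomputable def op (d : BrauerDiagram S T) : M.ev S →ₗ[k] M.ev T := (R.exists_act d).choose

theorem act_op (d : BrauerDiagram S T) : R.Act d (R.op d) := (R.exists_act d).choose_spec

variable {A B : FB}

theorem op_ofEquiv (f : S ≃ T) : R.op (BrauerDiagram.ofEquiv f) = M.mp f :=
  (R.act_op _).unique (.ofEquiv f)

theorem op_comp_cup (d : BrauerDiagram S B) (e : A ⊕ B ≃ T) (h : Nat.card A = 2) :
    R.op (d.comp (BrauerDiagram.cup e h)) = R.cup e h ∘ₗ R.op d :=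
  (R.act_op _).unique (.cup d e h _ (R.act_op d))

theorem op_cap_comp (d : BrauerDiagram B T) (e : A ⊕ B ≃ S) (h : Nat.card A = 2) :
    R.op ((BrauerDiagram.cap e h).comp d) = R.op d ∘ₗ R.cap e h :=
  (R.act_op _).unique (.cap d e h _ (R.act_op d))

theorem op_comp_ofEquiv (d : BrauerDiagram S T) (f : T ≃ U) :
    R.op (d.comp (BrauerDiagram.ofEquiv f)) = M.mp f ∘ₗ R.op d :=
  (R.act_op _).unique ((R.act_op d).comp_ofEquiv f)

theorem op_cup (e : A ⊕ B ≃ T) (h : Nat.card A = 2) :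
    R.op (BrauerDiagram.cup e h) = R.cup e h := by
  rw [← refl_comp (BrauerDiagram.cup e h), op_comp_cup, op_ofEquiv]
  exact LinearMap.ext fun x => congrArg (R.cup e h) (FBMod.mp_refl M x)

theorem op_cap (e : A ⊕ B ≃ T) (h : Nat.card A = 2) :
    R.op (BrauerDiagram.cap e h) = R.cap e h := by
  rw [← comp_refl (BrauerDiagram.cap e h), op_cap_comp, op_ofEquiv]
  exact LinearMap.ext fun x => FBMod.mp_refl M (R.cap e h x)

/-- The one case of functoriality that needs the mixed relations. When the diagram ends with a cup,
the pairs of the cup and the cap are in one of three relative positions, and each position has its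
relation. A cap at the source plays no part, and a bijection is absorbed into the cap. -/
theorem cap_op (d : BrauerDiagram S T) : ∀ {A B : FB} (e : A ⊕ B ≃ T) (h : Nat.card A = 2)
    (x : M.ev S), R.cap e h (R.op d x) = δ ^ loops d (BrauerDiagram.cap e h) •
      R.op (d.comp (BrauerDiagram.cap e h)) x := by
  refine generation (P := fun {S T} d => ∀ {A B : FB} (e : A ⊕ B ≃ T) (h : Nat.card A = 2)
    (x : M.ev S), R.cap e h (R.op d x) = δ ^ loops d (BrauerDiagram.cap e h) •
      R.op (d.comp (BrauerDiagram.cap e h)) x) ?_ ?_ ?_ d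
  · intro S T f A B e h x
    rw [(BrauerDiagram.ofEquiv_comp f _).2, pow_zero, one_smul, (BrauerDiagram.ofEquiv_comp f _).1,
      BrauerDiagram.cap_congr e h (e.trans f.symm) h (Equiv.refl A) (Equiv.refl B) f.symm (fun x => by
        rcases x with x | x <;> rfl), op_cap, op_ofEquiv]
    refine (R.cap_congr (e.trans f.symm) h e h (Equiv.refl A) (Equiv.refl B) f (fun x => by
        rcases x with x | x <;> simp) x).trans ?_
    rw [FBMod.mp_refl]
  · intro S T A' B' d e' h' ih A B e h x
    -- Adding a cup to `d` creates no loop, so all loops can be counted with the cup and the cap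
    -- composed first.
    have hl := loops_assoc d (BrauerDiagram.cup e' h') (BrauerDiagram.cap e h)
    rw [loops_cup, add_zero] at hl
    rw [hl, op_comp_cup, LinearMap.comp_apply, assoc]
    rcases FB.trichotomy e e' h h' with ⟨⟨s⟩⟩ | ⟨⟨D⟩⟩ | ⟨⟨m⟩⟩
    · obtain ⟨h1, h2⟩ := cup_comp_cap_of_same (h := h) (h' := h') s
      rw [h1, h2, (BrauerDiagram.comp_ofEquiv _ _).2, zero_add, pow_one, op_comp_ofEquiv]
      exact R.cap_cup_same h h' s _
    · obtain ⟨h1, h2⟩ := cup_comp_cap_of_disj (h := h) (h' := h') D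
      -- After the cap has slid past the cup it meets the smaller diagram `d`; the loops formed
      -- there are those of the induction hypothesis.
      have hl := loops_assoc d (BrauerDiagram.cap D.q h) (BrauerDiagram.cup D.p h')
      rw [loops_cup, loops_cup, add_zero, zero_add] at hl
      rw [h1, h2, add_zero, ← hl, ← assoc, op_comp_cup, R.cap_cup_disj h h' D, ih, map_smul]
      rfl
    · obtain ⟨h1, h2⟩ := cup_comp_cap_of_meet (h := h) (h' := h') m
      rw [h1, h2, (BrauerDiagram.comp_ofEquiv _ _).2, zero_add, pow_zero, one_smul, op_comp_ofEquiv]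
      exact R.cap_cup_meet h h' m _
  · intro S T A' B' d e' h' ih A B e h x
    have hl := loops_assoc (BrauerDiagram.cap e' h') d (BrauerDiagram.cap e h)
    rw [loops_cap, loops_cap, add_zero, zero_add] at hl
    rw [hl, assoc, op_cap_comp, op_cap_comp]
    exact ih e h _

/-- The operators attached to diagrams are compatible with composition. -/
theorem op_op (d : BrauerDiagram S T) (d' : BrauerDiagram T U) (x : M.ev S) :
    R.op d' (R.op d x) = δ ^ loops d d' • R.op (d.comp d') x := by
  -- Induction on the second diagram. A bijection or a cup at the end creates no loops; a cap at its
  -- source is applied directly to `R.op d x`, where `cap_op` takes over.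
  refine generation (P := fun {T U} d' => ∀ {S : FB} (d : BrauerDiagram S T) (x : M.ev S),
    R.op d' (R.op d x) = δ ^ loops d d' • R.op (d.comp d') x) ?_ ?_ ?_ d' d x
  · intro T U f S d x
    rw [(BrauerDiagram.comp_ofEquiv d f).2, pow_zero, one_smul, op_comp_ofEquiv, op_ofEquiv]
    rfl
  · intro T U A B d' e h ih S d x
    have hl := loops_assoc d d' (BrauerDiagram.cup e h)
    rw [loops_cup, loops_cup, add_zero, zero_add] at hl
    rw [← hl, ← assoc, op_comp_cup, op_comp_cup, LinearMap.comp_apply, LinearMap.comp_apply, ih,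
      map_smul]
  · intro T U A B d' e h ih S d x
    have hl := loops_assoc d (BrauerDiagram.cap e h) d'
    rw [loops_cap, add_zero] at hl
    rw [← hl, ← assoc, op_cap_comp, LinearMap.comp_apply, cap_op, map_smul, ih, smul_smul, pow_add,
      mul_comm]

end CupCap

/-! ### Components of tensor products, and the standard action of the curried general linear
algebra. -/

namespace FBMod

noncomputable section

variable {k : Type u} [CommRing k] {n : ℕ}

attribute [local irreducible] FBMod.app

/-- This makes `compAux` independent of the chosen identification. -/
theorem same_right_unique {A B A' B' T : FB} {e : A ⊕ B ≃ T} {e' : A' ⊕ B' ≃ T}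
    (s s' : FB.Same e e') : s.right = s'.right := by
  ext b
  have := (s.eq (Sum.inr b)).symm.trans (s'.eq (Sum.inr b))
  simpa using this

open Classical in
/-- The component at `e` of the tensor `v ⊗ x` with respect to the decomposition `e'`. -/
def compAux {N : FBMod k} {A B A' B' S : FB} (e : A ⊕ B ≃ S) (e' : A' ⊕ B' ≃ S) :
    (std (k := k) n).ev A' →ₗ[k] N.ev B' →ₗ[k] N.ev B :=
  if h : Nonempty (FB.Same e e') then
    (LinearMap.lsmul k _).compl₁₂ (coef n A') (N.mp h.some.right) else 0

theorem compAux_same {N : FBMod k} {A B A' B' S : FB} {e : A ⊕ B ≃ S} {e' : A' ⊕ B' ≃ S}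
    (s : FB.Same e e') (v : (std (k := k) n).ev A') (x : N.ev B') :
    compAux e e' v x = coef n A' v • N.mp s.right x := by
  rw [compAux, dif_pos ⟨s⟩, same_right_unique s]
  rfl

theorem compAux_not {N : FBMod k} {A B A' B' S : FB} {e : A ⊕ B ≃ S} {e' : A' ⊕ B' ≃ S}
    (s : ¬ Nonempty (FB.Same e e')) (v : (std (k := k) n).ev A') (x : N.ev B') :
    compAux e e' v x = 0 := by
  rw [compAux, dif_neg s]
  rfl

theorem compAux_naturality {N : FBMod k} {A B S : FB} (e : A ⊕ B ≃ S) {A₁ B₁ A₂ B₂ : FB}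
    (f : A₁ ≃ A₂) (g : B₁ ≃ B₂) (e' : A₂ ⊕ B₂ ≃ S) (v : (std (k := k) n).ev A₁) (x : N.ev B₁) :
    compAux e e' ((std n).mp f v) (N.mp g x) = compAux e ((Equiv.sumCongr f g).trans e') v x := by
  by_cases h : Nonempty (FB.Same e e')
  · obtain ⟨s⟩ := h
    rw [compAux_same s, compAux_same (e' := (Equiv.sumCongr f g).trans e')
      ⟨f.trans s.left, g.trans s.right, fun x => by
        rw [Equiv.trans_apply, s.eq]
        rcases x with x | x <;> rfl⟩, coef_mp, mp_mp]
  · rw [compAux_not h, compAux_not]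
    rintro ⟨s⟩
    refine h ⟨⟨f.symm.trans s.left, g.symm.trans s.right, fun x => ?_⟩⟩
    have := s.eq (Sum.map f.symm g.symm x)
    rcases x with x | x <;> simpa using this

/-- The component at `e : A ⊔ B ≃ S` of an element of a tensor product with `std n`. -/
def comp {N : FBMod k} {A B S : FB} (e : A ⊕ B ≃ S) : (std n ⊗ N : FBMod k).ev S →ₗ[k] N.ev B :=
  desc fun e' => compAux e e'

theorem comp_tmul {N : FBMod k} {A B A' B' S : FB} (e : A ⊕ B ≃ S) (e' : A' ⊕ B' ≃ S)
    (v : (std (k := k) n).ev A') (x : N.ev B') : comp e (tmul e' v x) = compAux e e' v x :=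
  desc_tmul _ (compAux_naturality e) e' v x

theorem comp_tmul_same {N : FBMod k} {A B A' B' S : FB} {e : A ⊕ B ≃ S} {e' : A' ⊕ B' ≃ S}
    (s : FB.Same e e') (v : (std (k := k) n).ev A') (x : N.ev B') :
    comp e (tmul e' v x) = coef n A' v • N.mp s.right x :=
  (comp_tmul e e' v x).trans (compAux_same s v x)

theorem comp_tmul_not {N : FBMod k} {A B A' B' S : FB} {e : A ⊕ B ≃ S} {e' : A' ⊕ B' ≃ S}
    (s : ¬ Nonempty (FB.Same e e')) (v : (std (k := k) n).ev A') (x : N.ev B') :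
    comp e (tmul e' v x) = 0 :=
  (comp_tmul e e' v x).trans (compAux_not s v x)

theorem comp_whiskerLeft {N N' : FBMod k} (f : N ⟶ N') {A B S : FB} (e : A ⊕ B ≃ S)
    (w : (std n ⊗ N : FBMod k).ev S) : comp e (app (std n ◁ f) S w) = app f B (comp e w) := by
  induction w using tensor_induction with
  | add x y hx hy => simp only [map_add, hx, hy]
  | tmul A' B' e' v x =>
    rw [app_whiskerLeft]
    by_cases h : Nonempty (FB.Same e e')
    · obtain ⟨s⟩ := h
      rw [comp_tmul_same s, comp_tmul_same s, map_smul, app_mp]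
    · rw [comp_tmul_not h, comp_tmul_not h, map_zero]

open Classical in
-- As `std n` is `k` on sets with `n` elements and `0` elsewhere, the tensor product is the direct
-- sum of the `N(S \ T)` over the `T` with `n` elements, and `comp (cut T)` is the projection. A
-- pure tensor has its only component at the image of its first part.
theorem eq_sum_comp {N : FBMod k} {S : FB} (w : (std n ⊗ N : FBMod k).ev S) :
    w = ∑ T : Set S, if Nat.card (FB.sub T) = n then
      tmul (cut T) (one n (FB.sub T)) (comp (cut T) w) else 0 := by
  induction w using tensor_induction with
  | add x y hx hy =>
    conv_lhs => rw [hx, hy]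
    rw [← Finset.sum_add_distrib]
    refine Finset.sum_congr rfl fun T _ => ?_
    split_ifs
    · rw [map_add, map_add]
    · rw [add_zero]
  | tmul A B e v x =>
    by_cases hA : Nat.card A = n
    · have s : FB.Same (cut (Set.range fun a => e (Sum.inl a))) e :=
        ⟨leftPart e, rightPart e, by rintro (x | x) <;> rfl⟩
      have hc : Nat.card (FB.sub (Set.range fun a => e (Sum.inl a))) = n :=
        (Nat.card_congr (leftPart e)).symm.trans hA
      rw [Finset.sum_eq_single (Set.range fun a => e (Sum.inl a)), if_pos hc, comp_tmul_same s]
      · rw [LinearMap.map_smul, ← LinearMap.smul_apply, ← LinearMap.map_smul, ← mp_one n s.left,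
          ← LinearMap.map_smul, coef_smul_one, tmul_mp]
        exact tmul_eq s.eq _ _
      · intro T _ hT
        split_ifs with h
        · rw [comp_tmul_not, map_zero]
          rintro ⟨s'⟩
          refine hT (Set.ext fun t => ⟨fun ht => ?_, ?_⟩)
          · refine ⟨s'.left.symm ⟨t, ht⟩, ?_⟩
            change e (Sum.inl _) = t
            rw [s'.eq, Sum.map_inl, Equiv.apply_symm_apply]
            rfl
          · rintro ⟨a, rfl⟩
            dsimp only
            rw [s'.eq]
            exact (s'.left a).2
        · rfl
      · exact fun h => absurd (Finset.mem_univ _) h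
    · have hv : v = 0 := by rw [← coef_smul_one v, coef_eq_zero hA, zero_smul]
      subst hv
      rw [map_zero, LinearMap.zero_apply]
      refine (Finset.sum_eq_zero fun T _ => ?_).symm
      rw [map_zero, map_zero, ite_self]

theorem comp_ext {N : FBMod k} {S : FB} {w w' : (std n ⊗ N : FBMod k).ev S}
    (h : ∀ (A B : FB) (e : A ⊕ B ≃ S), Nat.card A = n → comp e w = comp e w') : w = w' := by
  classical
  rw [eq_sum_comp w, eq_sum_comp w']
  refine Finset.sum_congr rfl fun T _ => ?_
  split_ifs with hT
  · rw [h _ _ (cut T) hT]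
  · rfl

theorem std_tensor_hom_ext {N P : FBMod k} {φ ψ : std n ⊗ N ⟶ P}
    (h : ∀ (S A B : FB) (e : A ⊕ B ≃ S), Nat.card A = n → ∀ x : N.ev B,
      app φ S (tmul e (one n A) x) = app ψ S (tmul e (one n A) x)) : φ = ψ :=
  tensor_hom_ext' fun S A B e v x => by
    by_cases hA : Nat.card A = n
    · rw [← coef_smul_one v, LinearMap.map_smul, LinearMap.smul_apply, LinearMap.map_smul,
        LinearMap.map_smul, h S A B e hA]
    · rw [← coef_smul_one v, coef_eq_zero hA, zero_smul, map_zero, LinearMap.zero_apply, map_zero,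
        map_zero]

/-- Interchange of the first two parts of a decomposition. -/
def swapEquiv {A B C D S : FB} (e : A ⊕ D ≃ S) (e' : B ⊕ C ≃ D) : B ⊕ (A ⊕ C) ≃ S :=
  ((Equiv.sumAssoc B A C).symm.trans (Equiv.sumCongr (Equiv.sumComm B A) (Equiv.refl C))).trans
    ((Equiv.sumAssoc A B C).trans ((Equiv.sumCongr (Equiv.refl A) e').trans e))

theorem app_swap {V W M : FBMod k} {A B C D S : FB} (e : A ⊕ D ≃ S) (e' : B ⊕ C ≃ D) (v : V.ev A)
    (w : W.ev B) (x : M.ev C) : app (Curried.swap V W M) S (tmul e v (tmul e' w x)) =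
      tmul (B := FB.sum A C) (swapEquiv e e') w (tmul (S := FB.sum A C) (Equiv.refl (A ⊕ C)) v x) := by
  rw [Curried.swap, app_comp, app_comp, app_associator_inv, app_whiskerRight, app_braiding,
    app_associator]
  rw [tmul_tmul]
  exact tmul_eq (by rintro (x | x | x) <;> rfl) _ _

/-- The element `v ⊗ w ⊗ x` for a decomposition into three parts. -/
def tmul₃ {V W M : FBMod k} {A B C S : FB} (e : A ⊕ B ⊕ C ≃ S) (v : V.ev A) (w : W.ev B)
    (x : M.ev C) : (V ⊗ W ⊗ M : FBMod k).ev S :=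
  tmul (B := FB.sum B C) e v (tmul (S := FB.sum B C) (Equiv.refl (B ⊕ C)) w x)

theorem tmul_tmul_eq {V W M : FBMod k} {A B C D S : FB} (e : A ⊕ D ≃ S) (e' : B ⊕ C ≃ D)
    (v : V.ev A) (w : W.ev B) (x : M.ev C) :
    tmul e v (tmul e' w x) = tmul₃ ((Equiv.sumCongr (Equiv.refl A) e').trans e) v w x :=
  tmul_tmul e e' v w x

theorem tensor₃_hom_ext {V W M Q : FBMod k} {φ ψ : V ⊗ W ⊗ M ⟶ Q}
    (h : ∀ (S A B C : FB) (e : A ⊕ B ⊕ C ≃ S) (v : V.ev A) (w : W.ev B) (x : M.ev C),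
      app φ S (tmul₃ e v w x) = app ψ S (tmul₃ e v w x)) : φ = ψ :=
  triple_hom_ext' fun S A D B C e e' v w x => by
    rw [tmul_tmul_eq]
    exact h _ _ _ _ _ _ _ _

open Classical in
-- The half of the action on `W ⊗ M` that moves the point of `V` into the part of `W`.
theorem app_actLeft (δ : k) (W M : FBMod k) {A B C S : FB} (e : A ⊕ B ⊕ C ≃ S) (v : (V k).ev A)
    (w : W.ev B) (x : M.ev C) :
    app ((α_ (V k) W M).inv ≫ glStd δ W ▷ M ≫ (α_ (V k) W M).hom) S (tmul₃ e v w x) =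
      δ • tmul₃ e v w x + ∑ a : A, ∑ b : B,
        tmul₃ ((Equiv.swap (Sum.inl a) (Sum.inr (Sum.inl b))).trans e) v w x := by
  -- The element `x` is a bystander: `L` appends it to elements of `(V ⊗ W)(A ⊔ B)`, which reduces
  -- the claim to the formula for the standard map on `V ⊗ W`.
  let E : FB.sum A B ⊕ C ≃ S := ((Equiv.sumAssoc A B C).trans
    (Equiv.sumCongr (Equiv.refl A) (Equiv.refl (B ⊕ C)))).trans e
  let L : (V k ⊗ W : FBMod k).ev (FB.sum A B) →ₗ[k] (V k ⊗ W ⊗ M : FBMod k).ev S :=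
    app (α_ (V k) W M).hom S ∘ₗ (tmul E).flip x
  have hL : ∀ (e₁ : A ⊕ B ≃ A ⊕ B) (e₂ : A ⊕ B ⊕ C ≃ S),
      (∀ z, (Equiv.sumCongr e₁ (Equiv.refl C)).trans E z = e₂ (Equiv.sumAssoc A B C z)) →
      L (tmul (S := FB.sum A B) e₁ v w) = tmul₃ e₂ v w x := by
    intro e₁ e₂ h
    refine (app_associator (V k) W M E e₁ v w x).trans (tmul_eq (fun z => ?_) _ _)
    have := h ((Equiv.sumAssoc A B C).symm z)
    rwa [Equiv.apply_symm_apply] at this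
  rw [app_comp, app_comp, tmul₃, app_associator_inv, app_whiskerRight]
  refine (congrArg L (app_glStd δ W (S := FB.sum A B) (Equiv.refl (A ⊕ B)) v w)).trans ?_
  rw [map_add, map_smul, map_sum]
  refine congrArg₂ _ (congrArg _ (hL _ _ ?_)) (Finset.sum_congr rfl fun a _ => ?_)
  · rintro ((z | z) | z) <;> rfl
  · rw [map_sum]
    refine Finset.sum_congr rfl fun b _ => hL _ _ fun z => ?_
    let i : A ⊕ B → A ⊕ B ⊕ C := fun y => Equiv.sumAssoc A B C (Sum.inl y)
    have hi : Function.Injective i := (Equiv.injective _).comp Sum.inl_injective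
    have hE : ∀ z, E z = e (Equiv.sumAssoc A B C z) := by rintro ((z | z) | z) <;> rfl
    refine (hE _).trans (congrArg e ?_)
    rcases z with z | z
    · exact hi.map_swap (Sum.inl a) (Sum.inr b) z
    · exact (Equiv.swap_apply_of_ne_of_ne (x := Sum.inr (Sum.inr z)) (by simp) (by simp)).symm

theorem swapEquiv_inr {A B C D S : FB} (e : A ⊕ D ≃ S) (e' : B ⊕ C ≃ D) (y : A ⊕ C) :
    swapEquiv e e' (Sum.inr y) = e (Sum.map id (fun c => e' (Sum.inr c)) y) := by
  rcases y with y | y <;> rfl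

open Classical in
-- The other half, which moves the point of `V` into the part of `M`; now `w` is the bystander.
theorem app_actRight (δ : k) (W M : FBMod k) {A B C S : FB} (e : A ⊕ B ⊕ C ≃ S) (v : (V k).ev A)
    (w : W.ev B) (x : M.ev C) :
    app (Curried.swap (V k) W M ≫ W ◁ glStd δ M ≫ Curried.swap W (V k) M) S (tmul₃ e v w x) =
      δ • tmul₃ e v w x + ∑ a : A, ∑ c : C,
        tmul₃ ((Equiv.swap (Sum.inl a) (Sum.inr (Sum.inr c))).trans e) v w x := by
  let E : B ⊕ FB.sum A C ≃ S := swapEquiv (B := B) (D := FB.sum B C) e (Equiv.refl (B ⊕ C))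
  let y : (V k ⊗ M : FBMod k).ev (FB.sum A C) := tmul (S := FB.sum A C) (Equiv.refl (A ⊕ C)) v x
  obtain ⟨L, hy⟩ : ∃ L : (V k ⊗ M : FBMod k).ev (FB.sum A C) →ₗ[k] (V k ⊗ W ⊗ M : FBMod k).ev S,
      ∀ y, L y = app (Curried.swap W (V k) M) S (tmul (M := W) (N := V k ⊗ M) E w y) :=
    ⟨app (Curried.swap W (V k) M) S ∘ₗ tmul (M := W) (N := V k ⊗ M) E w, fun _ =>
      LinearMap.comp_apply _ _ _⟩
  have hL : ∀ (e₁ : A ⊕ C ≃ A ⊕ C) (e₂ : A ⊕ B ⊕ C ≃ S),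
      (∀ z, swapEquiv E e₁ z = e₂ z) →
      L (tmul (S := FB.sum A C) e₁ v x) = tmul₃ e₂ v w x := by
    intro e₁ e₂ h
    have := app_swap (V := W) (W := V k) (M := M) (D := FB.sum A C) E e₁ w v x
    rw [Equiv.ext h] at this
    rw [hy]
    exact this
  have h1 : app (Curried.swap (V k) W M) S (tmul₃ e v w x) = tmul (N := V k ⊗ M) E w y :=
    app_swap (V := V k) (W := W) (M := M) (D := FB.sum B C) e (Equiv.refl (B ⊕ C)) v w x
  have h2 : app (glStd δ M) (FB.sum A C) y = _ := app_glStd δ M _ v x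
  have h3 : app (W ◁ glStd δ M) S (tmul (N := V k ⊗ M) E w y) =
    tmul (N := V k ⊗ M) E w (app (glStd δ M) (FB.sum A C) y) := app_whiskerLeft _ _ _ _ _
  rw [app_comp, app_comp, h1, h3, ← hy, h2]
  rw [map_add, map_smul, map_sum]
  refine congrArg₂ _ (congrArg _ (hL _ _ ?_)) (Finset.sum_congr rfl fun a _ => ?_)
  · rintro (z | z | z) <;> rfl
  · rw [map_sum]
    refine Finset.sum_congr rfl fun c _ => hL _ _ fun z => ?_
    let i : A ⊕ C → A ⊕ B ⊕ C := Sum.map id Sum.inr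
    have hi : Function.Injective i := Sum.map_injective.2 ⟨Function.injective_id, Sum.inr_injective⟩
    have hE : ∀ y, E (Sum.inr y) = e (i y) := swapEquiv_inr _ _
    rcases z with z | z | z
    · exact (hE _).trans (congrArg e (hi.map_swap (Sum.inl a) (Sum.inr c) (Sum.inl z)))
    · exact congrArg e (Equiv.swap_apply_of_ne_of_ne (x := Sum.inr (Sum.inl z)) (by simp) (by simp)).symm
    · exact (hE _).trans (congrArg e (hi.map_swap (Sum.inl a) (Sum.inr c) (Sum.inr z)))

theorem swap_apply_congr {α : Type*} (i j : DecidableEq α) (x y z : α) :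
    @Equiv.swap α i x y z = @Equiv.swap α j x y z := by
  rw [Subsingleton.elim i j]

/-- The standard map sums over all transpositions of the point of `V` with another point. On `W ⊗ M`
the other points are those in the part of `W` and those in the part of `M`, and the two diagonal
terms add up. -/
theorem tensorAct_glStd (δ₁ δ₂ : k) (W M : FBMod k) :
    Curried.tensorAct (glStd δ₁ W) (glStd δ₂ M) = glStd (δ₁ + δ₂) (W ⊗ M) :=
  tensor₃_hom_ext fun S A B C e v w x => by
    classical
    have h3 : ∀ f : FB.sum B C → (V k ⊗ W ⊗ M : FBMod k).ev S,
        ∑ d ∈ @Finset.univ _ (instFintypeCarrier (FB.sum B C)), f d =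
        ∑ b : B, f (Sum.inl b) + ∑ c : C, f (Sum.inr c) := fun f => by
      rw [← Fintype.sum_sum_type]
      exact Finset.sum_congr (by ext; simp) fun _ _ => rfl
    have h4 : app (glStd (δ₁ + δ₂) (W ⊗ M)) S (tmul₃ e v w x) = (δ₁ + δ₂) • tmul₃ e v w x +
        ∑ a : A, (∑ b : B, tmul₃ ((Equiv.swap (Sum.inl a) (Sum.inr (Sum.inl b))).trans e) v w x +
          ∑ c : C, tmul₃ ((Equiv.swap (Sum.inl a) (Sum.inr (Sum.inr c))).trans e) v w x) := by
      refine (app_glStd (δ₁ + δ₂) (W ⊗ M) (B := FB.sum B C) e v _).trans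
        (congrArg₂ (· + ·) rfl (Finset.sum_congr rfl fun a _ => (h3 _).trans ?_))
      refine congrArg₂ (· + ·) (Finset.sum_congr rfl fun b _ => ?_)
        (Finset.sum_congr rfl fun c _ => ?_)
      · exact tmul_eq (fun z => congrArg e (swap_apply_congr _ _ _ _ _)) _ _
      · exact tmul_eq (fun z => congrArg e (swap_apply_congr _ _ _ _ _)) _ _
    rw [h4, Curried.tensorAct, app_add, app_actLeft, app_actRight, Finset.sum_add_distrib, add_smul,
      add_add_add_comm]

/-- On `V ⊗ V` there is a single transposition and no diagonal term: the natural representation `V`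
is `0`-standard. -/
theorem braiding_eq_glStd : (β_ (V k) (V k)).hom = glStd 0 (V k) :=
  std_tensor_hom_ext fun S A B e hA y => by
    classical
    rw [app_braiding, app_glStd, zero_smul, zero_add]
    have := (Nat.card_eq_one_iff_unique.1 hA).1
    obtain ⟨a⟩ := (Nat.card_eq_one_iff_unique.1 hA).2
    rw [Fintype.sum_eq_single a fun a' h => absurd (Subsingleton.elim a' a) h]
    by_cases hB : Nat.card B = 1
    · have := (Nat.card_eq_one_iff_unique.1 hB).1
      obtain ⟨b⟩ := (Nat.card_eq_one_iff_unique.1 hB).2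
      rw [Fintype.sum_eq_single b fun b' h => absurd (Subsingleton.elim b' b) h]
      rw [← coef_smul_one y]
      simp only [map_smul, LinearMap.smul_apply]
      congr 1
      rw [tmul_one_one hB _ b, tmul_one_one hA _ a]
      simp
    · rw [← coef_smul_one y, coef_eq_zero hB]
      simp

/-- `Δ` intertwines the natural action with the action on `V ⊗ V`, which is `0`-standard by the two
preceding results. As a map of species it also intertwines the `0`-standard actions. The two agree
because `V ◁ Δ` is injective, being injective on each component. -/
theorem divAct_eq : (squares k).divAct = glStd 0 (std 2) := by
  have h := (squares k).divAct_Δ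
  rw [braiding_eq_glStd, tensorAct_glStd, add_zero] at h
  have h' := h.trans (Brauer.glStd_naturality 0 (squares k).Δ).symm
  refine hom_ext fun S => LinearMap.ext fun w => comp_ext fun A B e hA => comul_injective B ?_
  have := congrArg (fun f => comp e (app f S w)) h'
  simp only [app_comp] at this
  exact ((comp_whiskerLeft comul e _).symm.trans this).trans (comp_whiskerLeft comul e _)

theorem whiskerLeft_mul_cancel {X W : FBMod k} {φ ψ : W ⊗ std 2 ⟶ X}
    (h : W ◁ mul ≫ φ = W ◁ mul ≫ ψ) : φ = ψ :=
  tensor_hom_ext' fun S A B e v x => by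
    obtain ⟨w, rfl⟩ := mul_surjective B x
    have := congrArg (fun f => app f S (tmul e v w)) h
    simp only [app_comp] at this
    rwa [app_whiskerLeft] at this

/-- Dual to `divAct_eq`, with surjectivity of `m` in place of injectivity of `Δ`. -/
theorem symAct_eq : (squares k).symAct = glStd 0 (std 2) := by
  have h := (squares k).m_symAct
  rw [braiding_eq_glStd, tensorAct_glStd, add_zero] at h
  exact whiskerLeft_mul_cancel (h.trans (Brauer.glStd_naturality 0 (squares k).m))

/-- The standard action on `V ⊗ M` is `τ + a₁`, since `V` is `0`-standard. It commutes with `a₂`, by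
naturality applied to the map `a` itself. Rearranged with `τ² = 1`, this is the required relation.
-/
theorem isGlRep_glStd (δ : k) (M : FBMod k) : Curried.IsGlRep (glStd δ M) := by
  have h1 := Brauer.glStd_naturality δ (glStd δ M)
  have h2 := tensorAct_glStd 0 δ (V k) M
  rw [zero_add, Curried.tensorAct, ← braiding_eq_glStd] at h2
  have h3 : Curried.swap (V k) (V k) M ≫ Curried.swap (V k) (V k) M = 𝟙 _ := by
    have : (β_ (V k) (V k)).hom ▷ M ≫ (β_ (V k) (V k)).hom ▷ M = 𝟙 _ := by
      rw [← comp_whiskerRight, SymmetricCategory.symmetry, id_whiskerRight]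
    simp [Curried.swap, reassoc_of% this]
  rw [← h2] at h1
  change (Curried.swap (V k) (V k) M + _) ≫ _ = _ ≫ (Curried.swap (V k) (V k) M + _) at h1
  rw [Preadditive.add_comp, Preadditive.comp_add] at h1
  change V k ◁ glStd δ M ≫ (Curried.swap (V k) (V k) M ≫ V k ◁ glStd δ M ≫ Curried.swap (V k) (V k) M) -
    (Curried.swap (V k) (V k) M ≫ V k ◁ glStd δ M ≫ Curried.swap (V k) (V k) M) ≫ V k ◁ glStd δ M =
    ((Curried.swap (V k) (V k) M ≫ V k ◁ glStd δ M ≫ Curried.swap (V k) (V k) M) -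
      V k ◁ glStd δ M) ≫ Curried.swap (V k) (V k) M
  rw [Preadditive.sub_comp, Category.assoc _ _ (Curried.swap (V k) (V k) M),
    Category.assoc _ _ (Curried.swap (V k) (V k) M), h3, Category.comp_id, sub_eq_sub_iff_add_eq_add,
    add_comm, ← h1, add_comm]

/-- Both sides carry the `δ`-standard action, because `Div²` is `0`-standard, and every map of
species commutes with it. The same argument applies to `b'`. -/
theorem b_equivariant (δ : k) {M : FBMod k} (b : (squares k).div ⊗ M ⟶ M) :
    V k ◁ b ≫ glStd δ M = Curried.tensorAct (squares k).divAct (glStd δ M) ≫ V k ◁ b := by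
  rw [divAct_eq]
  have := tensorAct_glStd 0 δ (std 2) M
  rw [zero_add] at this
  exact (Brauer.glStd_naturality δ b).symm.trans (congrArg (· ≫ V k ◁ b) this.symm)

theorem b'_equivariant (δ : k) {M : FBMod k} (b' : M ⟶ (squares k).sym ⊗ M) :
    glStd δ M ≫ V k ◁ b' = V k ◁ b' ≫ Curried.tensorAct (squares k).symAct (glStd δ M) := by
  rw [symAct_eq]
  have := tensorAct_glStd 0 δ (std 2) M
  rw [zero_add] at this
  exact (Brauer.glStd_naturality δ b').trans (congrArg (V k ◁ b' ≫ ·) this.symm)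

end

end FBMod

/-! ### Components of the interchange and of the right-hand side of the bracket relation. -/

/-- A decomposition into three parts as a pair of disjoint decompositions. -/
def FB.disjSwap {A B A' C T : FB} (e : A ⊕ B ≃ T) (p : A' ⊕ C ≃ B) :
    FB.Disj (B' := FB.sum A C) e (FBMod.swapEquiv e p) where
  rest := C
  p := p
  q := Equiv.refl _
  inl_left _ := rfl
  inl_right _ := rfl
  inr _ := rfl

namespace FBMod

noncomputable section

variable {k : Type u} [CommRing k] {n : ℕ}

attribute [local irreducible] FBMod.app

theorem comp_mp {N : FBMod k} {A B S A' B' S' : FB} (e : A ⊕ B ≃ S) (e' : A' ⊕ B' ≃ S') (f : A ≃ A')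
    (g : B ≃ B') (v : S ≃ S') (H : ∀ x, v (e x) = e' (Sum.map f g x)) (w : (std n ⊗ N : FBMod k).ev S) :
    comp e' ((std n ⊗ N : FBMod k).mp v w) = N.mp g (comp e w) := by
  induction w using tensor_induction with
  | add x y hx hy => simp only [map_add, hx, hy]
  | tmul A₁ B₁ e₁ m x =>
    rw [mp_tmul']
    by_cases h : Nonempty (FB.Same e e₁)
    · obtain ⟨s⟩ := h
      rw [comp_tmul_same s, comp_tmul_same (e := e') (e' := e₁.trans v)
        ⟨s.left.trans f, s.right.trans g, fun x => ?_⟩, map_smul, mp_mp]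
      rw [Equiv.trans_apply, s.eq, H]
      rcases x with x | x <;> rfl
    · rw [comp_tmul_not h, map_zero, comp_tmul_not]
      rintro ⟨s⟩
      refine h ⟨⟨s.left.trans f.symm, s.right.trans g.symm, fun x => v.injective ?_⟩⟩
      rw [H]
      refine (s.eq x).trans ?_
      rcases x with x | x <;> simp

theorem tmul_same {M N : FBMod k} {A B A' B' S : FB} {e : A ⊕ B ≃ S} {e' : A' ⊕ B' ≃ S}
    (s : FB.Same e e') (v : M.ev A') (x : N.ev B') :
    tmul e' v x = tmul e (M.mp s.left v) (N.mp s.right x) := by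
  rw [tmul_mp]
  exact tmul_eq s.eq _ _

/-- The interchange brings the factor `std n` inside `z` to the front. Its points lie in the
complement of `A'`, where the first part of `e` becomes that of `D.q`. -/
theorem comp_swap_disj {W M : FBMod k} {A B A' B' S : FB} {e : A ⊕ B ≃ S} {e' : A' ⊕ B' ≃ S}
    (D : FB.Disj e e') (v : W.ev A') (z : (std n ⊗ M : FBMod k).ev B') :
    comp e (app (Curried.swap W (std n) M) S (tmul e' v z)) = tmul D.p v (comp D.q z) := by
  induction z using tensor_induction with
  | add x y hx hy => simp only [map_add, hx, hy]
  | tmul A₁ C₁ e₁ w x =>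
    rw [app_swap]
    by_cases h : Nonempty (FB.Same D.q e₁)
    · obtain ⟨t⟩ := h
      rw [comp_tmul_same t]
      refine (comp_tmul_same (e := e) (B' := FB.sum A' C₁) (e' := swapEquiv e' e₁)
        ⟨t.left, (Equiv.sumCongr (Equiv.refl A') t.right).trans D.p, ?_⟩ _ _).trans ?_
      · rintro (z | z | z)
        · change e' (Sum.inr (e₁ (Sum.inl z))) = e (Sum.inl (t.left z))
          rw [t.eq, D.inl_left]
          rfl
        · exact D.inl_right z
        · change e' (Sum.inr (e₁ (Sum.inr z))) = e (Sum.inr (D.p (Sum.inr (t.right z))))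
          rw [t.eq, D.inr]
          rfl
      · rw [map_smul]
        refine congrArg _ ((mp_tmul' _ _ _ _).trans ?_)
        rw [tmul_mp_right]
        rfl
    · rw [comp_tmul_not h, map_zero]
      refine comp_tmul_not (B' := FB.sum A' C₁) ?_ _ _
      rintro ⟨s⟩
      have key : ∀ a, e₁ (Sum.inl a) = D.q (Sum.inl (s.left a)) := by
        intro a
        have h1 := s.eq (Sum.inl a)
        change e' (Sum.inr (e₁ (Sum.inl a))) = e (Sum.inl (s.left a)) at h1
        rw [D.inl_left] at h1
        simpa using h1
      refine h (FB.exists_same fun t => ⟨?_, ?_⟩)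
      · rintro ⟨a, rfl⟩
        exact ⟨s.left.symm a, by rw [key, Equiv.apply_symm_apply]⟩
      · rintro ⟨a, rfl⟩
        exact ⟨s.left a, (key a).symm⟩

/-- The factor brought to the front is supported off `A'`, so it has no component at a set that
meets `A'`. -/
theorem comp_swap_not_disj {W M : FBMod k} {A B A' B' S : FB} {e : A ⊕ B ≃ S} {e' : A' ⊕ B' ≃ S}
    (D : ¬ Nonempty (FB.Disj e e')) (v : W.ev A') (z : (std n ⊗ M : FBMod k).ev B') :
    comp e (app (Curried.swap W (std n) M) S (tmul e' v z)) = 0 := by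
  induction z using tensor_induction with
  | add x y hx hy => simp only [map_add, hx, hy, add_zero]
  | tmul A₁ C₁ e₁ w x =>
    rw [app_swap]
    refine comp_tmul_not (B' := FB.sum A' C₁) ?_ _ _
    rintro ⟨s⟩
    refine D (FB.exists_disj fun a a' h => ?_)
    have h1 := s.eq (Sum.inl (s.left.symm a))
    change e' (Sum.inr (e₁ (Sum.inl _))) = e (Sum.inl (s.left (s.left.symm a))) at h1
    rw [Equiv.apply_symm_apply, h] at h1
    simp at h1

/-- Both sides extract the coefficient at the same two disjoint subsets, in the two possible orders.
-/
theorem comp_comp_swap {M : FBMod k} {A B A' B' S : FB} {e : A ⊕ B ≃ S} {e' : A' ⊕ B' ≃ S}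
    (D : FB.Disj e e') (w : (std n ⊗ std n ⊗ M : FBMod k).ev S) :
    comp D.p (comp e (app (Curried.swap (std n) (std n) M) S w)) = comp D.q (comp e' w) := by
  induction w using tensor_induction with
  | add x y hx hy => simp only [map_add, hx, hy]
  | tmul A₁ B₁ e₁ v z =>
    by_cases h : Nonempty (FB.Same e' e₁)
    · obtain ⟨s⟩ := h
      rw [tmul_same s]
      refine (congrArg (comp D.p) (comp_swap_disj D _ _)).trans ?_
      refine (comp_tmul_same ⟨Equiv.refl _, Equiv.refl _, ?_⟩ _ _).trans ?_
      · rintro (x | x) <;> rfl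
      · rw [mp_refl, ← map_smul]
        refine congrArg (comp D.q) ?_
        refine Eq.symm ((comp_tmul_same ⟨Equiv.refl _, Equiv.refl _, ?_⟩ _ _).trans ?_)
        · rintro (x | x) <;> rfl
        · rw [mp_refl]
    · rw [comp_tmul_not h, map_zero]
      by_cases h' : Nonempty (FB.Disj e e₁)
      · obtain ⟨D'⟩ := h'
        refine (congrArg (comp D.p) (comp_swap_disj D' _ _)).trans (comp_tmul_not ?_ _ _)
        rintro ⟨s⟩
        have key : ∀ a, e₁ (Sum.inl a) = e' (Sum.inl (s.left a)) := fun a => by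
          rw [D'.inl_right, D.inl_right, s.eq]
          rfl
        refine h (FB.exists_same fun t => ⟨?_, ?_⟩)
        · rintro ⟨a, rfl⟩
          exact ⟨s.left.symm a, by rw [key, Equiv.apply_symm_apply]⟩
        · rintro ⟨a, rfl⟩
          exact ⟨s.left a, (key a).symm⟩
      · exact (congrArg (comp D.p) (comp_swap_not_disj h' _ _)).trans (map_zero _)

theorem map_swap_apply {α β : Type*} (i : DecidableEq α) (j : DecidableEq β) {f : α → β}
    (hf : Function.Injective f) (x y z : α) :
    f (@Equiv.swap α i x y z) = @Equiv.swap β j (f x) (f y) (f z) :=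
  hf.map_swap x y z

/-- In a set of two elements, passing to the other element is a permutation. -/
theorem sum_compl_pair {A : FB} (hA : Nat.card A = 2) {P : Type u} [AddCommGroup P] (f : A → P) :
    ∑ i : A, ∑ a ∈ @Finset.univ _ (instFintypeCarrier (FB.sub ({i}ᶜ : Set A))), f a.1 =
      ∑ a : A, f a := by
  obtain ⟨i, j, hji, hij, hsum⟩ := exists_pair.{u} hA
  have key : ∀ i j : A, j ≠ i →
      ∑ a ∈ @Finset.univ _ (instFintypeCarrier (FB.sub ({i}ᶜ : Set A))), f a.1 = f j := by
    intro i j h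
    have := (Nat.card_eq_one_iff_unique.1 ((card_compl i).2 hA)).1
    exact @Fintype.sum_eq_single _ _ (instFintypeCarrier (FB.sub ({i}ᶜ : Set A))) _ _
      (⟨j, h⟩ : FB.sub ({i}ᶜ : Set A)) fun a h => absurd (Subsingleton.elim _ _) h
  rw [hsum, hsum, key i j hji, key j i hij, add_comm]

/-- The right-hand side of the bracket relation. -/
def bracketMap {M : FBMod k} (a : V k ⊗ M ⟶ V k ⊗ M) : std 2 ⊗ M ⟶ std 2 ⊗ M :=
  comul ▷ M ≫ (α_ (V k) (V k) M).hom ≫ V k ◁ a ≫ (α_ (V k) (V k) M).inv ≫ mul ▷ M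

theorem app_assoc_mul {M : FBMod k} {A A₁ A₂ B S : FB} (E : A₁ ⊕ FB.sum A₂ B ≃ S) (e' : A₁ ⊕ A₂ ≃ A)
    (h₁ : Nat.card A₁ = 1) (h₂ : Nat.card A₂ = 1) (e₁ : A₂ ⊕ B ≃ A₂ ⊕ B) (x : M.ev B) (F : A ⊕ B ≃ S)
    (H : ∀ z, F (Sum.map e' id z) = E (Sum.map id e₁ (Equiv.sumAssoc A₁ A₂ B z))) :
    app ((α_ (V k) (V k) M).inv ≫ mul ▷ M) S
      (tmul (N := V k ⊗ M) E (one 1 A₁) (tmul (S := FB.sum A₂ B) e₁ (one 1 A₂) x)) =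
        tmul F (one 2 A) x := by
  rw [app_comp, app_associator_inv, app_whiskerRight, app_mul, coef_one h₁, coef_one h₂, one_mul,
    one_smul, ← mp_one 2 (S := FB.sum A₁ A₂) e', tmul_mp_left]
  refine tmul_eq (fun z => Eq.symm ((Eq.trans ?_ (H z)).trans ?_)) _ _
  · rcases z with z | z <;> rfl
  · rcases z with (z | z) | z <;> rfl

open Classical in
-- For `A = {i, j}`, `Δ` yields `t^i ⊗ t^j` and `t^j ⊗ t^i`. The standard map multiplies by `δ` or
-- moves the second of the two points into `B`, and `m` forgets the order. So each point of `A` is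
-- moved once, and the diagonal terms add up to `2δ`, the parameter of the Brauer category.
theorem app_bracketMap (δ : k) {M : FBMod k} {A B S : FB} (e : A ⊕ B ≃ S) (hA : Nat.card A = 2)
    (x : M.ev B) : app (bracketMap (glStd δ M)) S (tmul e (one 2 A) x) =
      (2 * δ) • tmul e (one 2 A) x + ∑ a : A, ∑ b : B,
        tmul ((Equiv.swap (Sum.inl a) (Sum.inr b)).trans e) (one 2 A) x := by
  have key : ∀ i : A, app ((α_ (V k) (V k) M).hom ≫ V k ◁ glStd δ M ≫ (α_ (V k) (V k) M).inv ≫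
      mul ▷ M) S (tmul (M := V k ⊗ V k) e (pt i) x) = δ • tmul e (one 2 A) x +
        ∑ a ∈ @Finset.univ _ (instFintypeCarrier (FB.sub ({i}ᶜ : Set A))), ∑ b : B,
          tmul ((Equiv.swap (Sum.inl a.1) (Sum.inr b)).trans e) (one 2 A) x := by
    intro i
    let E : FB.sub {i} ⊕ FB.sum (FB.sub {i}ᶜ) B ≃ S := (Equiv.sumAssoc _ _ _).symm.trans
      ((Equiv.sumCongr (cut {i}) (Equiv.refl B)).trans e)
    have h₁ : Nat.card (FB.sub {i}) = 1 := by simp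
    have h₂ := (card_compl i).2 hA
    obtain ⟨L, hL⟩ : ∃ L : (V k ⊗ M : FBMod k).ev (FB.sum (FB.sub {i}ᶜ) B) →ₗ[k]
        (std 2 ⊗ M : FBMod k).ev S, ∀ y, L y = app ((α_ (V k) (V k) M).inv ≫ mul ▷ M) S
          (tmul (N := V k ⊗ M) E (one 1 (FB.sub {i})) y) :=
      ⟨app ((α_ (V k) (V k) M).inv ≫ mul ▷ M) S ∘ₗ tmul (N := V k ⊗ M) E (one 1 (FB.sub {i})),
        fun _ => LinearMap.comp_apply _ _ _⟩
    have h3 : app (α_ (V k) (V k) M).hom S (tmul (M := V k ⊗ V k) e (pt i) x) =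
        tmul (N := V k ⊗ M) E (one 1 (FB.sub {i})) (tmul (S := FB.sum (FB.sub {i}ᶜ) B)
          (Equiv.refl _) (one 1 (FB.sub {i}ᶜ)) x) :=
      app_associator _ _ _ _ _ _ _ _
    have h4 := app_glStd δ M (S := FB.sum (FB.sub {i}ᶜ) B) (Equiv.refl _) (one 1 (FB.sub {i}ᶜ)) x
    rw [app_comp, h3, app_comp, app_whiskerLeft, h4, ← hL, map_add, map_smul, map_sum, hL]
    refine congrArg₂ _ (congrArg _ (app_assoc_mul E (cut {i}) h₁ h₂ _ x e ?_))
      (Finset.sum_congr rfl fun a _ => ?_)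
    · rintro ((z | z) | z) <;> rfl
    · rw [map_sum]
      refine Finset.sum_congr rfl fun b _ => (hL _).trans
        (app_assoc_mul E (cut {i}) h₁ h₂ _ x _ fun z => congrArg e ?_)
      let ι : FB.sub ({i}ᶜ : Set A) ⊕ B → A ⊕ B := Sum.map Subtype.val id
      have hι : Function.Injective ι :=
        Sum.map_injective.2 ⟨Subtype.val_injective, Function.injective_id⟩
      have hE : ∀ y, (Equiv.sumCongr (cut {i}) (Equiv.refl B)) ((Equiv.sumAssoc _ _ _).symm
          (Sum.inr y)) = ι y := by rintro (y | y) <;> rfl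
      rcases z with (z | z) | z
      · refine Equiv.swap_apply_of_ne_of_ne (fun h => a.2 ?_) (by simp)
        exact (Sum.inl_injective h).symm.trans z.2
      · exact ((hE _).trans (map_swap_apply _ _ hι (Sum.inl a) (Sum.inr b) (Sum.inl z))).symm
      · exact ((hE _).trans (map_swap_apply _ _ hι (Sum.inl a) (Sum.inr b) (Sum.inr z))).symm
  have h1 : app comul A (one (k := k) 2 A) = ∑ i : A, pt i := by
    rw [app_comul, coef_one hA, one_smul]
  rw [bracketMap, app_comp, app_whiskerRight, h1]
  have h2 : tmul (M := V k ⊗ V k) e (∑ i : A, pt i) x = ∑ i : A, tmul (M := V k ⊗ V k) e (pt i) x := by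
    rw [map_sum, LinearMap.sum_apply]
  rw [h2, map_sum]
  refine (Finset.sum_congr rfl fun i _ => key i).trans ?_
  rw [Finset.sum_add_distrib, sum_compl_pair hA fun a => ∑ b : B,
    (tmul ((Equiv.swap (Sum.inl a) (Sum.inr b)).trans e) (one 2 A) x : (std 2 ⊗ M : FBMod k).ev S)]
  congr 1
  rw [Finset.sum_const, Finset.card_univ, ← Nat.card_eq_fintype_card, hA, two_mul, add_smul, two_smul]

section

variable {M : FBMod k} {A B A' B' S : FB} {e : A ⊕ B ≃ S} {e' : A' ⊕ B' ≃ S}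

/-- A transposition of a point of `A'` with a point of `B'` changes the pair, so only the diagonal
term has a component here. -/
theorem comp_bracketMap_same (δ : k) (hA : Nat.card A' = 2) (s : FB.Same e e') (x : M.ev B') :
    comp e (app (bracketMap (glStd δ M)) S (tmul e' (one 2 A') x)) =
      (2 * δ) • M.mp s.right x := by
  classical
  rw [app_bracketMap δ e' hA, map_add, map_smul, comp_tmul_same s, coef_one hA, one_smul, map_sum]
  refine (congrArg _ (Finset.sum_eq_zero fun a _ => ?_)).trans (add_zero _)
  rw [map_sum]
  refine Finset.sum_eq_zero fun b _ => comp_tmul_not ?_ _ _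
  rintro ⟨t⟩
  have h1 := t.eq (Sum.inl a)
  rw [Equiv.trans_apply, Equiv.swap_apply_left, s.eq] at h1
  simp at h1

/-- A transposition moves only one point of the pair; the other stays outside the first part of `e`.
-/
theorem comp_bracketMap_disj (δ : k) (hA : Nat.card A' = 2) (D : FB.Disj e e') (x : M.ev B') :
    comp e (app (bracketMap (glStd δ M)) S (tmul e' (one 2 A') x)) = 0 := by
  classical
  have hne : ∀ a a', e' (Sum.inl a) ≠ e (Sum.inl a') := fun a a' h => by
    rw [D.inl_right] at h
    simp at h
  have : Nontrivial A' := Finite.one_lt_card_iff_nontrivial.1 (by omega)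
  rw [app_bracketMap δ e' hA, map_add, map_smul, comp_tmul_not, smul_zero, zero_add, map_sum]
  · refine Finset.sum_eq_zero fun a _ => ?_
    rw [map_sum]
    refine Finset.sum_eq_zero fun b _ => comp_tmul_not ?_ _ _
    rintro ⟨t⟩
    obtain ⟨a', h⟩ := exists_ne a
    refine hne a' _ (Eq.trans ?_ (t.eq (Sum.inl a')))
    rw [Equiv.trans_apply, Equiv.swap_apply_of_ne_of_ne (by simpa using h) (by simp)]
  · rintro ⟨t⟩
    obtain ⟨a, -⟩ := exists_pair_ne A'
    exact hne a _ (t.eq (Sum.inl a))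

/-- Exactly one transposition turns the pair of `e'` into that of `e`: the point `l` has to leave,
and `i` has to take its place. In terms of `e'`, these are `s.left.symm i` and `s.right.symm l`. -/
theorem comp_bracketMap_meet (δ : k) (hA : Nat.card A' = 2) (m : FB.Meet e e') (x : M.ev B') :
    comp e (app (bracketMap (glStd δ M)) S (tmul e' (one 2 A') x)) = M.mp m.same.right x := by
  classical
  obtain ⟨i, l, s⟩ := m
  have hs : ∀ y, e' y = e (Equiv.swap (Sum.inl i) (Sum.inr l) (Sum.map s.left s.right y)) :=
    fun y => (s.eq y).trans (congrArg e (swap_apply_congr _ _ _ _ _))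
  have h0 : e' (Sum.inl (s.left.symm i)) = e (Sum.inr l) := by simp [hs]
  have hne : ∀ a', e' (Sum.inl (s.left.symm i)) ≠ e (Sum.inl a') := fun a' h => by
    rw [h0] at h
    simp at h
  rw [app_bracketMap δ e' hA, map_add, map_smul, comp_tmul_not, smul_zero, zero_add, map_sum,
    Fintype.sum_eq_single (s.left.symm i), map_sum, Fintype.sum_eq_single (s.right.symm l),
    comp_tmul_same ⟨s.left, s.right, ?_⟩, coef_one hA, one_smul]
  · intro y
    refine (hs _).trans (congrArg e ?_)
    -- Transported to `A ⊔ B`, the transposition becomes that of `i` and `l`, and cancels the one in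
    -- `Meet`.
    refine (congrArg _ (map_swap_apply _ inferInstance (Equiv.sumCongr s.left s.right).injective _ _ y)).trans ?_
    simp only [Equiv.sumCongr_apply, Sum.map_inl, Sum.map_inr, Equiv.apply_symm_apply]
    exact Equiv.swap_apply_self _ _ _
  · intro b hb
    refine comp_tmul_not ?_ _ _
    rintro ⟨t⟩
    have h1 := t.eq (Sum.inl (s.left.symm i))
    rw [Equiv.trans_apply, Equiv.swap_apply_left, hs, Sum.map_inr, Equiv.swap_apply_of_ne_of_ne] at h1
    · simp at h1
    · simp
    · intro h
      refine hb ?_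
      exact (Equiv.eq_symm_apply _).2 (Sum.inr_injective h)
  · intro a ha
    rw [map_sum]
    refine Finset.sum_eq_zero fun b _ => comp_tmul_not ?_ _ _
    rintro ⟨t⟩
    refine hne _ (Eq.trans ?_ (t.eq (Sum.inl (s.left.symm i))))
    rw [Equiv.trans_apply, Equiv.swap_apply_of_ne_of_ne (by simpa using ha.symm) (by simp)]
  · rintro ⟨t⟩
    exact hne _ (t.eq _)

end

end

end FBMod

namespace FB

variable {A B A' B' T : FB} {e : A ⊕ B ≃ T} {e' : A' ⊕ B' ≃ T}

theorem Same.not_disj (h : Nat.card A = 2) (s : Same e e') : ¬ Nonempty (Disj e e') := by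
  rintro ⟨D⟩
  obtain ⟨⟨a⟩, -⟩ := Nat.card_pos_iff.1 (h ▸ two_pos)
  have h1 := s.eq (Sum.inl (s.left.symm a))
  rw [D.inl_right] at h1
  simp at h1

theorem Meet.not_disj (h : Nat.card A = 2) (m : Meet e e') : ¬ Nonempty (Disj e e') := by
  classical
  rintro ⟨D⟩
  have : Nontrivial A := Finite.one_lt_card_iff_nontrivial.1 (by omega)
  obtain ⟨a, ha⟩ := exists_ne m.i
  have h1 := m.same.eq (Sum.inl (m.same.left.symm a))
  rw [D.inl_right, Equiv.trans_apply, Sum.map_inl, Equiv.apply_symm_apply,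
    Equiv.swap_apply_of_ne_of_ne (by simpa using ha) (by simp)] at h1
  simp at h1

end FB

namespace FBMod

noncomputable section

variable {k : Type u} [CommRing k] {n m : ℕ}

attribute [local irreducible] FBMod.app

theorem app_swap_disj {V W M : FBMod k} {A B A' B' S : FB} {e : A ⊕ B ≃ S} {e' : A' ⊕ B' ≃ S}
    (D : FB.Disj e e') (v : V.ev A) (w : W.ev A') (x : M.ev D.rest) :
    app (Curried.swap V W M) S (tmul e v (tmul D.p w x)) = tmul e' w (tmul D.q v x) := by
  have h : (tmul D.q v x : (V ⊗ M : FBMod k).ev B') =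
      (V ⊗ M : FBMod k).mp (S := FB.sum A D.rest) D.q
        (tmul (S := FB.sum A D.rest) (Equiv.refl _) v x) :=
    (mp_tmul' (S := FB.sum A D.rest) D.q (Equiv.refl _) v x).symm
  rw [app_swap, h]
  refine Eq.trans (tmul_eq ?_ _ _) (tmul_mp_right (B := FB.sum A D.rest) D.q e' w _).symm
  rintro (z | z | z)
  · exact (D.inl_right z).symm
  · exact D.inl_left z
  · exact D.inr z

theorem std_tensor₂_hom_ext {N P : FBMod k} {φ ψ : std n ⊗ std m ⊗ N ⟶ P}
    (h : ∀ (S A B A' C : FB) (e : A ⊕ B ≃ S) (e' : A' ⊕ C ≃ B), Nat.card A = n → Nat.card A' = m →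
      ∀ x : N.ev C, app φ S (tmul e (one n A) (tmul e' (one m A') x)) =
        app ψ S (tmul e (one n A) (tmul e' (one m A') x))) : φ = ψ :=
  triple_hom_ext' fun S A B A' C e e' v w x => by
    by_cases hA : Nat.card A = n
    · by_cases hA' : Nat.card A' = m
      · have := h S A B A' C e e' hA hA' x
        rw [← coef_smul_one v, ← coef_smul_one w]
        simp only [map_smul, LinearMap.smul_apply]
        refine congrArg _ (congrArg _ this)
      · rw [← coef_smul_one w, coef_eq_zero hA']
        simp
    · rw [← coef_smul_one v, coef_eq_zero hA]
      simp

variable {M : FBMod k} (b : std 2 ⊗ M ⟶ M) (b' : M ⟶ std 2 ⊗ M)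

theorem comp_commutator {A B A' B' S : FB} (e : A ⊕ B ≃ S) (e' : A' ⊕ B' ≃ S) (x : M.ev B') :
    comp e (app (b ≫ b' - std 2 ◁ b' ≫ Curried.swap (std 2) (std 2) M ≫ std 2 ◁ b) S
      (tmul e' (one 2 A') x)) =
    comp e (app b' S (app b S (tmul e' (one 2 A') x))) -
      app b B (comp e (app (Curried.swap (std 2) (std 2) M) S (tmul e' (one 2 A') (app b' B' x)))) := by
  rw [app_sub, map_sub, app_comp, app_comp, app_comp, comp_whiskerLeft, app_whiskerLeft]

end

end FBMod

/-! ### Cup and cap relations versus the axioms of the curried symplectic algebra. -/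

namespace CupCap

open FBMod

noncomputable section

variable {k : Type u} [CommRing k] {δ : k} {M : FBMod k} {b : std 2 ⊗ M ⟶ M} {b' : M ⟶ std 2 ⊗ M}

attribute [local irreducible] FBMod.app

/-- The operators attached to cups and caps, given by maps `b` and `b'` that satisfy the relations
between the generators of the curried symplectic algebra. -/
def ofMaps (hb : std 2 ◁ b ≫ b = (Curried.swap (std 2) (std 2) M ≫ std 2 ◁ b) ≫ b)
    (hb' : b' ≫ std 2 ◁ b' ≫ Curried.swap (std 2) (std 2) M = b' ≫ std 2 ◁ b')
    (hbb' : b ≫ b' - std 2 ◁ b' ≫ Curried.swap (std 2) (std 2) M ≫ std 2 ◁ b =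
      bracketMap (glStd δ M)) : CupCap (2 * δ) M where
  cup {A B S} e _ := app b S ∘ₗ tmul e (one 2 A)
  cap {A B S} e _ := comp e ∘ₗ app b' S
  cup_congr {A B S A' B' S'} e h e' h' f g v H x := by
    rw [LinearMap.comp_apply, LinearMap.comp_apply, ← app_mp, mp_tmul', ← mp_one 2 f, tmul_mp]
    exact congrArg _ (tmul_eq (fun z => (H z).symm) _ _)
  cap_congr {A B S A' B' S'} e h e' h' f g v H y := by
    rw [LinearMap.comp_apply, LinearMap.comp_apply, app_mp]
    exact comp_mp e e' f g v H _
  cup_cup {A B A' B' T e e'} h h' D x := by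
    have h1 := congrArg (fun φ => app φ T (tmul e (one 2 A) (tmul D.p (one 2 A') x))) hb
    simp only [app_comp] at h1
    rw [app_swap_disj D, app_whiskerLeft, app_whiskerLeft] at h1
    exact h1
  cap_cap {A B A' B' T e e'} h h' D y := by
    have h1 := congrArg (fun φ => comp D.p (comp e (app φ T y))) hb'
    simp only [app_comp] at h1
    rw [comp_comp_swap D, comp_whiskerLeft, comp_whiskerLeft] at h1
    exact h1.symm
  -- In this and the next two fields, the component at `e` of the bracket relation is evaluated on
  -- `t^{A'} ⊗ x`. The term `b₁ b'₂` vanishes unless the pairs are disjoint, and then it is the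
  -- right-hand side of `cap_cup_disj`.
  cap_cup_same {A B A' B' T e e'} h h' s x := by
    have h1 := comp_commutator b b' e e' x
    rw [hbb', comp_bracketMap_same δ h' s x, comp_swap_not_disj (s.not_disj h), map_zero,
      sub_zero] at h1
    exact h1.symm
  cap_cup_meet {A B A' B' T e e'} h h' m x := by
    have h1 := comp_commutator b b' e e' x
    rw [hbb', comp_bracketMap_meet δ h' m x, comp_swap_not_disj (m.not_disj h), map_zero,
      sub_zero] at h1
    exact h1.symm
  cap_cup_disj {A B A' B' T e e'} h h' D x := by
    have h1 := comp_commutator b b' e e' x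
    rw [hbb', comp_bracketMap_disj δ h' D x, comp_swap_disj D] at h1
    exact sub_eq_zero.1 h1.symm

section

variable (R : CupCap (2 * δ) M)
  (hcup : ∀ {A B S : FB} (e : A ⊕ B ≃ S) (h : Nat.card A = 2) (x : M.ev B),
    app b S (tmul e (one 2 A) x) = R.cup e h x)
  (hcap : ∀ {A B S : FB} (e : A ⊕ B ≃ S) (h : Nat.card A = 2) (y : M.ev S),
    comp e (app b' S y) = R.cap e h y)

include hcup in
theorem b_comm : std 2 ◁ b ≫ b = (Curried.swap (std 2) (std 2) M ≫ std 2 ◁ b) ≫ b := by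
  refine std_tensor₂_hom_ext fun S A B A' C e p hA hA' x => ?_
  let D := FB.disjSwap e p
  have h1 : app (Curried.swap (std 2) (std 2) M) S (tmul e (one 2 A) (tmul p (one 2 A') x)) = _ :=
    app_swap_disj D (one 2 A) (one 2 A') x
  rw [app_comp, app_comp, app_comp, h1, app_whiskerLeft, app_whiskerLeft, hcup p hA', hcup e hA]
  exact (R.cup_cup hA hA' D x).trans ((congrArg _ (congrArg _ (hcup D.q hA x))).trans
    (hcup _ hA' _)).symm

include hcap in
theorem b'_comm : b' ≫ std 2 ◁ b' ≫ Curried.swap (std 2) (std 2) M = b' ≫ std 2 ◁ b' := by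
  refine hom_ext fun S => LinearMap.ext fun y => comp_ext fun A B e hA => comp_ext
    fun A' C p hA' => ?_
  let D := FB.disjSwap e p
  rw [app_comp, app_comp, app_comp]
  refine (comp_comp_swap D _).trans ?_
  rw [comp_whiskerLeft, comp_whiskerLeft, hcap e hA, hcap p hA', hcap D.q hA, hcap _ hA']
  exact (R.cap_cap hA hA' D y).symm

include hcup hcap in
-- The converse of the last three fields of `ofMaps`: a map out of `Div² ⊗ M` is tested on the
-- `t^{A'} ⊗ x`, its values are tested on components, and the three relative positions of the pairs
-- exhaust all cases.
theorem commutator : b ≫ b' - std 2 ◁ b' ≫ Curried.swap (std 2) (std 2) M ≫ std 2 ◁ b =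
    bracketMap (glStd δ M) := by
  refine std_tensor_hom_ext fun S A' B' e' hA' x => comp_ext fun A B e hA => ?_
  rw [comp_commutator, hcup e' hA', hcap e hA]
  rcases FB.trichotomy e e' hA hA' with ⟨⟨s⟩⟩ | ⟨⟨D⟩⟩ | ⟨⟨m⟩⟩
  · rw [comp_bracketMap_same δ hA' s, comp_swap_not_disj (s.not_disj hA), map_zero, sub_zero]
    exact R.cap_cup_same hA hA' s x
  · rw [comp_bracketMap_disj δ hA' D, comp_swap_disj D, hcup D.p hA', hcap D.q hA]
    exact sub_eq_zero.2 (R.cap_cup_disj hA hA' D x)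
  · rw [comp_bracketMap_meet δ hA' m, comp_swap_not_disj (m.not_disj hA), map_zero, sub_zero]
    exact R.cap_cup_meet hA hA' m x

include hcup hcap in
-- Representation and equivariance hold for arbitrary `b` and `b'`; only the other three axioms use
-- the relations in `R`.
theorem isSpModule : (⟨M, glStd δ M, b, b'⟩ : Curried.SpData (squares k)).IsSpModule where
  gl := isGlRep_glStd δ M
  b_comm := R.b_comm hcup
  b'_comm := R.b'_comm hcap
  b_equivariant := b_equivariant δ b
  b'_equivariant := b'_equivariant δ b'
  bracket := R.commutator hcup hcap

end

end

end CupCap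

namespace FBMod

variable {k : Type u} [CommRing k] {n : ℕ}

theorem comp_tmul_cut {N : FBMod k} {A B S : FB} {e : A ⊕ B ≃ S} {T : Set S}
    (h : T ≠ Set.range fun a => e (Sum.inl a)) (v : (std (k := k) n).ev (FB.sub T))
    (x : N.ev (FB.sub Tᶜ)) : comp e (tmul (cut T) v x) = 0 := by
  refine comp_tmul_not ?_ _ _
  rintro ⟨s⟩
  refine h (Set.ext fun t => ⟨fun ht => ?_, ?_⟩)
  · exact ⟨s.left ⟨t, ht⟩, (s.eq (Sum.inl ⟨t, ht⟩)).symm⟩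
  · rintro ⟨a, rfl⟩
    have := s.eq (Sum.inl (s.left.symm a))
    rw [Sum.map_inl, Equiv.apply_symm_apply] at this
    dsimp only
    rw [← this]
    exact (s.left.symm a).2

end FBMod

/-! ### Modules over the Brauer category give standard symplectic modules. -/

namespace Brauer

open BrauerDiagram FBMod

noncomputable section

variable {k : Type u} [CommRing k] {δ : k}

theorem act_act_smul (N : Mod δ) {S T U : FB} (d : BrauerDiagram S T) (d' : BrauerDiagram T U)
    (x : (res.obj N).ev S) :
    act N d' (act N d x) = δ ^ loops d d' • act N (d.comp d') x := by
  have := N.property.2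
  have h := N.obj.map_comp (diag δ d) (diag δ d')
  rw [diag_comp, N.obj.map_smul] at h
  exact (congrArg (fun f => f.hom x) h).symm

/-- The operators attached to cups and caps on a module over the Brauer category. -/
def cupCap (N : Mod δ) : CupCap δ (res.obj N) where
  cup e h := act N (cup e h)
  cap e h := act N (cap e h)
  cup_congr e h e' h' f g v H x := by rw [← cup_congr e h e' h' f g v H, relabel_act]
  cap_congr e h e' h' f g v H y := by rw [← cap_congr e h e' h' f g v H, relabel_act]
  cup_cup h h' D x := by
    rw [act_act _ _ _ (loops_cup _ _ _), act_act _ _ _ (loops_cup _ _ _), cup_comp_cup_of_disj]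
  cap_cap h h' D y := by
    rw [act_act _ _ _ (loops_cap _ _ _), act_act _ _ _ (loops_cap _ _ _), cap_comp_cap_of_disj]
  cap_cup_same h h' s x := by
    obtain ⟨h1, h2⟩ := cup_comp_cap_of_same (h := h) (h' := h') s
    rw [act_act_smul, h1, h2, pow_one, mp_eq]
  cap_cup_meet h h' m x := by
    obtain ⟨h1, h2⟩ := cup_comp_cap_of_meet (h := h) (h' := h') m
    rw [act_act _ _ _ h2, h1, mp_eq]
  cap_cup_disj h h' D x := by
    obtain ⟨h1, h2⟩ := cup_comp_cap_of_disj (h := h) (h' := h') D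
    rw [act_act _ _ _ h2, h1, act_act _ _ _ (loops_cup _ _ _)]

theorem app_cupMap_one (N : Mod δ) {A B S : FB} (e : A ⊕ B ≃ S) (h : Nat.card A = 2)
    (x : (res.obj N).ev B) : app (cupMap N) S (tmul e (one 2 A) x) = act N (cup e h) x := by
  rw [app_cupMap N e h, coef_one h, one_smul]

/-- Of the sum over all subsets, only the summand of the image of `A` has a component at `e`. -/
theorem comp_capMap (N : Mod δ) {A B S : FB} (e : A ⊕ B ≃ S) (h : Nat.card A = 2)
    (y : (res.obj N).ev S) : comp e (app (capMap N) S y) = act N (cap e h) y := by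
  classical
  let T : Set S := Set.range fun a => e (Sum.inl a)
  have s : FB.Same e (cut T) := ⟨(leftPart e).symm, (rightPart e).symm, by
    intro x
    obtain ⟨z, rfl⟩ := (Equiv.sumCongr (leftPart e) (rightPart e)).surjective x
    rcases z with z | z <;> simp <;> rfl⟩
  have hT : Nat.card (FB.sub T) = 2 := (Nat.card_congr (leftPart e)).symm.trans h
  rw [app_capMap, map_sum, Fintype.sum_eq_single T]
  · rw [capTerm, dif_pos hT, LinearMap.comp_apply, comp_tmul_same s, coef_one hT, one_smul]
    exact ((cupCap N).cap_congr (cut T) hT e h s.left s.right (Equiv.refl S) s.eq y).symm.trans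
      (congrArg _ (mp_refl _ _))
  · intro T' hT'
    rw [capTerm]
    split_ifs with h'
    · exact comp_tmul_cut hT' _ _
    · exact map_zero _

/-- By `Act.unique` it suffices that the given action is itself built up from the generators, and
this is `generation`. -/
theorem op_eq_act {N : Mod δ} (R : CupCap δ (res.obj N))
    (hcup : ∀ {A B S : FB} (e : A ⊕ B ≃ S) (h : Nat.card A = 2), R.cup e h = act N (cup e h))
    (hcap : ∀ {A B S : FB} (e : A ⊕ B ≃ S) (h : Nat.card A = 2), R.cap e h = act N (cap e h))
    {S T : FB} (d : BrauerDiagram S T) : R.op d = act N d := by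
  refine (R.act_op d).unique (generation (P := fun {S T} d => R.Act d (act N d))
    (fun f => .ofEquiv f) (fun d e h H => ?_) (fun d e h H => ?_) d)
  · rw [show act N (d.comp (cup e h)) = R.cup e h ∘ₗ act N d from
      LinearMap.ext fun x => (act_act N _ _ (loops_cup _ _ _) x).symm.trans
        (LinearMap.congr_fun (hcup e h).symm _)]
    exact .cup _ _ _ _ H
  · rw [show act N ((cap e h).comp d) = act N d ∘ₗ R.cap e h from
      LinearMap.ext fun x => (act_act N _ _ (loops_cap _ _ _) x).symm.trans
        (congrArg _ (LinearMap.congr_fun (hcap e h).symm _))]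
    exact .cap _ _ _ _ H

theorem isStandardSpRep (δ : k) (N : Mod (2 * δ)) : IsStandardSpRep δ ((toSpData δ).obj N) :=
  ⟨(cupCap N).isSpModule (app_cupMap_one N) (comp_capMap N), rfl⟩

end

end Brauer

/-! ### Modules over the Brauer category from operators for cups and caps. -/

namespace CupCap

noncomputable section

variable {k : Type u} [CommRing k] {δ : k} {M N : FBMod k}

/-- Compatibility with bijections is part of being a map of species, so cups and caps suffice by
`generation`. -/
theorem app_op (R : CupCap δ M) (R' : CupCap δ N) (φ : M ⟶ N)
    (hcup : ∀ {A B S : FB} (e : A ⊕ B ≃ S) (h : Nat.card A = 2) (x : M.ev B),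
      FBMod.app φ S (R.cup e h x) = R'.cup e h (FBMod.app φ B x))
    (hcap : ∀ {A B S : FB} (e : A ⊕ B ≃ S) (h : Nat.card A = 2) (y : M.ev S),
      FBMod.app φ B (R.cap e h y) = R'.cap e h (FBMod.app φ S y))
    {S T : FB} (d : BrauerDiagram S T) (x : M.ev S) :
    FBMod.app φ T (R.op d x) = R'.op d (FBMod.app φ S x) := by
  refine BrauerDiagram.generation (P := fun {S T} d => ∀ x : M.ev S,
    FBMod.app φ T (R.op d x) = R'.op d (FBMod.app φ S x)) ?_ ?_ ?_ d x
  · intro S T f x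
    rw [op_ofEquiv, op_ofEquiv, FBMod.app_mp]
  · intro S T A B d e h ih x
    rw [op_comp_cup, op_comp_cup, LinearMap.comp_apply, LinearMap.comp_apply, hcup, ih]
  · intro S T A B d e h ih x
    rw [op_cap_comp, op_cap_comp, LinearMap.comp_apply, LinearMap.comp_apply, ih, hcap]

/-- The linear extension of `op` to linear combinations of diagrams. -/
def lin (R : CupCap δ M) (S T : FB) : (BrauerDiagram S T →₀ k) →ₗ[k] M.ev S →ₗ[k] M.ev T :=
  Finsupp.linearCombination k R.op

theorem lin_single (R : CupCap δ M) {S T : FB} (d : BrauerDiagram S T) (a : k) :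
    R.lin S T (Finsupp.single d a) = a • R.op d :=
  Finsupp.linearCombination_single _ _ _

/-- The bilinear extension of `op_op`; the power of `δ` in the composition of diagrams accounts for
the loops. -/
theorem lin_comp (R : CupCap δ M) {S T U : FB} (f : BrauerDiagram S T →₀ k)
    (g : BrauerDiagram T U →₀ k) (x : M.ev S) :
    R.lin S U (Brauer.compₗ δ S T U f g) x = R.lin T U g (R.lin S T f x) := by
  induction f using Finsupp.induction_linear with
  | zero => simp
  | add f f' hf hf' => simp only [map_add, LinearMap.add_apply, hf, hf']
  | single d a =>
    induction g using Finsupp.induction_linear with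
    | zero => simp
    | add f f' hf hf' => simp only [map_add, LinearMap.add_apply, hf, hf']
    | single d' b =>
      rw [Brauer.compₗ_single, lin_single, lin_single, lin_single, LinearMap.smul_apply,
        LinearMap.smul_apply, LinearMap.smul_apply, map_smul, op_op, smul_smul, smul_smul]
      congr 1
      ring

theorem app_lin (R : CupCap δ M) (R' : CupCap δ N) (φ : M ⟶ N)
    (hcup : ∀ {A B S : FB} (e : A ⊕ B ≃ S) (h : Nat.card A = 2) (x : M.ev B),
      FBMod.app φ S (R.cup e h x) = R'.cup e h (FBMod.app φ B x))
    (hcap : ∀ {A B S : FB} (e : A ⊕ B ≃ S) (h : Nat.card A = 2) (y : M.ev S),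
      FBMod.app φ B (R.cap e h y) = R'.cap e h (FBMod.app φ S y))
    {S T : FB} (f : BrauerDiagram S T →₀ k) (x : M.ev S) :
    FBMod.app φ T (R.lin S T f x) = R'.lin S T f (FBMod.app φ S x) := by
  induction f using Finsupp.induction_linear with
  | zero => simp
  | add f f' hf hf' => simp only [map_add, LinearMap.add_apply, hf, hf']
  | single d a =>
    rw [lin_single, lin_single, LinearMap.smul_apply, LinearMap.smul_apply, map_smul,
      app_op R R' φ hcup hcap]

/-- The module over the Brauer category given by operators attached to cups and caps. -/
def toMod (R : CupCap δ M) : Brauer.Mod δ where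
  obj :=
    { obj S := M.ev S.set
      map {S T} f := ModuleCat.ofHom (R.lin S.set T.set f)
      map_id S := by
        refine ModuleCat.hom_ext (LinearMap.ext fun x => ?_)
        refine (LinearMap.congr_fun (R.lin_single _ _) x).trans ?_
        rw [one_smul, op_ofEquiv]
        exact FBMod.mp_refl M x
      map_comp f g := ModuleCat.hom_ext (LinearMap.ext fun x => R.lin_comp f g x) }
  property := ⟨⟨fun {S T f g} => ModuleCat.hom_ext (map_add (R.lin S.set T.set)
      (show BrauerDiagram S.set T.set →₀ k from f) (show BrauerDiagram S.set T.set →₀ k from g))⟩,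
    ⟨fun {S T} f c => ModuleCat.hom_ext (map_smul (R.lin S.set T.set) c
      (show BrauerDiagram S.set T.set →₀ k from f))⟩⟩

theorem act_toMod (R : CupCap δ M) {S T : FB} (d : BrauerDiagram S T) :
    Brauer.act R.toMod d = R.op d :=
  (R.lin_single d 1).trans (one_smul _ _)

/-- The morphism of modules over the Brauer category given by a map compatible with cups and caps. -/
def toModMap (R : CupCap δ M) (R' : CupCap δ N) (φ : M ⟶ N)
    (hcup : ∀ {A B S : FB} (e : A ⊕ B ≃ S) (h : Nat.card A = 2) (x : M.ev B),
      FBMod.app φ S (R.cup e h x) = R'.cup e h (FBMod.app φ B x))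
    (hcap : ∀ {A B S : FB} (e : A ⊕ B ≃ S) (h : Nat.card A = 2) (y : M.ev S),
      FBMod.app φ B (R.cap e h y) = R'.cap e h (FBMod.app φ S y)) : R.toMod ⟶ R'.toMod :=
  ObjectProperty.homMk
    { app S := ModuleCat.ofHom (FBMod.app φ S.set)
      naturality S T f := by
        refine ModuleCat.hom_ext (LinearMap.ext fun x => ?_)
        change FBMod.app φ T.set (R.lin S.set T.set f x) = R'.lin S.set T.set f (FBMod.app φ S.set x)
        exact app_lin R R' φ hcup hcap f x }

end

end CupCap

/-! ### The two composites are equal to the identity functors. -/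

theorem CategoryTheory.NatTrans.hext {C D : Type*} [Category C] [Category D] {F F' G G' : C ⥤ D}
    (hF : F = F') (hG : G = G') {α : F ⟶ G} {β : F' ⟶ G'} (h : ∀ X, α.app X ≍ β.app X) : α ≍ β := by
  subst hF hG
  exact heq_of_eq (NatTrans.ext (funext fun X => eq_of_heq (h X)))

theorem CategoryTheory.ObjectProperty.hom_hext {C : Type*} [Category C] {P : ObjectProperty C}
    {X X' Y Y' : P.FullSubcategory} (hX : X = X') (hY : Y = Y') {f : X ⟶ Y} {g : X' ⟶ Y'}
    (h : f.hom ≍ g.hom) : f ≍ g := by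
  subst hX hY
  exact heq_of_eq (ObjectProperty.hom_ext _ (eq_of_heq h))

namespace FBMod

variable {k : Type u} [CommRing k]

open Curried in
theorem spData_hom_hext {X X' Y Y' : SpData (squares k)} (hX : X = X') (hY : Y = Y') {f : X ⟶ Y}
    {g : X' ⟶ Y'} (h : f.hom ≍ g.hom) : f ≍ g := by
  subst hX hY
  exact heq_of_eq (SpData.Hom.ext (eq_of_heq h))

/-- In the application, the two species have the same modules by definition but equal actions of
bijections only by a theorem. Hence elements are compared heterogeneously; once the species are
identified, `b` and `c` are recovered from their cups and caps. -/
theorem spData_eq {δ : k} {M M' : FBMod k} (hM : M = M') {b : std 2 ⊗ M ⟶ M}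
    {c : M ⟶ std 2 ⊗ M} {b' : std 2 ⊗ M' ⟶ M'} {c' : M' ⟶ std 2 ⊗ M'}
    (hb : ∀ {A B S : FB} (e : A ⊕ B ≃ S) (_ : Nat.card A = 2) (x : M.ev B) (x' : M'.ev B), x ≍ x' →
      app b S (tmul e (one 2 A) x) ≍ app b' S (tmul e (one 2 A) x'))
    (hc : ∀ {A B S : FB} (e : A ⊕ B ≃ S) (_ : Nat.card A = 2) (y : M.ev S) (y' : M'.ev S), y ≍ y' →
      comp e (app c S y) ≍ comp e (app c' S y')) :
    (⟨M, glStd δ M, b, c⟩ : Curried.SpData (squares k)) = ⟨M', glStd δ M', b', c'⟩ := by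
  subst hM
  have h1 : b = b' := std_tensor_hom_ext fun S A B e h x => eq_of_heq (hb e h x x HEq.rfl)
  have h2 : c = c' := hom_ext fun S => LinearMap.ext fun y => comp_ext fun A B e h =>
    eq_of_heq (hc e h y y HEq.rfl)
  rw [h1, h2]

end FBMod

namespace Brauer

open FBMod

noncomputable section

variable {k : Type u} [CommRing k] {δ : k}

/-- The underlying modules agree by definition, so only the actions of morphisms need comparison.
Both are linear, which reduces this to single diagrams and `op_eq_act`. -/
theorem toMod_eq {N : Mod δ} (R : CupCap δ (res.obj N))
    (hcup : ∀ {A B S : FB} (e : A ⊕ B ≃ S) (h : Nat.card A = 2),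
      R.cup e h = act N (BrauerDiagram.cup e h))
    (hcap : ∀ {A B S : FB} (e : A ⊕ B ≃ S) (h : Nat.card A = 2),
      R.cap e h = act N (BrauerDiagram.cap e h)) : R.toMod = N := by
  refine ObjectProperty.FullSubcategory.ext (Functor.hext (fun _ => rfl) fun S T f =>
    heq_of_eq (ModuleCat.hom_ext ?_))
  have := N.property.1
  have := N.property.2
  change R.lin S.set T.set f = (N.obj.map f).hom
  let L : (BrauerDiagram S.set T.set →₀ k) →ₗ[k] ((res.obj N).ev S.set →ₗ[k] (res.obj N).ev T.set) :=
    { toFun f := (N.obj.map (X := S) (Y := T) f).hom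
      map_add' f g := congrArg ModuleCat.Hom.hom (N.obj.map_add (X := S) (Y := T) (f := f) (g := g))
      map_smul' c f := congrArg ModuleCat.Hom.hom (N.obj.map_smul (X := S) (Y := T) c f) }
  refine LinearMap.congr_fun (f := R.lin S.set T.set) (g := L)
    (Finsupp.lhom_ext' fun d => LinearMap.ext_ring ?_) f
  exact (R.lin_single d 1).trans ((one_smul _ _).trans (op_eq_act R hcup hcap d))

/-- The operators attached to cups and caps on a `δ`-standard module over the curried symplectic
algebra. -/
def cupCapOfRep (X : (IsStandardSpRep δ).FullSubcategory) : CupCap (2 * δ) X.obj.M :=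
  CupCap.ofMaps (b := X.obj.b) (b' := X.obj.b') X.property.1.b_comm X.property.1.b'_comm (by
    have h := X.property.1.bracket
    rw [X.property.2] at h
    exact h)

/-- The functor from `δ`-standard modules over the curried symplectic algebra to modules over the
Brauer category with parameter `2δ`. -/
def ofRep (δ : k) : (IsStandardSpRep δ).FullSubcategory ⥤ Mod (2 * δ) where
  obj X := (cupCapOfRep X).toMod
  map {X Y} φ := (cupCapOfRep X).toModMap (cupCapOfRep Y) φ.hom.hom
    (fun {A B S} e h x => by
      have h1 := congrArg (fun f => app f S (tmul e (one 2 A) x)) φ.hom.comm_b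
      exact h1.trans (congrArg (app Y.obj.b S) (app_whiskerLeft _ _ _ _ _)))
    (fun {A B S} e h y => by
      have h1 := congrArg (fun f => comp e (app f S y)) φ.hom.comm_b'
      exact (comp_whiskerLeft φ.hom.hom e (app X.obj.b' S y)).symm.trans h1)
  map_id _ := rfl
  map_comp _ _ := rfl

theorem toSpData_ofRep (X : (IsStandardSpRep δ).FullSubcategory) :
    (toSpData δ).obj ((ofRep δ).obj X) = X.obj := by
  -- Standardness determines `a`, which leaves only the species, `b` and `b'` to be compared.
  obtain ⟨⟨M, a, b, b'⟩, hX, rfl : a = glStd δ M⟩ := X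
  set X : (IsStandardSpRep δ).FullSubcategory := ⟨⟨M, glStd δ M, b, b'⟩, hX, rfl⟩
  -- The diagram of a bijection acts through the original species.
  have hM : res.obj ((ofRep δ).obj X) = M :=
    Functor.hext (fun _ => rfl) fun S T f => heq_of_eq (ModuleCat.hom_ext
      (((cupCapOfRep X).act_toMod _).trans ((cupCapOfRep X).op_ofEquiv (S := S) (T := T) f)))
  refine spData_eq hM (fun {A B S} e h x x' hx => ?_) (fun {A B S} e h y y' hy => ?_)
  · obtain rfl : x = x' := eq_of_heq hx
    rw [app_cupMap_one _ _ h]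
    refine heq_of_eq (LinearMap.congr_fun (((cupCapOfRep X).act_toMod _).trans
      ((cupCapOfRep X).op_cup e h)) x)
  · obtain rfl : y = y' := eq_of_heq hy
    rw [comp_capMap _ _ h]
    refine heq_of_eq (LinearMap.congr_fun (((cupCapOfRep X).act_toMod _).trans
      ((cupCapOfRep X).op_cap e h)) y)

end

end Brauer

theorem mainTheorem1 {k : Type u} [CommRing k] (δ : k) :
    ∃ h : ∀ M : Brauer.Mod (2 * δ), IsStandardSpRep δ ((Brauer.toSpData δ).obj M),
      ∃ Ψ : (IsStandardSpRep δ).FullSubcategory ⥤ Brauer.Mod (2 * δ),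
        (IsStandardSpRep δ).lift (Brauer.toSpData δ) h ⋙ Ψ = 𝟭 (Brauer.Mod (2 * δ)) ∧
        Ψ ⋙ (IsStandardSpRep δ).lift (Brauer.toSpData δ) h =
          𝟭 (IsStandardSpRep δ).FullSubcategory := by
  refine ⟨Brauer.isStandardSpRep δ, Brauer.ofRep δ, ?_, ?_⟩
  · let F := (IsStandardSpRep δ).lift (Brauer.toSpData δ) (Brauer.isStandardSpRep δ) ⋙ Brauer.ofRep δ
    have h0 : ∀ N, F.obj N = N := fun N =>
      Brauer.toMod_eq _ (fun e h => LinearMap.ext fun x => Brauer.app_cupMap_one N e h x)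
        (fun e h => LinearMap.ext fun y => Brauer.comp_capMap N e h y)
    refine Functor.hext h0 fun N N' φ => ObjectProperty.hom_hext (h0 N) (h0 N') ?_
    -- Morphisms keep their components, so once the objects are identified nothing remains to be
    -- checked.
    exact NatTrans.hext (α := (F.map φ).hom) (β := φ.hom) (congrArg (fun Z => Z.obj) (h0 N))
      (congrArg (fun Z => Z.obj) (h0 N')) fun S => HEq.rfl
  · let F := Brauer.ofRep δ ⋙ (IsStandardSpRep δ).lift (Brauer.toSpData δ) (Brauer.isStandardSpRep δ)
    have h0 : ∀ X, F.obj X = X := fun X =>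
      ObjectProperty.FullSubcategory.ext (Brauer.toSpData_ofRep X)
    refine Functor.hext h0 fun X Y φ => ObjectProperty.hom_hext (h0 X) (h0 Y)
      (FBMod.spData_hom_hext (congrArg (fun Z => Z.obj) (h0 X)) (congrArg (fun Z => Z.obj) (h0 Y)) ?_)
    exact NatTrans.hext (C := FB) (D := ModuleCat.{u} k) (α := (F.map φ).hom.hom) (β := φ.hom.hom)
      (congrArg (fun Z => Z.obj.M) (h0 X)) (congrArg (fun Z => Z.obj.M) (h0 Y)) fun S => HEq.rfl
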